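/- Let $R$ be an associative unital ring and $M$ an $R$-bimodule. **Notation.** Let $R\text{-proj}$ be the category of finitely generated projective left $R$-modules. For a ring $R'$, let $\mathcal B(R,R')$ be the abelian category of functors $F:R\text{-proj}\to R'\text{-mod}$ with $F(0)=0$, and put $\mathcal B(R)=\mathcal B(R,R)$. Let ${\sf I}\in\mathcal B(R)$ be the tautological functor $V\mapsto V$, let ${\sf I}(M)\in\mathcal B(R)$ be the functor $V\mapsto M\otimes_R V$, and let $H^2_M(R,M)=\operatorname{Ext}^2_{\mathcal B(R)}({\sf I},{\sf I}(M))$ be the second MacLane cohomology of $R$ with coefficients in $M$. Let $e_*:\mathcal B(R)\to\mathcal B(R,\mathbb Z)$ be the composition with the forgetful functor to abelian groups. A *square-zero extension* of $R$ by $M$ is a unital ring $R'$ with an exact sequence of abelian groups $0\to M\xrightarrow{i}R'\xrightarrow{q}R\to0$ in which $q$ is a unital ring map, $i(m)r'=i(m\,q(r'))$, $r'i(m)=i(q(r')m)$ and $i(m)i(m')=0$. Let $\mathrm{Sq}(R,M)$ be the set of their isomorphism classes. For such an $R'$, let $q_*:\mathcal B(R)\to\mathcal B(R,R')$ and $q^*:\mathcal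 B(R,R')\to\mathcal B(R)$ be the compositions with restriction of scalars along $q$ and with $V'\mapsto R\otimes_{R'}V'$. An *elementary extension* $\phi$ of an object $A$ by an object $B$ in an abelian category is an exact sequence $0\to B\xrightarrow{b}C_1\xrightarrow{d}C_0\xrightarrow{a}A\to0$. Morphisms are maps of such sequences that are the identity on $A$ and $B$. Let $\mathrm{El}(R,M)$ be the set of connected components of the category of elementary extensions of ${\sf I}$ by ${\sf I}(M)$ in $\mathcal B(R)$. A *splitting* of $\phi$ is an object $C_{01}$ with maps $c_1:C_1\to C_{01}$, $c_0:C_{01}\to C_0$ such that $c_0c_1=d$ and the sequences $0\to C_1\xrightarrow{c_1}C_{01}\xrightarrow{a c_0}A\to0$ and $0\to B\xrightarrow{c_1b}C_{01}\xrightarrow{c_0}C_0\to0$ are exact. If $\phi$ is an elementary extension of ${\sf I}$ by ${\sf I}(M)$ and $C_{01}$ is a splitting of $e_*\phi$ in $\mathcal B(R,\mathbb Z)$, an endomorphism $r'$ of $C_{01}$ is *regular over* $r\in R$ if $r'c_1=c_1r$ and $c_0r'=rc_0$, where $r$ also denotes the multiplication by $r$ on $e_*C_1$ and $e_*C_0$;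 it is *regular* if this holds for some $r$. **Theorem.** 1. For every square-zero extension $R'$, the object $q_*({\sf I})$ of $\mathcal B(R,R')$ has a projective resolution. For every projective resolution $P'_\bullet$ of it, $\tau_{[0,1]}q^*P'_\bullet$ is an elementary extension of ${\sf I}$ by ${\sf I}(M)$, where the map to ${\sf I}$ is induced by the augmentation and by $R\otimes_{R'}V\cong V$, and the map from ${\sf I}(M)$ is induced by the natural identification $H_1(q^*P'_\bullet(V))=\operatorname{Tor}^{R'}_1(R,V)\cong M\otimes_RV$ given by the connecting homomorphism of $0\to M\to R'\to R\to0$. Its class in $\mathrm{El}(R,M)$ depends only on the isomorphism class of $R'$. This gives a map $\Phi:\mathrm{Sq}(R,M)\to\mathrm{El}(R,M)$. 2. For every elementary extension $\phi$ of ${\sf I}$ by ${\sf I}(M)$, the extension $e_*\phi$ has a splitting $C_{01}$ in $\mathcal B(R,\mathbb Z)$. For every such splitting, the ring $R'$ of regular endomorphisms of $C_{01}$ is a square-zero extension of $R$ by $M$, where $q:R'\to R$ sends a regular endomorphism over $r$ to $r$, and $i:M\to R'$ sends $m$ to the composition of $ac_0:C_{01}\to e_*{\sf I}$, the map $v\mapsto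 m\otimes v$ from $e_*{\sf I}$ to $e_*{\sf I}(M)$, and $c_1b:e_*{\sf I}(M)\to C_{01}$. The isomorphism class of this square-zero extension depends only on the class of $\phi$ in $\mathrm{El}(R,M)$. This gives a map $\Psi:\mathrm{El}(R,M)\to\mathrm{Sq}(R,M)$. 3. The maps $\Phi$ and $\Psi$ are inverse to each other. 4. Sending an elementary extension to its Yoneda class gives a bijection $\mathrm{El}(R,M)\cong H^2_M(R,M)$. Hence its composition with $\Phi$ is a bijection $\mathrm{Sq}(R,M)\cong H^2_M(R,M)$. -/

import Mathlib

open CategoryTheory CategoryTheory.Limits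
open scoped TensorProduct

universe u v w

namespace SqEl

noncomputable section

/-! ### Elementary extensions in an abelian category -/

section Elementary

variable {E : Type v} [Category.{w} E] [Abelian E]

/-- An elementary extension of `A` by `B`: a complex `C₁ ⟶ C₀` in degrees `[0,1]` together with a
four-term exact sequence `0 ⟶ B ⟶ C₁ ⟶ C₀ ⟶ A ⟶ 0`. -/
structure ElemExt (A B : E) where
  C₁ : E
  C₀ : E
  b : B ⟶ C₁
  d : C₁ ⟶ C₀
  a : C₀ ⟶ A
  b_d : b ≫ d = 0
  d_a : d ≫ a = 0
  mono_b : Mono b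
  exact₁ : (ShortComplex.mk b d b_d).Exact
  exact₀ : (ShortComplex.mk d a d_a).Exact
  epi_a : Epi a

namespace ElemExt

variable {A B : E}

/-- A morphism of elementary extensions of `A` by `B`: a map of complexes which is compatible with
the maps from `B` and to `A`. -/
@[ext]
structure Hom (φ ψ : ElemExt A B) where
  f₁ : φ.C₁ ⟶ ψ.C₁
  f₀ : φ.C₀ ⟶ ψ.C₀
  b_f₁ : φ.b ≫ f₁ = ψ.b
  d_f₀ : φ.d ≫ f₀ = f₁ ≫ ψ.d
  f₀_a : f₀ ≫ ψ.a = φ.a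

/-- The category of elementary extensions of `A` by `B`. -/
instance : Category (ElemExt A B) where
  Hom := Hom
  id φ := ⟨𝟙 _, 𝟙 _, by simp, by simp, by simp⟩
  comp {φ ψ χ} f g := ⟨f.f₁ ≫ g.f₁, f.f₀ ≫ g.f₀,
    by rw [← Category.assoc, f.b_f₁, g.b_f₁],
    by rw [← Category.assoc, f.d_f₀, Category.assoc, g.d_f₀, Category.assoc],
    by rw [Category.assoc, g.f₀_a, f.f₀_a]⟩
  id_comp _ := Hom.ext (Category.id_comp _) (Category.id_comp _)
  comp_id _ := Hom.ext (Category.comp_id _) (Category.comp_id _)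
  assoc _ _ _ := Hom.ext (Category.assoc _ _ _) (Category.assoc _ _ _)

lemma shortExact₁ (φ : ElemExt A B) :
    (ShortComplex.mk φ.b (factorThruImage φ.d) (by
      rw [← cancel_mono (image.ι φ.d)]; simp [φ.b_d])).ShortExact where
  mono_f := φ.mono_b
  epi_g := inferInstanceAs (Epi (factorThruImage φ.d))
  exact := by
    let f : ShortComplex.mk φ.b (factorThruImage φ.d) (by
        rw [← cancel_mono (image.ι φ.d)]; simp [φ.b_d]) ⟶ ShortComplex.mk φ.b φ.d φ.b_d :=
      { τ₁ := 𝟙 _, τ₂ := 𝟙 _, τ₃ := image.ι φ.d }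
    have : Epi f.τ₁ := inferInstanceAs (Epi (𝟙 _))
    have : IsIso f.τ₂ := inferInstanceAs (IsIso (𝟙 _))
    have : Mono f.τ₃ := inferInstanceAs (Mono (image.ι φ.d))
    exact (ShortComplex.exact_iff_of_epi_of_isIso_of_mono f).2 φ.exact₁

lemma shortExact₀ (φ : ElemExt A B) :
    (ShortComplex.mk (image.ι φ.d) φ.a (by
      rw [← cancel_epi (factorThruImage φ.d)]; simp [φ.d_a])).ShortExact where
  mono_f := inferInstanceAs (Mono (image.ι φ.d))
  epi_g := φ.epi_a
  exact := by
    let f : ShortComplex.mk φ.d φ.a φ.d_a ⟶ ShortComplex.mk (image.ι φ.d) φ.a (by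
        rw [← cancel_epi (factorThruImage φ.d)]; simp [φ.d_a]) :=
      { τ₁ := factorThruImage φ.d, τ₂ := 𝟙 _, τ₃ := 𝟙 _ }
    have : Epi f.τ₁ := inferInstanceAs (Epi (factorThruImage φ.d))
    have : IsIso f.τ₂ := inferInstanceAs (IsIso (𝟙 _))
    have : Mono f.τ₃ := inferInstanceAs (Mono (𝟙 _))
    exact (ShortComplex.exact_iff_of_epi_of_isIso_of_mono f).1 φ.exact₀

/-- The Yoneda class in `Ext²(A, B)` of an elementary extension of `A` by `B`: the product of the
classes of `0 ⟶ Im d ⟶ C₀ ⟶ A ⟶ 0` and `0 ⟶ B ⟶ C₁ ⟶ Im d ⟶ 0`. -/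
def yonedaClass [HasExt.{u} E] (φ : ElemExt A B) : Abelian.Ext.{u} A B 2 :=
  φ.shortExact₀.extClass.comp φ.shortExact₁.extClass (by norm_num)

/-- A splitting of an elementary extension: an object `C₀₁` with maps `c₁ : C₁ ⟶ C₀₁` and
`c₀ : C₀₁ ⟶ C₀` with `c₁ ≫ c₀ = d`, such that `C₁` is a subobject of `C₀₁` with quotient `A`, and
`C₀` is the quotient of `C₀₁` by the subobject `B`. -/
structure Splitting (φ : ElemExt A B) where
  C₀₁ : E
  c₁ : φ.C₁ ⟶ C₀₁
  c₀ : C₀₁ ⟶ φ.C₀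
  c₁_c₀ : c₁ ≫ c₀ = φ.d
  shortExact₁ : (ShortComplex.mk c₁ (c₀ ≫ φ.a)
    (by rw [← Category.assoc, c₁_c₀, φ.d_a])).ShortExact
  shortExact₀ : (ShortComplex.mk (φ.b ≫ c₁) c₀
    (by rw [Category.assoc, c₁_c₀, φ.b_d])).ShortExact

/-- The image of an elementary extension under an exact functor. -/
abbrev map (φ : ElemExt A B) {E' : Type*} [Category* E'] [Abelian E'] (F : E ⥤ E') [F.Additive]
    [PreservesFiniteLimits F] [PreservesFiniteColimits F] : ElemExt (F.obj A) (F.obj B) where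
  C₁ := F.obj φ.C₁
  C₀ := F.obj φ.C₀
  b := F.map φ.b
  d := F.map φ.d
  a := F.map φ.a
  b_d := by rw [← F.map_comp, φ.b_d, F.map_zero]
  d_a := by rw [← F.map_comp, φ.d_a, F.map_zero]
  mono_b := by have := φ.mono_b; infer_instance
  exact₁ := φ.exact₁.map F
  exact₀ := φ.exact₀.map F
  epi_a := by have := φ.epi_a; infer_instance

end ElemExt

end Elementary

/-! ### Tensor products over a noncommutative ring -/

section Tensor

variable {S T : Type*} [Ring S] [Ring T] (f : S →+* T) (A N : Type*) [Ring A] [AddCommGroup N]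
  [Module A N] [Module Tᵐᵒᵖ N]

/-- The relations `(n · f(s)) ⊗ v = n ⊗ (s v)`. -/
def tensorRel (V : Type*) [AddCommGroup V] [Module S V] : Submodule A (N ⊗[ℤ] V) :=
  Submodule.span A {x | ∃ (n : N) (s : S) (v : V),
    x = (MulOpposite.op (f s) • n) ⊗ₜ[ℤ] v - n ⊗ₜ[ℤ] (s • v)}

/-- The left `A`-module `N ⊗_S V`, for an `(A, T)`-bimodule `N`, which is a right `S`-module via
the ring map `f : S → T`, and a left `S`-module `V`. -/
abbrev BTensor (V : Type*) [AddCommGroup V] [Module S V] : Type _ :=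
  (N ⊗[ℤ] V) ⧸ tensorRel f A N V

/-- The pure tensor `n ⊗ v` in `N ⊗_S V`. -/
def btmul {V : Type*} [AddCommGroup V] [Module S V] (n : N) (v : V) : BTensor f A N V :=
  (tensorRel f A N V).mkQ (n ⊗ₜ[ℤ] v)

/-- The map `N ⊗_S V → N ⊗_S V'` induced by an `S`-linear map `V → V'`. -/
def btensorMap {V V' : Type*} [AddCommGroup V] [Module S V] [AddCommGroup V'] [Module S V']
    (g : V →ₗ[S] V') : BTensor f A N V →ₗ[A] BTensor f A N V' :=
  Submodule.mapQ _ _ (TensorProduct.AlgebraTensorModule.lTensor A N g.toAddMonoidHom.toIntLinearMap)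
    (by
      refine Submodule.span_le.2 ?_
      rintro _ ⟨n, s, v, rfl⟩
      refine Submodule.subset_span ⟨n, s, g v, ?_⟩
      simp)

@[simp]
lemma btensorMap_btmul {V V' : Type*} [AddCommGroup V] [Module S V] [AddCommGroup V']
    [Module S V'] (g : V →ₗ[S] V') (n : N) (v : V) :
    btensorMap f A N g (btmul f A N n v) = btmul f A N n (g v) := rfl

lemma btensor_hom_ext {V W : Type*} [AddCommGroup V] [Module S V] [AddCommGroup W] [Module A W]
    {g h : BTensor f A N V →ₗ[A] W} (H : ∀ n v, g (btmul f A N n v) = h (btmul f A N n v)) :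
    g = h := by
  refine LinearMap.ext fun y => ?_
  obtain ⟨x, rfl⟩ := Submodule.mkQ_surjective _ y
  induction x with
  | zero => simp
  | tmul n v => exact H n v
  | add x y hx hy => rw [map_add, map_add, map_add, hx, hy]

lemma btmul_add {V : Type*} [AddCommGroup V] [Module S V] (n : N) (v v' : V) :
    btmul f A N n (v + v') = btmul f A N n v + btmul f A N n v' := by
  simp [btmul, TensorProduct.tmul_add]

end Tensor

/-- The functor `V ↦ N ⊗_S V` from left `S`-modules to left `A`-modules. -/
def tensorFunctor {S : Type v} {T : Type w} {A : Type*} [Ring S] [Ring T] [Ring A] (f : S →+* T)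
    (N : Type u) [AddCommGroup N] [Module A N] [Module Tᵐᵒᵖ N] :
    ModuleCat.{u} S ⥤ ModuleCat.{u} A where
  obj V := ModuleCat.of A (BTensor f A N V)
  map g := ModuleCat.ofHom (btensorMap f A N g.hom)
  map_id V := by
    ext : 1
    exact btensor_hom_ext f A N fun _ _ => rfl
  map_comp g h := by
    ext : 1
    exact btensor_hom_ext f A N fun _ _ => rfl

instance {S : Type v} {T : Type w} {A : Type*} [Ring S] [Ring T] [Ring A] (f : S →+* T)
    (N : Type u) [AddCommGroup N] [Module A N] [Module Tᵐᵒᵖ N] :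
    (tensorFunctor (A := A) f N).Additive where
  map_add {V W g h} := by
    ext : 1
    exact btensor_hom_ext f A N fun n v => btmul_add f A N n (g.hom v) (h.hom v)

/-! ### Pointed functors -/

/-- The category `R-proj` of finitely generated projective left `R`-modules. -/
abbrev FGProj (R : Type u) [Ring R] :=
  ObjectProperty.FullSubcategory
    (fun V : ModuleCat.{u} R => Module.Finite R V ∧ Module.Projective R V)

/-- A functor `F` from `R-proj` to an abelian category is pointed if `F(0) = 0`. -/
def isPointed (R : Type u) [Ring R] (C : Type*) [Category* C] [Abelian C] :
    ObjectProperty (FGProj R ⥤ C) :=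
  fun F => ∀ V : FGProj R, IsZero V → IsZero (F.obj V)

/-- The category of pointed functors from `R-proj` to an abelian category. -/
abbrev PFun (R : Type u) [Ring R] (C : Type*) [Category* C] [Abelian C] :=
  (isPointed R C).FullSubcategory

/-- The category `𝓑(R, R')` of pointed functors from `R-proj` to `R'-mod`. -/
abbrev BCat (R : Type u) [Ring R] (R' : Type v) [Ring R'] := PFun R (ModuleCat.{u} R')

/-- The category `𝓑(R, ℤ)` of pointed functors from `R-proj` to abelian groups. -/
abbrev BAb (R : Type u) [Ring R] := PFun R AddCommGrpCat.{u}

section Abelian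

variable (R : Type u) [Ring R] (C : Type*) [Category* C] [Abelian C]

instance : (isPointed R C).IsClosedUnderSubobjects where
  prop_of_mono f _ hY V hV := by
    exact IsZero.of_mono (f.app V) (hY V hV)

instance : (isPointed R C).IsClosedUnderQuotients where
  prop_of_epi f _ hX V hV := by
    exact IsZero.of_epi (f.app V) (hX V hV)

open ZeroObject in
instance : (isPointed R C).ContainsZero where
  exists_zero := ⟨(Functor.const _).obj 0, Functor.isZero _ fun _ => isZero_zero _,
    fun _ _ => isZero_zero _⟩

instance : (isPointed R C).IsClosedUnderFiniteProducts where
  isClosedUnderLimitsOfShape J _ := ⟨by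
    rintro X ⟨p⟩ V hV
    have hc := isLimitOfPreserves ((evaluation (FGProj R) C).obj V) p.isLimit
    rw [IsZero.iff_id_eq_zero]
    exact hc.hom_ext fun j => (p.prop_diag_obj j V hV).eq_of_tgt _ _⟩

/-- The category of pointed functors is abelian, as a full subcategory of the category of all
functors which is closed under kernels, cokernels and finite products. -/
instance : Abelian (PFun R C) := inferInstance

instance : HasExt.{u + 1} (BCat R R) := HasExt.standard _

instance : PreservesFiniteLimits (isPointed R C).ι :=
  ((Functor.preservesFiniteLimits_tfae (isPointed R C).ι).out 2 3).1
    (isPointed R C).preservesKernels_ι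

instance : PreservesFiniteColimits (isPointed R C).ι :=
  ((Functor.preservesFiniteColimits_tfae (isPointed R C).ι).out 2 3).1
    (isPointed R C).preservesCokernels_ι

end Abelian

/-- The component at `V` of a map of pointed functors. -/
def ev {R : Type u} [Ring R] {R' : Type v} [Ring R'] {F G : BCat R R'} (f : F ⟶ G)
    (V : FGProj R) : F.obj.obj V →ₗ[R'] G.obj.obj V :=
  (f.hom.app V).hom

section Postcomp

variable (R : Type u) [Ring R] {C D : Type*} [Category* C] [Category* D] [Abelian C] [Abelian D]
  (G : C ⥤ D) [G.Additive]

/-- The functor between categories of pointed functors given by the composition with an additive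
functor. -/
def postcomp : PFun R C ⥤ PFun R D where
  obj F := ⟨F.obj ⋙ G, fun V hV => G.map_isZero (F.property V hV)⟩
  map f := ObjectProperty.homMk (Functor.whiskerRight f.hom G)

instance : (postcomp R G).Additive where
  map_add {F F' f g} := by
    refine ObjectProperty.hom_ext _ (NatTrans.ext (funext fun V => ?_))
    exact G.map_add

instance [PreservesFiniteLimits G] : PreservesFiniteLimits (postcomp R G) := by
  have : PreservesFiniteLimits ((Functor.whiskeringRight (FGProj R) _ _).obj G) :=
    ⟨fun _ _ _ => inferInstance⟩
  have : PreservesFiniteLimits (postcomp R G ⋙ (isPointed R D).ι) :=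
    comp_preservesFiniteLimits (isPointed R C).ι ((Functor.whiskeringRight (FGProj R) _ _).obj G)
  exact preservesFiniteLimits_of_reflects_of_preserves _ (isPointed R D).ι

instance [PreservesFiniteColimits G] : PreservesFiniteColimits (postcomp R G) := by
  have : PreservesFiniteColimits ((Functor.whiskeringRight (FGProj R) _ _).obj G) :=
    ⟨fun _ _ _ => inferInstance⟩
  have : PreservesFiniteColimits (postcomp R G ⋙ (isPointed R D).ι) :=
    comp_preservesFiniteColimits (isPointed R C).ι
      ((Functor.whiskeringRight (FGProj R) _ _).obj G)
  exact preservesFiniteColimits_of_reflects_of_preserves _ (isPointed R D).ι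

end Postcomp

/-! ### Square-zero extensions -/

section Bimodule

variable (R : Type u) [Ring R] (M : Type u) [AddCommGroup M] [Module R M] [Module Rᵐᵒᵖ M]
  [SMulCommClass R Rᵐᵒᵖ M]

/-- A square-zero extension `0 ⟶ M ⟶ R' ⟶ R ⟶ 0` of the ring `R` by the `R`-bimodule `M`. -/
structure SqZeroExt where
  carrier : Type u
  [ring : Ring carrier]
  i : M →+ carrier
  q : carrier →+* R
  i_injective : Function.Injective i
  q_surjective : Function.Surjective q
  exact : Function.Exact i q
  i_mul (m : M) (x : carrier) : i m * x = i (MulOpposite.op (q x) • m)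
  mul_i (x : carrier) (m : M) : x * i m = i (q x • m)
  i_mul_i (m m' : M) : i m * i m' = 0

attribute [instance] SqZeroExt.ring

namespace SqZeroExt

variable {R M}

/-- A morphism of square-zero extensions of `R` by `M`: a ring map compatible with the maps from
`M` and to `R`. -/
@[ext]
structure Hom (X Y : SqZeroExt R M) where
  f : X.carrier →+* Y.carrier
  f_i (m : M) : f (X.i m) = Y.i m
  q_f (x : X.carrier) : Y.q (f x) = X.q x

/-- The category of square-zero extensions of `R` by `M`. -/
instance : Category (SqZeroExt R M) where
  Hom := Hom
  id X := ⟨RingHom.id _, fun _ => rfl, fun _ => rfl⟩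
  comp f g := ⟨g.f.comp f.f, fun m => by simp [f.f_i, g.f_i], fun x => by simp [f.q_f, g.q_f]⟩

end SqZeroExt

/-- The set `Sq(R, M)` of isomorphism classes of square-zero extensions of `R` by `M`. -/
def Sq : Type (u + 1) := Quotient (isIsomorphicSetoid (SqZeroExt R M))

/-! ### Elementary extensions of a ring by a bimodule, and MacLane cohomology -/

/-- The tautological functor `𝖨 : R-proj ⥤ R-mod`. -/
def I : BCat R R :=
  ⟨ObjectProperty.ι _, fun _ hV => by
    rw [IsZero.iff_id_eq_zero] at hV ⊢
    exact congrArg (fun f => f.hom) hV⟩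

/-- The functor `𝖨(M) : R-proj ⥤ R-mod`, `V ↦ M ⊗_R V`. -/
def IM : BCat R R := (postcomp R (tensorFunctor (RingHom.id R) M)).obj (I R)

variable {R} in
/-- The element `m ⊗ v` of `𝖨(M)(V) = M ⊗_R V`. -/
def tmulIM (V : FGProj R) (m : M) (v : V.obj) : (IM R M).obj.obj V :=
  btmul (RingHom.id R) R M m v

/-- Elementary extensions of `R` by `M`: elementary extensions of `𝖨` by `𝖨(M)` in `𝓑(R)`. -/
abbrev RingElemExt := ElemExt (I R) (IM R M)

/-- The set `El(R, M)` of connected components of the category of elementary extensions. -/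
abbrev El := ConnectedComponents (RingElemExt R M)

/-- The second MacLane cohomology `H²_M(R, M) = Ext²(𝖨, 𝖨(M))`, in the category `𝓑(R)`. -/
abbrev MacLaneH2 : Type (u + 1) := Abelian.Ext.{u + 1} (I R) (IM R M) 2

variable {R M}

/-- The class of a square-zero extension in `Sq(R, M)`. -/
def Sq.mk (X : SqZeroExt R M) : Sq R M := Quotient.mk _ X

/-- The class of an elementary extension in `El(R, M)`. -/
def El.mk (φ : RingElemExt R M) : El R M := Quotient.mk _ φ

/-! ### From square-zero extensions to elementary extensions -/

namespace SqZeroExt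

variable (X : SqZeroExt R M)

/-- `q_* : 𝓑(R) ⥤ 𝓑(R, R')`, composition with the restriction functor `R-mod ⥤ R'-mod`. -/
def qLower : BCat R R ⥤ BCat R X.carrier := postcomp R (ModuleCat.restrictScalars X.q)

/-- `q^* : 𝓑(R, R') ⥤ 𝓑(R)`, composition with the functor `V' ↦ R ⊗_{R'} V'` from `R'-mod` to
`R-mod`. -/
def qUpper : BCat R X.carrier ⥤ BCat R R := postcomp R (tensorFunctor X.q R)

instance : X.qUpper.Additive := inferInstanceAs (postcomp R (tensorFunctor X.q R)).Additive

/-- The element `r ⊗ x` of `(q^* F)(V) = R ⊗_{R'} F(V)`. -/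
def tmulUpper (F : BCat R X.carrier) (V : FGProj R) (r : R) (x : F.obj.obj V) :
    (X.qUpper.obj F).obj.obj V :=
  btmul X.q R R r x

/-- The augmentation `P'₀(V) → q_* V = V` of a projective resolution `P'` of `q_* 𝖨`. -/
def aug (P' : ProjectiveResolution (X.qLower.obj (I R))) (V : FGProj R) :
    (P'.complex.X 0).obj.obj V → V.obj :=
  fun x => ev (P'.π.f 0) V x

/-- The complex `P = q^* P'` in `𝓑(R)`. -/
def pullback (P' : ProjectiveResolution (X.qLower.obj (I R))) : ChainComplex (BCat R R) ℕ :=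
  (X.qUpper.mapHomologicalComplex _).obj P'.complex

/-- The elementary extension `φ` is the canonical truncation `τ_[0,1] P` of `P = q^* P'`. As `P` is
concentrated in non-negative degrees, the truncation is `P₁ / d(P₂) ⟶ P₀`, and `P₁ / d(P₂)` is
`P.opcycles 1`. The map to `𝖨` is given by the augmentation and the isomorphism
`q^* q_* V ≅ V`, `r ⊗ v ↦ r v`. The map from `𝖨(M)` is given by the isomorphism
`H₁(P(V)) = L¹q^* q_* V ≅ M ⊗_R V` which is the connecting homomorphism `δ` for the sequence
`0 ⟶ M ⊗_{R'} P'(V) ⟶ P'(V) ⟶ P(V) ⟶ 0`: if `x₀ ∈ P'₀(V)` and `x₁ ∈ P'₁(V)` are such that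
`d x₁ = i(m) x₀`, then `δ` sends the class of `1 ⊗ x₁` to `m ⊗ v`, `v` being the image of `x₀`. -/
def IsTruncation (P' : ProjectiveResolution (X.qLower.obj (I R))) (φ : RingElemExt R M) : Prop :=
  ∃ (e₁ : φ.C₁ ≅ (X.pullback P').opcycles 1) (e₀ : φ.C₀ ≅ (X.pullback P').X 0),
    φ.d ≫ e₀.hom = e₁.hom ≫ (X.pullback P').fromOpcycles 1 0 ∧
    (∀ (V : FGProj R) (r : R) (x : (P'.complex.X 0).obj.obj V),
      ev (e₀.inv ≫ φ.a) V (X.tmulUpper (P'.complex.X 0) V r x) = (r • X.aug P' V x : V.obj)) ∧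
    (∀ (V : FGProj R) (m : M) (x₀ : (P'.complex.X 0).obj.obj V) (x₁ : (P'.complex.X 1).obj.obj V),
      ev (P'.complex.d 1 0) V x₁ = X.i m • x₀ →
      ev (φ.b ≫ e₁.hom) V (tmulIM M V m (X.aug P' V x₀)) =
        ev ((X.pullback P').pOpcycles 1) V (X.tmulUpper (P'.complex.X 1) V 1 x₁))

end SqZeroExt

/-! ### From elementary extensions to square-zero extensions -/

variable (R) in
/-- `e_* : 𝓑(R) ⥤ 𝓑(R, ℤ)`, composition with the forgetful functor from `R-mod` to abelian
groups. -/
def eLower : BCat R R ⥤ BAb R := postcomp R (forget₂ (ModuleCat.{u} R) AddCommGrpCat.{u})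

instance : (eLower R).Additive :=
  inferInstanceAs (postcomp R (forget₂ (ModuleCat.{u} R) AddCommGrpCat.{u})).Additive

lemma preservesFiniteLimits_forget :
    PreservesFiniteLimits (forget₂ (ModuleCat.{u} R) AddCommGrpCat.{u}) := inferInstance

lemma preservesFiniteColimits_forget :
    PreservesFiniteColimits (forget₂ (ModuleCat.{u} R) AddCommGrpCat.{u}) := inferInstance

instance : PreservesFiniteLimits (eLower R) := by
  have := preservesFiniteLimits_forget (R := R)
  delta eLower
  infer_instance

instance : PreservesFiniteColimits (eLower R) := by
  have := preservesFiniteColimits_forget (R := R)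
  delta eLower
  infer_instance

/-- The multiplication by `r ∈ R` on `e_* F`, for `F ∈ 𝓑(R)`. -/
def scalMap (F : BCat R R) (r : R) : (eLower R).obj F ⟶ (eLower R).obj F :=
  ObjectProperty.homMk
    { app := fun V => AddCommGrpCat.ofHom (DistribSMul.toAddMonoidHom (F.obj.obj V) r)
      naturality := fun V W f => by
        ext x
        exact ((F.obj.map f).hom.map_smul r x).symm }

/-- The action of `R` on `e_* F` by multiplication, for `F ∈ 𝓑(R)`. -/
def scal (F : BCat R R) : R →+* End ((eLower R).obj F) where
  toFun := scalMap F
  map_one' := by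
    refine ObjectProperty.hom_ext _ (NatTrans.ext (funext fun V => AddCommGrpCat.ext fun x => ?_))
    exact one_smul R (show F.obj.obj V from x)
  map_mul' r s := by
    refine ObjectProperty.hom_ext _ (NatTrans.ext (funext fun V => AddCommGrpCat.ext fun x => ?_))
    exact mul_smul r s (show F.obj.obj V from x)
  map_zero' := by
    refine ObjectProperty.hom_ext _ (NatTrans.ext (funext fun V => AddCommGrpCat.ext fun x => ?_))
    exact zero_smul R (show F.obj.obj V from x)
  map_add' r s := by
    refine ObjectProperty.hom_ext _ (NatTrans.ext (funext fun V => AddCommGrpCat.ext fun x => ?_))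
    exact add_smul r s (show F.obj.obj V from x)

/-- The additive map `v ↦ m ⊗ v` from `V` to `M ⊗_R V`. -/
def tmulHom (V : FGProj R) (m : M) : V.obj →+ (IM R M).obj.obj V :=
  AddMonoidHom.mk' (tmulIM M V m) fun v w => btmul_add (V := V.obj) (RingHom.id R) R M m v w

/-- The map `e_* 𝖨 ⟶ e_* 𝖨(M)`, `v ↦ m ⊗ v`. -/
def tmulMap (m : M) : (eLower R).obj (I R) ⟶ (eLower R).obj (IM R M) :=
  ObjectProperty.homMk
    { app := fun V => AddCommGrpCat.ofHom (tmulHom V m)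
      naturality := fun V W f => by
        ext x
        rfl }

/-- The elementary extension `e_* φ` of `e_* 𝖨` by `e_* 𝖨(M)` in `𝓑(R, ℤ)`. -/
abbrev eLowerExt (φ : RingElemExt R M) : ElemExt ((eLower R).obj (I R)) ((eLower R).obj (IM R M)) :=
  φ.map (eLower R)

section Regular

variable {φ : RingElemExt R M} (S : (eLowerExt φ).Splitting)

/-- The endomorphism `r'` of `C₀₁` is regular over `r ∈ R`: it is compatible with the
multiplication by `r` on `e_* C₁` and on `e_* C₀`. -/
def IsRegularOver (r' : End S.C₀₁) (r : R) : Prop :=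
  S.c₁ ≫ r' = scal φ.C₁ r ≫ S.c₁ ∧ r' ≫ S.c₀ = S.c₀ ≫ scal φ.C₀ r

/-- The ring of regular endomorphisms of `C₀₁`. -/
def regularEnd : Subring (End S.C₀₁) where
  carrier := {r' | ∃ r : R, IsRegularOver S r' r}
  mul_mem' := by
    rintro x y ⟨r, hr⟩ ⟨s, hs⟩
    refine ⟨r * s, ?_, ?_⟩
    · rw [map_mul, End.mul_def, End.mul_def, ← Category.assoc, hs.1, Category.assoc, hr.1,
        Category.assoc]
    · rw [map_mul, End.mul_def, End.mul_def, Category.assoc, hr.2, ← Category.assoc, hs.2,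
        Category.assoc]
  one_mem' := ⟨1, by rw [map_one]; simp [End.one_def], by rw [map_one]; simp [End.one_def]⟩
  add_mem' := by
    rintro x y ⟨r, hr⟩ ⟨s, hs⟩
    refine ⟨r + s, ?_, ?_⟩
    · rw [map_add]
      exact (Preadditive.comp_add _ _ _ _ _ _).trans
        ((congrArg₂ (· + ·) hr.1 hs.1).trans (Preadditive.add_comp _ _ _ _ _ _).symm)
    · rw [map_add]
      exact (Preadditive.add_comp _ _ _ _ _ _).trans
        ((congrArg₂ (· + ·) hr.2 hs.2).trans (Preadditive.comp_add _ _ _ _ _ _).symm)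
  zero_mem' := by
    refine ⟨0, ?_, ?_⟩
    · rw [map_zero]
      exact comp_zero.trans zero_comp.symm
    · rw [map_zero]
      exact zero_comp.trans comp_zero.symm
  neg_mem' := by
    rintro x ⟨r, hr⟩
    refine ⟨-r, ?_, ?_⟩
    · rw [map_neg]
      exact (Preadditive.comp_neg _ _).trans
        ((congrArg Neg.neg hr.1).trans (Preadditive.neg_comp _ _).symm)
    · rw [map_neg]
      exact (Preadditive.neg_comp _ _).trans
        ((congrArg Neg.neg hr.2).trans (Preadditive.comp_neg _ _).symm)

/-- The square-zero extension `X` is the ring of regular endomorphisms of `C₀₁`, with its natural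
structure of a square-zero extension of `R` by `M`: the map to `R` sends a regular endomorphism
over `r` to `r`, and the map from `M` sends `m` to the composition of the projection `C₀₁ ⟶ e_* 𝖨`,
the map `v ↦ m ⊗ v`, and the embedding `e_* 𝖨(M) ⟶ C₀₁`. -/
def IsRegularExt (X : SqZeroExt R M) : Prop :=
  ∃ Θ : X.carrier ≃+* regularEnd S,
    (∀ x, IsRegularOver S (Θ x : End S.C₀₁) (X.q x)) ∧
    (∀ m, (Θ (X.i m) : End S.C₀₁) =
      (S.c₀ ≫ (eLowerExt φ).a) ≫ tmulMap m ≫ ((eLowerExt φ).b ≫ S.c₁))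

end Regular

end Bimodule

end

end SqEl

open SqEl

/-! The link between the two sides is the object `C₀₁`. As a functor to sets, `𝖨` is represented by
`R`, so a lift of `1 ∈ R` to `C₀(R)` gives a natural section `V → C₀(V)` of `a`. It is not additive,
but its additivity defect lifts to a natural function `V × V → C₁(V)`. Symmetry and the cocycle
identity hold up to natural functions with values in `𝖨(M)` that vanish when all variables but one
are zero. As `𝖨(M)` is additive, such functions are zero (`eq_zero_of_natural₂`,
`eq_zero_of_natural₃`). So there is an honest natural cocycle, and the twisted sum of `V` and
`C₁(V)` is a splitting (`exists_splitting`).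

The same rigidity extends every map of complexes `C₁ ⟶ C₀` to the splittings
(`Splitting.exists_lift`). Two such extensions differ by a natural additive map `V → M ⊗_R V`, that
is, by an element of `M` (`eq_of_comp_eq_zero`, `exists_tmulMap_eq`). Applied to the multiplication
by `r`, this shows that the regular endomorphisms over `r` form a torsor under `M`, so that they
make up a square-zero extension. Applied to morphisms of elementary extensions, it shows that the
class of this ring is invariant. This defines `Ψ`.

Let `P'` be a projective resolution of `q_* 𝖨`. Its values are projective modules over `R'`, so `M
⊗_{R'} P'₀(V) → P'₀(V)` is injective, and this is what makes the truncation of `q^* P'` exact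
(`connecting_injective`). The quotient `P'₀ / d(M P'₁)` is a splitting of the truncation, and `R'`
visibly acts on it by regular endomorphisms; hence `Ψ` sends the truncation back to `R'`.
Conversely, if `R'` acts regularly on a splitting of some `ψ`, that splitting becomes an object of
`𝓑(R, R')` over `q_* 𝖨`. The augmentation of `P'₀` lifts to it by projectivity, and the lift
descends to a map from the truncation to `ψ` (`TruncationData.nonempty_hom`). So the component of
`ψ` is determined by `R'`, `Ψ` is bijective, and `Φ` is its inverse.

The comparison with `Ext²` is dimension shifting along one elementary extension with projective
middle terms (`elemExtClass_bijective`). It needs enough projectives, which are supplied by reduced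
free functors on elements of the `F(Rⁿ)`. -/

namespace SqEl

/-! ### Connected components of elementary extensions and `Ext²` -/

section YonedaExt

variable {E : Type v} [Category.{w} E] [Abelian E]

namespace ElemExt

variable {A B L : E}

/-- A map of elementary extensions of `A`, lying over a map `g : L ⟶ B`. -/
structure HomOver (φ : ElemExt A L) (g : L ⟶ B) (ψ : ElemExt A B) where
  f₁ : φ.C₁ ⟶ ψ.C₁
  f₀ : φ.C₀ ⟶ ψ.C₀
  b_f₁ : φ.b ≫ f₁ = g ≫ ψ.b
  d_f₀ : φ.d ≫ f₀ = f₁ ≫ ψ.d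
  f₀_a : f₀ ≫ ψ.a = φ.a

/-- A map over `g` induces a map `k` between the images of the differentials, hence a map on each of
the two short exact sequences into which an elementary extension is cut. Naturality of `extClass`
for both sequences trades `g` for `k` and then `k` for the identity of `A`. -/
lemma yonedaClass_of_homOver [HasExt.{u} E] {φ : ElemExt A L} {g : L ⟶ B} {ψ : ElemExt A B}
    (f : HomOver φ g ψ) :
    ψ.yonedaClass = φ.yonedaClass.comp (Abelian.Ext.mk₀ g) (add_zero 2) := by
  let k : image φ.d ⟶ image ψ.d := image.map (Arrow.homMk f.f₁ f.f₀ f.d_f₀.symm :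
    Arrow.mk φ.d ⟶ Arrow.mk ψ.d)
  have hk₁ : factorThruImage φ.d ≫ k = f.f₁ ≫ factorThruImage ψ.d :=
    image.factor_map (Arrow.homMk f.f₁ f.f₀ f.d_f₀.symm : Arrow.mk φ.d ⟶ Arrow.mk ψ.d)
  have hk₂ : k ≫ image.ι ψ.d = image.ι φ.d ≫ f.f₀ := image.map_ι (Arrow.homMk f.f₁ f.f₀ f.d_f₀.symm : Arrow.mk φ.d ⟶ Arrow.mk ψ.d)
  have n₁ := φ.shortExact₁.extClass_naturality ψ.shortExact₁ (ShortComplex.homMk g f.f₁ k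
    f.b_f₁.symm hk₁.symm)
  have n₀ := φ.shortExact₀.extClass_naturality ψ.shortExact₀ (ShortComplex.homMk k f.f₀ (𝟙 A)
    hk₂ (f.f₀_a.trans (Category.comp_id _).symm))
  rw [yonedaClass, yonedaClass, Abelian.Ext.comp_assoc_of_third_deg_zero]
  erw [n₁]
  rw [← Abelian.Ext.comp_assoc_of_second_deg_zero]
  erw [n₀]
  congr 1
  exact (Abelian.Ext.mk₀_id_comp _).symm

lemma yonedaClass_eq_of_hom [HasExt.{u} E] {φ ψ : ElemExt A B} (f : φ ⟶ ψ) :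
    φ.yonedaClass = ψ.yonedaClass := by
  have := yonedaClass_of_homOver (φ := φ) (g := 𝟙 B) (ψ := ψ)
    ⟨f.f₁, f.f₀, by rw [f.b_f₁, Category.id_comp], f.d_f₀, f.f₀_a⟩
  rw [this, Abelian.Ext.comp_mk₀_id]

/-- The pushout of an elementary extension of `A` by `L` along a map `L ⟶ B`. -/
noncomputable def push (φ : ElemExt A L) (g : L ⟶ B) : ElemExt A B where
  C₁ := pushout φ.b g
  C₀ := φ.C₀
  b := pushout.inr _ _
  d := pushout.desc φ.d 0 (by rw [φ.b_d, comp_zero])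
  a := φ.a
  b_d := pushout.inr_desc _ _ _
  d_a := by
    ext
    · rw [pushout.inl_desc_assoc, φ.d_a, comp_zero]
    · rw [pushout.inr_desc_assoc, zero_comp, comp_zero]
  mono_b := by have := φ.mono_b; infer_instance
  exact₁ := by
    rw [ShortComplex.exact_iff_exact_up_to_refinements]
    intro T x hx
    -- The pushout is a quotient of `C₁ ⊞ B`, so `x` is locally represented by a pair. Its
    -- `C₁`-component is killed by `d`, hence comes locally from `L`, and can be moved into `B` by
    -- the gluing relation.
    have : Epi (biprod.desc (pushout.inl φ.b g) (pushout.inr φ.b g)) := ⟨fun s t h => by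
      ext
      · simpa using biprod.inl ≫= h
      · simpa using biprod.inr ≫= h⟩
    obtain ⟨T', p, _, z, hz⟩ := surjective_up_to_refinements_of_epi
      (biprod.desc (pushout.inl φ.b g) (pushout.inr φ.b g)) x
    have hz' : (z ≫ biprod.fst) ≫ φ.d = 0 := by
      have h₁ : biprod.desc (pushout.inl φ.b g) (pushout.inr φ.b g) ≫
          pushout.desc φ.d 0 (by rw [φ.b_d, comp_zero]) = biprod.fst ≫ φ.d := by
        ext <;> simp [pushout.inl_desc, pushout.inr_desc]
      have h₂ := p ≫= hx
      dsimp at h₂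
      rw [← Category.assoc, hz, Category.assoc, h₁, comp_zero] at h₂
      rw [Category.assoc, h₂]
    obtain ⟨T'', p', _, y, hy⟩ := φ.exact₁.exact_up_to_refinements (z ≫ biprod.fst) hz'
    dsimp at hy
    refine ⟨T'', p' ≫ p, inferInstance, y ≫ g + p' ≫ z ≫ biprod.snd, ?_⟩
    have h₃ : z = (z ≫ biprod.fst) ≫ biprod.inl + (z ≫ biprod.snd) ≫ biprod.inr := by
      ext <;> simp
    rw [Category.assoc, hz, h₃]
    simp only [Preadditive.add_comp, Preadditive.comp_add, Category.assoc, biprod.inl_desc,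
      biprod.inr_desc, biprod.inl_snd, biprod.inr_snd,
      comp_zero, Category.comp_id, zero_add]
    congr 1
    rw [← pushout.condition, ← reassoc_of% hy]
  exact₀ := by
    rw [ShortComplex.exact_iff_exact_up_to_refinements]
    intro T y hy
    obtain ⟨T', p, _, x, hx⟩ := φ.exact₀.exact_up_to_refinements y hy
    exact ⟨T', p, inferInstance, x ≫ pushout.inl _ _, by
      rw [Category.assoc, pushout.inl_desc]; exact hx⟩
  epi_a := φ.epi_a

/-- The canonical map from an elementary extension to its pushout. -/
noncomputable def toPush (φ : ElemExt A L) (g : L ⟶ B) : HomOver φ g (φ.push g) where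
  f₁ := pushout.inl _ _
  f₀ := 𝟙 _
  b_f₁ := pushout.condition
  d_f₀ := by simp [push, pushout.inl_desc]
  f₀_a := Category.id_comp _

/-- The map from the pushout induced by a map over `g`. -/
noncomputable def HomOver.fromPush {φ : ElemExt A L} {g : L ⟶ B} {ψ : ElemExt A B}
    (f : HomOver φ g ψ) : φ.push g ⟶ ψ :=
  Hom.mk (φ := φ.push g) (pushout.desc f.f₁ ψ.b f.b_f₁) f.f₀ (pushout.inr_desc _ _ _) (by
    dsimp [push]
    ext
    · rw [pushout.inl_desc_assoc, pushout.inl_desc_assoc, f.d_f₀]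
    · rw [pushout.inr_desc_assoc, pushout.inr_desc_assoc, ψ.b_d, zero_comp]) f.f₀_a

/-- Projective objects in the middle terms give maps to any elementary extension. -/
lemma exists_homOver (φ : ElemExt A L) [Projective φ.C₁] [Projective φ.C₀] (ψ : ElemExt A B) :
    ∃ g : L ⟶ B, Nonempty (HomOver φ g ψ) := by
  have := ψ.epi_a
  have := ψ.mono_b
  let f₀ : φ.C₀ ⟶ ψ.C₀ := Projective.factorThru φ.a ψ.a
  have hf₀ : f₀ ≫ ψ.a = φ.a := Projective.factorThru_comp _ _
  have h₀ : (φ.d ≫ f₀) ≫ ψ.a = 0 := by rw [Category.assoc, hf₀, φ.d_a]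
  let f₁ : φ.C₁ ⟶ ψ.C₁ := ψ.exact₀.liftFromProjective (φ.d ≫ f₀) h₀
  have hf₁ : f₁ ≫ ψ.d = φ.d ≫ f₀ := ψ.exact₀.liftFromProjective_comp _ h₀
  have h₁ : (φ.b ≫ f₁) ≫ ψ.d = 0 := by
    rw [Category.assoc, hf₁, ← Category.assoc, φ.b_d, zero_comp]
  exact ⟨ψ.exact₁.lift (φ.b ≫ f₁) h₁, ⟨f₁, f₀, (ψ.exact₁.lift_f _ h₁).symm, hf₁.symm, hf₀⟩⟩

/-- With enough projectives, there is an elementary extension of `A` with projective middle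
terms. -/
lemma exists_projective [EnoughProjectives E] (A : E) :
    ∃ (L : E) (φ : ElemExt A L), Projective φ.C₁ ∧ Projective φ.C₀ := by
  let p := Projective.π A
  let k := kernel.ι p
  let d := Projective.π (kernel p) ≫ k
  have hda : d ≫ p = 0 := by simp [d, k]
  refine ⟨kernel d, ⟨_, _, kernel.ι d, d, p, kernel.condition d, hda, inferInstance,
    ShortComplex.exact_of_f_is_kernel _ (kernelIsKernel d), ?_, inferInstance⟩,
    Projective.projective_over _, Projective.projective_over _⟩
  let f : ShortComplex.mk d p hda ⟶ ShortComplex.mk k p (kernel.condition p) :=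
    { τ₁ := Projective.π (kernel p), τ₂ := 𝟙 _, τ₃ := 𝟙 _ }
  have : Epi f.τ₁ := inferInstanceAs (Epi (Projective.π (kernel p)))
  have : IsIso f.τ₂ := inferInstanceAs (IsIso (𝟙 _))
  have : Mono f.τ₃ := inferInstanceAs (Mono (𝟙 _))
  exact (ShortComplex.exact_iff_of_epi_of_isIso_of_mono f).2
    (ShortComplex.exact_of_f_is_kernel _ (kernelIsKernel p))

open Abelian in
-- Dimension shifting: the groups `Ext²(C₀, B)` and `Ext¹(C₁, B)` vanish, so both connecting maps in
-- `Hom(L, B) → Ext¹(Im d, B) → Ext²(A, B)` are surjective.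
lemma exists_yonedaClass_push_eq [HasExt.{u} E] (φ : ElemExt A L) [Projective φ.C₁]
    [Projective φ.C₀] (x : Ext.{u} A B 2) : ∃ g : L ⟶ B, (φ.push g).yonedaClass = x := by
  obtain ⟨y, hy⟩ := Ext.contravariant_sequence_exact₃ φ.shortExact₀ _ x
    (Ext.eq_zero_of_projective (P := φ.C₀) (n := 1) _) (n₀ := 1) rfl
  obtain ⟨z, hz⟩ := Ext.contravariant_sequence_exact₃ φ.shortExact₁ _ y
    (Ext.eq_zero_of_projective (P := φ.C₁) (n := 0) _) (n₀ := 0) rfl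
  obtain ⟨g, rfl⟩ := (Ext.mk₀_bijective L B).2 z
  refine ⟨g, ?_⟩
  rw [yonedaClass_of_homOver (φ.toPush g), yonedaClass, Ext.comp_assoc_of_third_deg_zero]
  exact (congrArg (fun t => φ.shortExact₀.extClass.comp t _) hz).trans hy

open Abelian in
-- The kernel of the double connecting map: `Ext¹(C₀, B) = 0` makes the second connecting map
-- injective, and the kernel of the first consists of the maps that extend along `b`.
lemma exists_factor_of_yonedaClass_comp_eq_zero [HasExt.{u} E] (φ : ElemExt A L) [Projective φ.C₁]
    [Projective φ.C₀] (g : L ⟶ B)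
    (h : φ.yonedaClass.comp (Ext.mk₀ g) (add_zero 2) = 0) : ∃ k : φ.C₁ ⟶ B, φ.b ≫ k = g := by
  rw [yonedaClass, Ext.comp_assoc_of_third_deg_zero] at h
  obtain ⟨y, hy⟩ := Ext.contravariant_sequence_exact₁ φ.shortExact₀ _ _ _ h
  rw [Ext.eq_zero_of_projective (P := φ.C₀) (n := 0) y, Ext.comp_zero] at hy
  obtain ⟨z, hz⟩ := Ext.contravariant_sequence_exact₁ φ.shortExact₁ _ _ _ hy.symm
  obtain ⟨k, rfl⟩ := (Ext.mk₀_bijective φ.C₁ B).2 z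
  refine ⟨k, (Ext.mk₀_bijective L B).1 ?_⟩
  rw [← hz]
  exact (Ext.mk₀_comp_mk₀ _ _).symm

/-- Changing a map over `g` by a map `k : C₁ ⟶ B`. -/
def HomOver.sub {φ : ElemExt A L} {g : L ⟶ B} {ψ : ElemExt A B} (f : HomOver φ g ψ)
    (k : φ.C₁ ⟶ B) : HomOver φ (g - φ.b ≫ k) ψ where
  f₁ := f.f₁ - k ≫ ψ.b
  f₀ := f.f₀
  b_f₁ := by rw [Preadditive.comp_sub, Preadditive.sub_comp, f.b_f₁, Category.assoc]
  d_f₀ := by rw [Preadditive.sub_comp, Category.assoc, ψ.b_d, comp_zero, sub_zero, f.d_f₀]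
  f₀_a := f.f₀_a

end ElemExt

lemma connectedComponents_mk_eq_of_hom {J : Type*} [Category* J] {j k : J} (f : j ⟶ k) :
    (Quotient.mk _ j : ConnectedComponents J) = Quotient.mk _ k :=
  Quotient.sound (Zigzag.of_hom f)

lemma zigzag_congr {J α : Type*} [Category* J] (F : J → α)
    (hF : ∀ {j k : J}, (j ⟶ k) → F j = F k) {j k : J} (h : Zigzag j k) : F j = F k := by
  induction h with
  | refl => rfl
  | tail _ h ih =>
    obtain ⟨⟨f⟩⟩ | ⟨⟨f⟩⟩ := h
    · exact ih.trans (hF f)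
    · exact ih.trans (hF f).symm

/-- The map from the set of connected components of the category of elementary extensions to `Ext²`
given by the Yoneda class. -/
noncomputable def elemExtClass [HasExt.{u} E] (A B : E) :
    ConnectedComponents (ElemExt A B) → Abelian.Ext.{u} A B 2 :=
  Quotient.lift ElemExt.yonedaClass fun _ _ h => zigzag_congr _ ElemExt.yonedaClass_eq_of_hom h

/-- Everything is compared with a single `φ` with projective middle terms. Every elementary
extension receives a map from a pushout of `φ`, so both sides become `Hom(L, B)` modulo maps that
extend to `C₁`. -/
lemma elemExtClass_bijective [HasExt.{u} E] [EnoughProjectives E] (A B : E) :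
    Function.Bijective (elemExtClass.{u} A B) := by
  obtain ⟨L, φ, _, _⟩ := ElemExt.exists_projective A
  constructor
  · rintro ⟨ψ⟩ ⟨ψ'⟩ h
    change ψ.yonedaClass = ψ'.yonedaClass at h
    obtain ⟨g, ⟨f⟩⟩ := φ.exists_homOver ψ
    obtain ⟨g', ⟨f'⟩⟩ := φ.exists_homOver ψ'
    rw [ElemExt.yonedaClass_of_homOver f, ElemExt.yonedaClass_of_homOver f'] at h
    -- Equal classes force `g - g'` to factor through `C₁`. Subtracting this factor moves `f` to a
    -- map over `g'`, and both extensions receive a map from the same pushout.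
    obtain ⟨k, hk⟩ := φ.exists_factor_of_yonedaClass_comp_eq_zero (g - g') (by
      rw [sub_eq_add_neg, Abelian.Ext.mk₀_add, Abelian.Ext.mk₀_neg, Abelian.Ext.comp_add,
        Abelian.Ext.comp_neg, h, add_neg_cancel])
    have hg : g - φ.b ≫ k = g' := by rw [hk, sub_sub_cancel]
    have f'' : φ.HomOver g' ψ := hg ▸ f.sub k
    exact (connectedComponents_mk_eq_of_hom f''.fromPush).symm.trans
      (connectedComponents_mk_eq_of_hom f'.fromPush)
  · intro x
    obtain ⟨g, hg⟩ := φ.exists_yonedaClass_push_eq x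
    exact ⟨Quotient.mk _ (φ.push g), hg⟩

end YonedaExt


section PointedFunctors

/-! ### Exactness of sequences of pointed functors -/

section

variable {R : Type u} [Ring R] {C : Type*} [Category* C] [Abelian C]

variable (C) in
/-- Evaluation of pointed functors at an object. -/
def evalAt (V : FGProj R) : PFun R C ⥤ C :=
  (isPointed R C).ι ⋙ (evaluation (FGProj R) C).obj V

instance (V : FGProj R) : PreservesFiniteLimits (evalAt C V) :=
  comp_preservesFiniteLimits _ _

instance (V : FGProj R) : PreservesFiniteColimits (evalAt C V) :=
  comp_preservesFiniteColimits _ _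

instance (V : FGProj R) : (evalAt C V).Additive where
  map_add := rfl

lemma isZero_of_evalAt {F : PFun R C} (h : ∀ V, IsZero ((evalAt C V).obj F)) : IsZero F := by
  rw [IsZero.iff_id_eq_zero]
  exact ObjectProperty.hom_ext _ (NatTrans.ext (funext fun V => (h V).eq_of_src _ _))

/-- Evaluation preserves finite limits and colimits, so it commutes with homology, and a functor
vanishes when all its values do. -/
lemma exact_iff_evalAt (S : ShortComplex (PFun R C)) :
    S.Exact ↔ ∀ V : FGProj R, (S.map (evalAt C V)).Exact := by
  refine ⟨fun h V => h.map _, fun h => ?_⟩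
  rw [ShortComplex.exact_iff_isZero_homology]
  refine isZero_of_evalAt fun V => ?_
  exact ((ShortComplex.exact_iff_isZero_homology _).1 (h V)).of_iso
    (S.mapHomologyIso (evalAt C V)).symm

lemma mono_iff_evalAt {F G : PFun R C} (f : F ⟶ G) :
    Mono f ↔ ∀ V : FGProj R, Mono ((evalAt C V).map f) := by
  refine ⟨fun h V => inferInstance, fun h => ⟨fun a b hab => ?_⟩⟩
  refine ObjectProperty.hom_ext _ (NatTrans.ext (funext fun V => ?_))
  exact (h V).right_cancellation _ _ (congrArg (fun t => t.hom.app V) hab)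

lemma epi_iff_evalAt {F G : PFun R C} (f : F ⟶ G) :
    Epi f ↔ ∀ V : FGProj R, Epi ((evalAt C V).map f) := by
  refine ⟨fun h V => inferInstance, fun h => ⟨fun a b hab => ?_⟩⟩
  refine ObjectProperty.hom_ext _ (NatTrans.ext (funext fun V => ?_))
  exact (h V).left_cancellation _ _ (congrArg (fun t => t.hom.app V) hab)

end

/-- The map in `R-proj` given by a linear map. -/
def lin {R : Type u} [Ring R] {V W : FGProj R} (f : V.obj →ₗ[R] W.obj) : V ⟶ W :=
  ObjectProperty.homMk (ModuleCat.ofHom f)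

/-- The zero object of `R-proj`. -/
def zeroFG (R : Type u) [Ring R] : FGProj R := ⟨ModuleCat.of R PUnit, inferInstance, inferInstance⟩

lemma isZero_zeroFG (R : Type u) [Ring R] : IsZero (zeroFG R) := by
  rw [IsZero.iff_id_eq_zero]
  refine ObjectProperty.hom_ext _ (ModuleCat.hom_ext (LinearMap.ext fun x => ?_))
  exact Subsingleton.elim (α := PUnit) _ _

/-! ### Elements of functors with values in modules -/

section Mod

variable {R : Type u} [Ring R] {R' : Type v} [Ring R']

/-- The map `F(V) → F(W)` induced by a linear map `V → W`. -/
def mp (F : BCat R R') {V W : FGProj R} (f : V.obj →ₗ[R] W.obj) :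
    F.obj.obj V →ₗ[R'] F.obj.obj W :=
  (F.obj.map (lin f)).hom

lemma mp_id (F : BCat R R') (V : FGProj R) : mp F (LinearMap.id : V.obj →ₗ[R] V.obj) = .id :=
  congrArg ModuleCat.Hom.hom (F.obj.map_id V)

lemma mp_comp (F : BCat R R') {U V W : FGProj R} (f : U.obj →ₗ[R] V.obj) (g : V.obj →ₗ[R] W.obj) :
    mp F (g ∘ₗ f) = mp F g ∘ₗ mp F f :=
  congrArg ModuleCat.Hom.hom (F.obj.map_comp (lin f) (lin g))

lemma mp_comp_apply (F : BCat R R') {U V W : FGProj R} (f : U.obj →ₗ[R] V.obj)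
    (g : V.obj →ₗ[R] W.obj) (x : F.obj.obj U) : mp F (g ∘ₗ f) x = mp F g (mp F f x) := by
  rw [mp_comp]; rfl

/-- Here the condition `F(0) = 0` enters: a zero map factors through the zero object. -/
lemma mp_zero (F : BCat R R') (V W : FGProj R) : mp F (0 : V.obj →ₗ[R] W.obj) = 0 := by
  have h := mp_comp F (U := V) (V := zeroFG R) (W := W) 0 0
  rw [LinearMap.comp_zero] at h
  rw [h]
  have h0 : mp F (0 : V.obj →ₗ[R] (zeroFG R).obj) = 0 :=
    congrArg ModuleCat.Hom.hom ((F.property _ (isZero_zeroFG R)).eq_of_tgt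
      (F.obj.map (lin (0 : V.obj →ₗ[R] (zeroFG R).obj))) 0)
  rw [h0, LinearMap.comp_zero]

lemma ev_mp {F G : BCat R R'} (t : F ⟶ G) {V W : FGProj R} (f : V.obj →ₗ[R] W.obj)
    (x : F.obj.obj V) : ev t W (mp F f x) = mp G f (ev t V x) :=
  congrArg (fun h : F.obj.obj V ⟶ G.obj.obj W => h.hom x) (t.hom.naturality (lin f))

@[simp]
lemma ev_comp {F G H : BCat R R'} (s : F ⟶ G) (t : G ⟶ H) (V : FGProj R) (x : F.obj.obj V) :
    ev (s ≫ t) V x = ev t V (ev s V x) := rfl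

lemma ev_ext {F G : BCat R R'} {s t : F ⟶ G} (h : ∀ V x, ev s V x = ev t V x) : s = t :=
  ObjectProperty.hom_ext _ (NatTrans.ext (funext fun V => ModuleCat.hom_ext
    (LinearMap.ext fun x => h V x)))

/-- A map of pointed functors from its components. -/
def mkHom {F G : BCat R R'} (t : ∀ V : FGProj R, F.obj.obj V →ₗ[R'] G.obj.obj V)
    (ht : ∀ (V W : FGProj R) (f : V.obj →ₗ[R] W.obj) (x : F.obj.obj V),
      t W (mp F f x) = mp G f (t V x)) : F ⟶ G :=
  ObjectProperty.homMk
    { app := fun V => ModuleCat.ofHom (t V)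
      naturality := fun V W f => by
        ext x
        exact ht V W f.hom.hom x }

/-- A pointed functor from modules `T V` and maps between them. -/
def mkFun (T : FGProj R → Type u) [∀ V, AddCommGroup (T V)] [∀ V, Module R' (T V)]
    (m : ∀ {V W : FGProj R}, (V.obj →ₗ[R] W.obj) → (T V →ₗ[R'] T W))
    (hid : ∀ V : FGProj R, m (LinearMap.id : V.obj →ₗ[R] V.obj) = .id)
    (hcomp : ∀ {U V W : FGProj R} (f : U.obj →ₗ[R] V.obj) (g : V.obj →ₗ[R] W.obj),
      m (g ∘ₗ f) = m g ∘ₗ m f)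
    (hzero : ∀ V : FGProj R, m (0 : V.obj →ₗ[R] V.obj) = 0) : BCat R R' where
  obj :=
    { obj := fun V => ModuleCat.of R' (T V)
      map := fun f => ModuleCat.ofHom (m f.hom.hom)
      map_id := fun V => ModuleCat.hom_ext (hid V)
      map_comp := fun f g => ModuleCat.hom_ext (hcomp f.hom.hom g.hom.hom) }
  property := fun V hV => by
    rw [IsZero.iff_id_eq_zero] at hV ⊢
    have h : (LinearMap.id : V.obj →ₗ[R] V.obj) = 0 := congrArg (fun f => f.hom.hom) hV
    have h' := hid V
    rw [h, hzero] at h'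
    exact ModuleCat.hom_ext h'.symm

lemma mono_iff_injective {F G : BCat R R'} (f : F ⟶ G) :
    Mono f ↔ ∀ V, Function.Injective (ev f V) := by
  rw [mono_iff_evalAt]
  exact forall_congr' fun V => ModuleCat.mono_iff_injective _

lemma epi_iff_surjective {F G : BCat R R'} (f : F ⟶ G) :
    Epi f ↔ ∀ V, Function.Surjective (ev f V) := by
  rw [epi_iff_evalAt]
  exact forall_congr' fun V => ModuleCat.epi_iff_surjective _

lemma exact_iff_ev {F G H : BCat R R'} (f : F ⟶ G) (g : G ⟶ H) (w : f ≫ g = 0) :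
    (ShortComplex.mk f g w).Exact ↔ ∀ V (x : G.obj.obj V), ev g V x = 0 → ∃ y, ev f V y = x := by
  rw [exact_iff_evalAt]
  exact forall_congr' fun V => ShortComplex.moduleCat_exact_iff _

end Mod

/-! ### Elements of functors with values in abelian groups -/

section Ab

variable {R : Type u} [Ring R]

/-- The component at `V` of a map of pointed functors. -/
def evAb {F G : BAb R} (f : F ⟶ G) (V : FGProj R) : F.obj.obj V →+ G.obj.obj V :=
  (f.hom.app V).hom

/-- The map `F(V) → F(W)` induced by a linear map `V → W`. -/
def mpAb (F : BAb R) {V W : FGProj R} (f : V.obj →ₗ[R] W.obj) : F.obj.obj V →+ F.obj.obj W :=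
  (F.obj.map (lin f)).hom

lemma mpAb_id (F : BAb R) (V : FGProj R) :
    mpAb F (LinearMap.id : V.obj →ₗ[R] V.obj) = AddMonoidHom.id _ :=
  congrArg AddCommGrpCat.Hom.hom (F.obj.map_id V)

lemma mpAb_comp (F : BAb R) {U V W : FGProj R} (f : U.obj →ₗ[R] V.obj) (g : V.obj →ₗ[R] W.obj)
    (x : F.obj.obj U) : mpAb F (g ∘ₗ f) x = mpAb F g (mpAb F f x) :=
  congrArg (fun h => AddCommGrpCat.Hom.hom h x) (F.obj.map_comp (lin f) (lin g))

lemma mpAb_zero (F : BAb R) (V W : FGProj R) : mpAb F (0 : V.obj →ₗ[R] W.obj) = 0 := by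
  ext x
  have h := mpAb_comp F (U := V) (V := zeroFG R) (W := W) 0 0 x
  rw [LinearMap.comp_zero] at h
  rw [h]
  have h0 : mpAb F (0 : V.obj →ₗ[R] (zeroFG R).obj) = 0 :=
    congrArg AddCommGrpCat.Hom.hom ((F.property _ (isZero_zeroFG R)).eq_of_tgt
      (F.obj.map (lin (0 : V.obj →ₗ[R] (zeroFG R).obj))) 0)
  rw [h0, AddMonoidHom.zero_apply, map_zero, AddMonoidHom.zero_apply]

lemma evAb_mpAb {F G : BAb R} (t : F ⟶ G) {V W : FGProj R} (f : V.obj →ₗ[R] W.obj)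
    (x : F.obj.obj V) : evAb t W (mpAb F f x) = mpAb G f (evAb t V x) :=
  congrArg (fun h : F.obj.obj V ⟶ G.obj.obj W => h.hom x) (t.hom.naturality (lin f))

@[simp]
lemma evAb_comp {F G H : BAb R} (s : F ⟶ G) (t : G ⟶ H) (V : FGProj R) (x : F.obj.obj V) :
    evAb (s ≫ t) V x = evAb t V (evAb s V x) := rfl

lemma evAb_ext {F G : BAb R} {s t : F ⟶ G} (h : ∀ V x, evAb s V x = evAb t V x) : s = t :=
  ObjectProperty.hom_ext _ (NatTrans.ext (funext fun V => AddCommGrpCat.ext fun x => h V x))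

/-- A map of pointed functors from its components. -/
def mkHomAb {F G : BAb R} (t : ∀ V : FGProj R, F.obj.obj V →+ G.obj.obj V)
    (ht : ∀ (V W : FGProj R) (f : V.obj →ₗ[R] W.obj) (x : F.obj.obj V),
      t W (mpAb F f x) = mpAb G f (t V x)) : F ⟶ G :=
  ObjectProperty.homMk
    { app := fun V => AddCommGrpCat.ofHom (t V)
      naturality := fun V W f => by
        ext x
        exact ht V W f.hom.hom x }

/-- A pointed functor from abelian groups `T V` and maps between them. -/
def mkFunAb (T : FGProj R → Type u) [∀ V, AddCommGroup (T V)]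
    (m : ∀ {V W : FGProj R}, (V.obj →ₗ[R] W.obj) → (T V →+ T W))
    (hid : ∀ V : FGProj R, m (LinearMap.id : V.obj →ₗ[R] V.obj) = AddMonoidHom.id _)
    (hcomp : ∀ {U V W : FGProj R} (f : U.obj →ₗ[R] V.obj) (g : V.obj →ₗ[R] W.obj),
      m (g ∘ₗ f) = (m g).comp (m f))
    (hzero : ∀ V : FGProj R, m (0 : V.obj →ₗ[R] V.obj) = 0) : BAb R where
  obj :=
    { obj := fun V => AddCommGrpCat.of (T V)
      map := fun f => AddCommGrpCat.ofHom (m f.hom.hom)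
      map_id := fun V => AddCommGrpCat.hom_ext (hid V)
      map_comp := fun f g => AddCommGrpCat.hom_ext (hcomp f.hom.hom g.hom.hom) }
  property := fun V hV => by
    rw [IsZero.iff_id_eq_zero] at hV ⊢
    have h : (LinearMap.id : V.obj →ₗ[R] V.obj) = 0 := congrArg (fun f => f.hom.hom) hV
    have h' := hid V
    rw [h, hzero] at h'
    exact AddCommGrpCat.hom_ext h'.symm

lemma mono_iff_injective_evAb {F G : BAb R} (f : F ⟶ G) :
    Mono f ↔ ∀ V, Function.Injective (evAb f V) := by
  rw [mono_iff_evalAt]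
  exact forall_congr' fun V => AddCommGrpCat.mono_iff_injective _

lemma epi_iff_surjective_evAb {F G : BAb R} (f : F ⟶ G) :
    Epi f ↔ ∀ V, Function.Surjective (evAb f V) := by
  rw [epi_iff_evalAt]
  exact forall_congr' fun V => AddCommGrpCat.epi_iff_surjective _

lemma exact_iff_evAb {F G H : BAb R} (f : F ⟶ G) (g : G ⟶ H) (w : f ≫ g = 0) :
    (ShortComplex.mk f g w).Exact ↔
      ∀ V (x : G.obj.obj V), evAb g V x = 0 → ∃ y, evAb f V y = x := by
  rw [exact_iff_evalAt]
  exact forall_congr' fun V => ShortComplex.ab_exact_iff _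

lemma shortExact_iff_evAb {F G H : BAb R} (f : F ⟶ G) (g : G ⟶ H) (w : f ≫ g = 0) :
    (ShortComplex.mk f g w).ShortExact ↔ ∀ V, Function.Injective (evAb f V) ∧
      (∀ x : G.obj.obj V, evAb g V x = 0 → ∃ y, evAb f V y = x) ∧
      Function.Surjective (evAb g V) := by
  refine ⟨fun h V => ⟨(mono_iff_injective_evAb _).1 h.mono_f V,
    (exact_iff_evAb f g w).1 h.exact V, (epi_iff_surjective_evAb _).1 h.epi_g V⟩, fun h => ?_⟩
  exact { exact := (exact_iff_evAb f g w).2 fun V => (h V).2.1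
          mono_f := (mono_iff_injective_evAb f).2 fun V => (h V).1
          epi_g := (epi_iff_surjective_evAb g).2 fun V => (h V).2.2 }

end Ab

end PointedFunctors


noncomputable section Projectives

/-! ### Projective pointed functors -/

variable {R : Type u} [Ring R] {R' : Type u} [Ring R']

/-- The free module `Rⁿ`, as an object of `R-proj`. -/
def stdFG (R : Type u) [Ring R] (n : ℕ) : FGProj R :=
  ⟨ModuleCat.of R (Fin n → R), inferInstanceAs (Module.Finite R (Fin n → R)),
    inferInstanceAs (Module.Projective R (Fin n → R))⟩

/-- The objects of `R-proj` form a large type, but all are retracts of the modules `Rⁿ`. Hence the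
generators of a covering functor may be indexed by elements of the `F(Rⁿ)` alone, and stay in `Type
u`. -/
lemma exists_retract_stdFG (V : FGProj R) : ∃ (n : ℕ) (p : (stdFG R n).obj →ₗ[R] V.obj)
    (s : V.obj →ₗ[R] (stdFG R n).obj), p ∘ₗ s = LinearMap.id := by
  have := V.property.1
  have := V.property.2
  obtain ⟨n, p, hp⟩ := Module.Finite.exists_fin' R V.obj
  obtain ⟨s, hs⟩ := Module.projective_lifting_property p LinearMap.id hp
  exact ⟨n, p, s, hs⟩

/-- The index set of the basis of the free functor on the elements of the `F(Rⁿ)`. -/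
abbrev CoverIndex (F : BCat R R') (V : FGProj R) : Type u :=
  Σ n : ℕ, F.obj.obj (stdFG R n) × ((stdFG R n).obj →ₗ[R] V.obj)

/-- The functoriality of the free functor. -/
def freeMap (F : BCat R R') {V W : FGProj R} (f : V.obj →ₗ[R] W.obj) :
    (CoverIndex F V →₀ R') →ₗ[R'] (CoverIndex F W →₀ R') :=
  Finsupp.lmapDomain R' R' fun p => ⟨p.1, p.2.1, f ∘ₗ p.2.2⟩

lemma freeMap_single (F : BCat R R') {V W : FGProj R} (f : V.obj →ₗ[R] W.obj)
    (p : CoverIndex F V) (r : R') : freeMap F f (Finsupp.single p r) =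
      Finsupp.single ⟨p.1, p.2.1, f ∘ₗ p.2.2⟩ r :=
  Finsupp.mapDomain_single

lemma freeMap_id (F : BCat R R') (V : FGProj R) :
    freeMap F (LinearMap.id : V.obj →ₗ[R] V.obj) = .id :=
  Finsupp.lmapDomain_id R' R'

lemma freeMap_comp (F : BCat R R') {U V W : FGProj R} (f : U.obj →ₗ[R] V.obj)
    (g : V.obj →ₗ[R] W.obj) (x : CoverIndex F U →₀ R') :
    freeMap F (g ∘ₗ f) x = freeMap F g (freeMap F f x) := by
  rw [← LinearMap.comp_apply (freeMap F g)]
  congr 1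
  refine Finsupp.lhom_ext fun p r => ?_
  rw [LinearMap.comp_apply, freeMap_single, freeMap_single, freeMap_single]
  rfl

/-- The kernel of the endomorphism of the free functor induced by zero. -/
abbrev CoverModule (F : BCat R R') (V : FGProj R) : Submodule R' (CoverIndex F V →₀ R') :=
  LinearMap.ker (freeMap F (0 : V.obj →ₗ[R] V.obj))

/-- The functoriality of the reduced free functor. -/
def coverMap (F : BCat R R') {V W : FGProj R} (f : V.obj →ₗ[R] W.obj) :
    CoverModule F V →ₗ[R'] CoverModule F W :=
  (freeMap F f).restrict fun x hx => by
    rw [LinearMap.mem_ker] at hx ⊢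
    have h : (0 : W.obj →ₗ[R] W.obj) ∘ₗ f = f ∘ₗ (0 : V.obj →ₗ[R] V.obj) := by
      rw [LinearMap.zero_comp, LinearMap.comp_zero]
    rw [← freeMap_comp, h, freeMap_comp, hx, map_zero]

/-- The reduced free functor on the elements of the modules `F(Rⁿ)`. -/
def cover (F : BCat R R') : BCat R R' :=
  mkFun (fun V => CoverModule F V) (fun f => coverMap F f)
    (fun V => LinearMap.ext fun x => Subtype.ext (by
      change freeMap F (LinearMap.id : V.obj →ₗ[R] V.obj) x.1 = x.1
      rw [freeMap_id]; rfl))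
    (fun f g => LinearMap.ext fun x => Subtype.ext (freeMap_comp F f g x.1))
    (fun V => LinearMap.ext fun x => Subtype.ext (LinearMap.mem_ker.1 x.2))

/-- The inclusion of the reduced free functor in the free functor. -/
def coverVal (F : BCat R R') (V : FGProj R) :
    (cover F).obj.obj V →ₗ[R'] (CoverIndex F V →₀ R') :=
  (CoverModule F V).subtype

lemma coverVal_injective (F : BCat R R') (V : FGProj R) : Function.Injective (coverVal F V) :=
  Subtype.val_injective

lemma freeMap_zero_coverVal (F : BCat R R') (V : FGProj R) (x : (cover F).obj.obj V) :
    freeMap F (0 : V.obj →ₗ[R] V.obj) (coverVal F V x) = 0 :=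
  Subtype.property (p := fun y => y ∈ CoverModule F V) x

lemma coverVal_mp (F : BCat R R') {V W : FGProj R} (f : V.obj →ₗ[R] W.obj)
    (x : (cover F).obj.obj V) : coverVal F W (mp (cover F) f x) = freeMap F f (coverVal F V x) :=
  rfl

/-- The projection from the free functor to its reduced part. -/
def coverProj (F : BCat R R') (V : FGProj R) :
    (CoverIndex F V →₀ R') →ₗ[R'] (cover F).obj.obj V :=
  LinearMap.codRestrict (CoverModule F V)
    -- `freeMap F 0` is idempotent, so its complement projects onto its kernel.
    (LinearMap.id - freeMap F (0 : V.obj →ₗ[R] V.obj)) fun x => by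
    rw [LinearMap.mem_ker, LinearMap.sub_apply, map_sub, ← freeMap_comp, LinearMap.zero_comp]
    exact sub_self _

lemma coverVal_coverProj (F : BCat R R') (V : FGProj R) (x : CoverIndex F V →₀ R') :
    coverVal F V (coverProj F V x) = x - freeMap F (0 : V.obj →ₗ[R] V.obj) x := rfl

lemma coverProj_coverVal (F : BCat R R') (V : FGProj R) (x : (cover F).obj.obj V) :
    coverProj F V (coverVal F V x) = x :=
  coverVal_injective F V (by rw [coverVal_coverProj, freeMap_zero_coverVal, sub_zero])

lemma mp_coverProj (F : BCat R R') {V W : FGProj R} (f : V.obj →ₗ[R] W.obj)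
    (x : CoverIndex F V →₀ R') :
    mp (cover F) f (coverProj F V x) = coverProj F W (freeMap F f x) :=
  coverVal_injective F W (by
    rw [coverVal_mp, coverVal_coverProj, coverVal_coverProj, map_sub, ← freeMap_comp,
      ← freeMap_comp, LinearMap.comp_zero, LinearMap.zero_comp])


/-- The map from the free module given by elements `l n y` of `E(Rⁿ)`. -/
def freeDesc {F E : BCat R R'} (l : ∀ n, F.obj.obj (stdFG R n) → E.obj.obj (stdFG R n))
    (V : FGProj R) : (CoverIndex F V →₀ R') →ₗ[R'] E.obj.obj V :=
  Finsupp.linearCombination R' fun p => mp E p.2.2 (l p.1 p.2.1)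

lemma freeDesc_single {F E : BCat R R'} (l : ∀ n, F.obj.obj (stdFG R n) → E.obj.obj (stdFG R n))
    (V : FGProj R) (p : CoverIndex F V) (r : R') :
    freeDesc l V (Finsupp.single p r) = r • mp E p.2.2 (l p.1 p.2.1) :=
  Finsupp.linearCombination_single _ _ _

lemma freeDesc_freeMap {F E : BCat R R'} (l : ∀ n, F.obj.obj (stdFG R n) → E.obj.obj (stdFG R n))
    {V W : FGProj R} (f : V.obj →ₗ[R] W.obj) (x : CoverIndex F V →₀ R') :
    freeDesc l W (freeMap F f x) = mp E f (freeDesc l V x) := by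
  rw [← LinearMap.comp_apply, ← LinearMap.comp_apply]
  congr 1
  refine Finsupp.lhom_ext fun p r => ?_
  rw [LinearMap.comp_apply, LinearMap.comp_apply, freeMap_single, freeDesc_single,
    freeDesc_single, mp_comp_apply, map_smul]

/-- The map from the reduced free functor given by elements `l n y` of `E(Rⁿ)`. -/
def coverDesc {F E : BCat R R'} (l : ∀ n, F.obj.obj (stdFG R n) → E.obj.obj (stdFG R n)) :
    cover F ⟶ E :=
  mkHom (fun V => freeDesc l V ∘ₗ coverVal F V) fun _ _ f x =>
    freeDesc_freeMap l f (coverVal F _ x)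

/-- As `E` is pointed, `freeDesc l` kills the image of `freeMap F 0`, so restricting to the reduced
part loses nothing. -/
lemma ev_coverDesc_coverProj {F E : BCat R R'}
    (l : ∀ n, F.obj.obj (stdFG R n) → E.obj.obj (stdFG R n)) (V : FGProj R)
    (x : CoverIndex F V →₀ R') :
    ev (coverDesc l) V (coverProj F V x) = freeDesc l V x := by
  change freeDesc l V (coverVal F V (coverProj F V x)) = _
  rw [coverVal_coverProj, map_sub, freeDesc_freeMap, mp_zero, LinearMap.zero_apply, sub_zero]

/-- The universal element of the reduced free functor. -/
def coverGen (F : BCat R R') (n : ℕ) (y : F.obj.obj (stdFG R n)) : (cover F).obj.obj (stdFG R n) :=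
  coverProj F _ (Finsupp.single ⟨n, y, LinearMap.id⟩ 1)

lemma mp_coverGen (F : BCat R R') {V : FGProj R} (p : CoverIndex F V) :
    mp (cover F) p.2.2 (coverGen F p.1 p.2.1) = coverProj F V (Finsupp.single p 1) := by
  rw [coverGen, mp_coverProj, freeMap_single]
  rfl

/-- By Yoneda, maps from `cover F` to a pointed functor amount to arbitrary families of elements `l
n y`, the images of the generators `coverGen`. Such a family lifts along a pointwise surjection by
lifting each element. -/
instance projective_cover (F : BCat R R') : Projective (cover F) where
  factors {E G} t e he := by
    rw [epi_iff_surjective] at he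
    choose l hl using fun n (y : F.obj.obj (stdFG R n)) =>
      he (stdFG R n) (ev t _ (coverGen F n y))
    refine ⟨coverDesc l, ev_ext fun V x => ?_⟩
    have : ev e V ∘ₗ freeDesc l V = ev t V ∘ₗ coverProj F V := by
      refine Finsupp.lhom_ext fun p r => ?_
      rw [LinearMap.comp_apply, freeDesc_single, map_smul, ev_mp, hl, ← ev_mp, mp_coverGen,
        LinearMap.comp_apply, ← map_smul, ← map_smul, Finsupp.smul_single_one]
    refine (LinearMap.congr_fun this (coverVal F V x)).trans ?_
    rw [LinearMap.comp_apply, coverProj_coverVal]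

/-- The projection from the reduced free functor on the elements of `F` to `F`. -/
def coverTo (F : BCat R R') : cover F ⟶ F := coverDesc fun _ y => y

/-- If `V` is a retract of `Rⁿ` through `s` and `p`, then `x = F(p)(F(s) x)` is hit by the generator
of `F(s) x`. -/
instance epi_coverTo (F : BCat R R') : Epi (coverTo F) := by
  rw [epi_iff_surjective]
  intro V x
  obtain ⟨n, p, s, h⟩ := exists_retract_stdFG V
  refine ⟨coverProj F V (Finsupp.single ⟨n, mp F s x, p⟩ 1), ?_⟩
  rw [coverTo, ev_coverDesc_coverProj, freeDesc_single, one_smul, ← mp_comp_apply, h, mp_id,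
    LinearMap.id_apply]

instance enoughProjectives_bCat : EnoughProjectives (BCat R R') where
  presentation F := ⟨{ p := cover F, f := coverTo F }⟩

instance projective_cover_obj (F : BCat R R') (V : FGProj R) :
    Module.Projective R' ((cover F).obj.obj V) :=
  Module.Projective.of_split (coverVal F V) (coverProj F V)
    (LinearMap.ext fun x => coverProj_coverVal F V x)

/-- A projective functor is a retract of its cover, whose values are direct summands of free
modules. Applied to resolutions, this yields the vanishing of `Tor` needed for `mulMap_injective`.
-/
lemma projective_obj (F : BCat R R') [Projective F] (V : FGProj R) :
    Module.Projective R' (F.obj.obj V) := by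
  let s : F ⟶ cover F := Projective.factorThru (𝟙 F) (coverTo F)
  have hs : s ≫ coverTo F = 𝟙 F := Projective.factorThru_comp _ _
  exact Module.Projective.of_split (ev s V) (ev (coverTo F) V)
    (LinearMap.ext fun x => congrArg (fun t => ev t V x) hs)

end Projectives


noncomputable section TensorLift

/-! ### Maps from tensor products -/

variable {S T : Type*} [Ring S] [Ring T] (f : S →+* T) (A N : Type*) [Ring A] [AddCommGroup N]
  [Module A N] [Module Tᵐᵒᵖ N] {V : Type*} [AddCommGroup V] [Module S V]

lemma add_btmul (n n' : N) (v : V) :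
    btmul f A N (n + n') v = btmul f A N n v + btmul f A N n' v := by
  simp [btmul, TensorProduct.add_tmul]

lemma smul_btmul (a : A) (n : N) (v : V) :
    a • btmul f A N n v = btmul f A N (a • n) v := rfl

lemma btmul_smul (n : N) (s : S) (v : V) :
    btmul f A N n (s • v) = btmul f A N (MulOpposite.op (f s) • n) v := by
  refine ((Submodule.Quotient.eq (tensorRel f A N V)).2 (Submodule.subset_span ⟨n, s, v, rfl⟩)).symm

/-- The map `N → V → N ⊗_S V` given by pure tensors. -/
def btmulHom : N →+ V →+ BTensor f A N V :=
  AddMonoidHom.mk' (fun n => AddMonoidHom.mk' (btmul f A N n) (btmul_add f A N n)) fun n n' =>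
    AddMonoidHom.ext fun v => add_btmul f A N n n' v

lemma zero_btmul (v : V) : btmul f A N 0 v = 0 :=
  DFunLike.congr_fun (map_zero (btmulHom f A N (V := V))) v

lemma btmul_zero (n : N) : btmul f A N n (0 : V) = 0 :=
  map_zero (btmulHom f A N (V := V) n)

lemma bt_induction {P : BTensor f A N V → Prop} (h : ∀ n v, P (btmul f A N n v))
    (hadd : ∀ x y, P x → P y → P (x + y)) (x : BTensor f A N V) : P x := by
  obtain ⟨x, rfl⟩ := Submodule.mkQ_surjective _ x
  induction x with
  | zero => have := h 0 0; rwa [zero_btmul] at this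
  | tmul n v => exact h n v
  | add x y hx hy => rw [map_add]; exact hadd _ _ hx hy

variable [SMulCommClass A Tᵐᵒᵖ N]

/-- The additive map from `N ⊗_S V` given by a balanced biadditive map. -/
def btLift {W : Type*} [AddCommGroup W] (β : N →+ V →+ W)
    (hβ : ∀ n (s : S) v, β (MulOpposite.op (f s) • n) v = β n (s • v)) : BTensor f A N V →+ W :=
  QuotientAddGroup.lift (tensorRel f A N V).toAddSubgroup (TensorProduct.liftAddHom β fun z n v => by
    rw [map_zsmul, map_zsmul]; rfl) (by
      intro x hx
      -- The relations span an `A`-submodule while `β` is only biadditive, so the induction has to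
      -- treat all multiples `a • x` at once.
      suffices h : ∀ a : A, TensorProduct.liftAddHom β (fun z n v => by
          rw [map_zsmul, map_zsmul]; rfl) (a • x) = 0 by
        have := h 1
        rwa [one_smul] at this
      refine Submodule.span_induction ?_ ?_ ?_ ?_ hx
      · rintro _ ⟨n, s, v, rfl⟩ a
        rw [smul_sub, TensorProduct.smul_tmul', TensorProduct.smul_tmul', map_sub,
          TensorProduct.liftAddHom_tmul, TensorProduct.liftAddHom_tmul, smul_comm, hβ, sub_self]
      · intro a
        rw [smul_zero, map_zero]
      · intro x y _ _ hx hy a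
        rw [smul_add, map_add, hx, hy, add_zero]
      · intro b x _ hx a
        rw [← mul_smul]
        exact hx _)

end TensorLift

noncomputable section Additive

variable {R : Type u} [Ring R] {M : Type u} [AddCommGroup M] [Module R M] [Module Rᵐᵒᵖ M]

/-! ### Additive functors, and natural maps with values in them -/

/-- A functor to abelian groups is additive if it preserves sums of maps. -/
def IsAdd (F : BAb R) : Prop :=
  ∀ {V W : FGProj R} (f g : V.obj →ₗ[R] W.obj) (x : F.obj.obj V),
    mpAb F (f + g) x = mpAb F f x + mpAb F g x

lemma IM_induction {V : FGProj R} {P : (IM R M).obj.obj V → Prop}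
    (h : ∀ m v, P (tmulIM M V m v)) (hadd : ∀ x y, P x → P y → P (x + y))
    (x : (IM R M).obj.obj V) : P x :=
  bt_induction (RingHom.id R) R M (P := P) h hadd x

lemma mp_tmulIM {V W : FGProj R} (f : V.obj →ₗ[R] W.obj) (m : M) (v : V.obj) :
    mp (IM R M) f (tmulIM M V m v) = tmulIM M W m (f v) := rfl

lemma isAdd_IM : IsAdd ((eLower R).obj (IM R M)) := fun {V W} f g x => by
  refine IM_induction (P := fun x => mp (IM R M) (f + g) x =
    mp (IM R M) f x + mp (IM R M) g x) (fun m v => ?_) (fun x y hx hy => ?_) x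
  · exact btmul_add (V := W.obj) _ _ _ _ _ _
  · rw [map_add, map_add, map_add, hx, hy]; abel

/-- The product in `R-proj`. -/
def prodFG (V W : FGProj R) : FGProj R :=
  ⟨ModuleCat.of R (V.obj × W.obj), by
    have := V.property.1
    have := V.property.2
    have := W.property.1
    have := W.property.2
    exact ⟨inferInstanceAs (Module.Finite R (V.obj × W.obj)),
      inferInstanceAs (Module.Projective R (V.obj × W.obj))⟩⟩

/-- A natural map in two variables, with values in an additive subfunctor, vanishes if it vanishes
when one of the variables is zero. -/
lemma eq_zero_of_natural₂ {B C : BAb R} (hB : IsAdd B) (b : B ⟶ C)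
    (e : ∀ V : FGProj R, V.obj → V.obj → C.obj.obj V)
    (he : ∀ {V W : FGProj R} (f : V.obj →ₗ[R] W.obj) (v v' : V.obj),
      mpAb C f (e V v v') = e W (f v) (f v'))
    (hb : ∀ V v v', ∃ y, evAb b V y = e V v v')
    (h₁ : ∀ V v, e V v 0 = 0) (h₂ : ∀ V v, e V 0 v = 0) (V : FGProj R) (v v' : V.obj) :
    e V v v' = 0 := by
  -- The pair `(v, v')` is the image under `p + q` of the universal pair `(i, j)` on `V × V`.
  -- Additivity of `B` splits the value into the parts along `p` and `q`; as `p` kills `j` and `q`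
  -- kills `i`, each part has a zero variable.
  let p : (prodFG V V).obj →ₗ[R] V.obj := LinearMap.fst R V.obj V.obj
  let q : (prodFG V V).obj →ₗ[R] V.obj := LinearMap.snd R V.obj V.obj
  let i : (prodFG V V).obj := ((v, 0) : V.obj × V.obj)
  let j : (prodFG V V).obj := ((0, v') : V.obj × V.obj)
  obtain ⟨y, hy⟩ := hb (prodFG V V) i j
  have hi : (p + q) i = v := add_zero v
  have hj : (p + q) j = v' := zero_add v'
  have := he (p + q) i j
  rw [hi, hj] at this
  rw [← this, ← hy, ← evAb_mpAb, hB, map_add, evAb_mpAb, evAb_mpAb, hy, he, he]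
  exact (congrArg₂ (· + ·) (h₁ V v) (h₂ V v')).trans (add_zero 0)

/-- A natural map in three variables, with values in an additive subfunctor, vanishes if it vanishes
when two of the variables are zero. -/
lemma eq_zero_of_natural₃ {B C : BAb R} (hB : IsAdd B) (b : B ⟶ C)
    (e : ∀ V : FGProj R, V.obj → V.obj → V.obj → C.obj.obj V)
    (he : ∀ {V W : FGProj R} (f : V.obj →ₗ[R] W.obj) (v v' v'' : V.obj),
      mpAb C f (e V v v' v'') = e W (f v) (f v') (f v''))
    (hb : ∀ V v v' v'', ∃ y, evAb b V y = e V v v' v'')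
    (h₁ : ∀ V v, e V v 0 0 = 0) (h₂ : ∀ V v, e V 0 v 0 = 0) (h₃ : ∀ V v, e V 0 0 v = 0)
    (V : FGProj R) (v v' v'' : V.obj) : e V v v' v'' = 0 := by
  let p : (prodFG V (prodFG V V)).obj →ₗ[R] V.obj := LinearMap.fst R V.obj (V.obj × V.obj)
  let q : (prodFG V (prodFG V V)).obj →ₗ[R] V.obj :=
    LinearMap.fst R V.obj V.obj ∘ₗ LinearMap.snd R V.obj (V.obj × V.obj)
  let r : (prodFG V (prodFG V V)).obj →ₗ[R] V.obj :=
    LinearMap.snd R V.obj V.obj ∘ₗ LinearMap.snd R V.obj (V.obj × V.obj)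
  let i : (prodFG V (prodFG V V)).obj := ((v, 0, 0) : V.obj × V.obj × V.obj)
  let j : (prodFG V (prodFG V V)).obj := ((0, v', 0) : V.obj × V.obj × V.obj)
  let k : (prodFG V (prodFG V V)).obj := ((0, 0, v'') : V.obj × V.obj × V.obj)
  obtain ⟨y, hy⟩ := hb (prodFG V (prodFG V V)) i j k
  have hi : (p + q + r) i = v := (add_zero (v + 0)).trans (add_zero v)
  have hj : (p + q + r) j = v' := (add_zero (0 + v')).trans (zero_add v')
  have hk : (p + q + r) k = v'' := by
    change (0 : V.obj) + 0 + v'' = v''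
    rw [add_zero, zero_add]
  have := he (p + q + r) i j k
  rw [hi, hj, hk] at this
  rw [← this, ← hy, ← evAb_mpAb, hB, hB, map_add, map_add, evAb_mpAb, evAb_mpAb, evAb_mpAb, hy,
    he, he, he]
  refine (congrArg₂ (· + ·) (congrArg₂ (· + ·) (h₁ V v) (h₂ V v')) (h₃ V v'')).trans ?_
  rw [add_zero, add_zero]

/-- The free module of rank one, as an object of `R-proj`. -/
def oneFG (R : Type u) [Ring R] : FGProj R :=
  ⟨ModuleCat.of R R, inferInstanceAs (Module.Finite R R), inferInstanceAs (Module.Projective R R)⟩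

/-- The map `R → V` given by an element of `V`. -/
def toFG {V : FGProj R} (v : V.obj) : (oneFG R).obj →ₗ[R] V.obj :=
  LinearMap.toSpanSingleton R V.obj v

/-- The natural map `V → F(V)` given by an element of `F(R)`. -/
def sec (F : BAb R) (s : F.obj.obj (oneFG R)) (V : FGProj R) (v : V.obj) : F.obj.obj V :=
  mpAb F (toFG v) s

lemma comp_toFG {V W : FGProj R} (f : V.obj →ₗ[R] W.obj) (v : V.obj) :
    f ∘ₗ toFG v = toFG (f v) :=
  LinearMap.ext fun _ => map_smul f _ _

lemma mpAb_sec (F : BAb R) (s : F.obj.obj (oneFG R)) {V W : FGProj R} (f : V.obj →ₗ[R] W.obj)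
    (v : V.obj) : mpAb F f (sec F s V v) = sec F s W (f v) := by
  rw [sec, ← mpAb_comp, comp_toFG]
  rfl

lemma sec_zero (F : BAb R) (s : F.obj.obj (oneFG R)) (V : FGProj R) : sec F s V 0 = 0 := by
  have : toFG (0 : V.obj) = 0 := LinearMap.toSpanSingleton_zero _ _
  rw [sec, this, mpAb_zero]
  rfl

lemma evAb_sec {F G : BAb R} (t : F ⟶ G) (s : F.obj.obj (oneFG R)) (V : FGProj R) (v : V.obj) :
    evAb t V (sec F s V v) = sec G (evAb t _ s) V v :=
  evAb_mpAb _ _ _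

lemma sec_I_one (V : FGProj R) (v : V.obj) :
    sec ((eLower R).obj (I R)) (1 : R) V v = v := one_smul R v

lemma tmulIM_toFG (V : FGProj R) (v : V.obj) (m : M) :
    mp (IM R M) (toFG v) (tmulIM M (oneFG R) m (1 : R)) = tmulIM M V m v :=
  congrArg (tmulIM M V m) (one_smul R v)

/-- The isomorphism `M ⊗_R R ≅ M`. -/
def tensorOne [SMulCommClass R Rᵐᵒᵖ M] : (IM R M).obj.obj (oneFG R) →+ M :=
  btLift (RingHom.id R) R M (V := R) (AddMonoidHom.mk' (fun m => AddMonoidHom.mk'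
      (fun r : R => MulOpposite.op r • m)
      fun _ _ => by rw [MulOpposite.op_add, add_smul]) fun m n => AddMonoidHom.ext fun _ => by
        exact smul_add _ _ _)
    fun m s r => by
      change MulOpposite.op r • MulOpposite.op s • m = MulOpposite.op (s * r) • m
      rw [MulOpposite.op_mul, mul_smul]

lemma tensorOne_tmulIM [SMulCommClass R Rᵐᵒᵖ M] (m : M) (r : R) :
    tensorOne (tmulIM M (oneFG R) m r) = MulOpposite.op r • m := rfl

lemma exists_tmulIM_eq (y : (IM R M).obj.obj (oneFG R)) :
    ∃ m : M, tmulIM M (oneFG R) m (1 : R) = y := by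
  refine bt_induction (RingHom.id R) R M (V := R) (P := fun y => ∃ m : M,
    btmul (RingHom.id R) R M m (1 : R) = y) (fun m r => ?_) ?_ y
  · refine ⟨MulOpposite.op r • m, ?_⟩
    have := btmul_smul (RingHom.id R) R M m r (1 : R)
    rw [smul_eq_mul, mul_one] at this
    exact this.symm
  · rintro _ _ ⟨m, rfl⟩ ⟨n, rfl⟩
    exact ⟨m + n, add_btmul _ _ _ _ _ _⟩

lemma tmulMap_injective [SMulCommClass R Rᵐᵒᵖ M] :
    Function.Injective (tmulMap (R := R) (M := M)) := by
  intro m n h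
  have hm : ∀ m : M, tensorOne (evAb (tmulMap (R := R) m) (oneFG R) (1 : R)) = m := fun m =>
    (tensorOne_tmulIM m 1).trans (one_smul _ _)
  rw [← hm m, h, hm]

/-- By naturality along the maps `R → V`, `1 ↦ v`, the map `t` is determined by its value at `1 ∈
R`, which lies in `M ⊗_R R ≅ M`. -/
lemma exists_tmulMap_eq (t : (eLower R).obj (I R) ⟶ (eLower R).obj (IM R M)) :
    ∃ m : M, tmulMap m = t := by
  obtain ⟨m, hm⟩ := exists_tmulIM_eq (evAb t (oneFG R) (1 : R))
  refine ⟨m, evAb_ext fun V v => ?_⟩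
  have := evAb_mpAb t (toFG (V := V) v) (1 : R)
  rw [← hm] at this
  have hv : mpAb ((eLower R).obj (I R)) (toFG (V := V) v) (1 : R) = v :=
    sec_I_one V v
  rw [hv] at this
  exact (tmulIM_toFG V v m).symm.trans this.symm

end Additive


section TwistedSum

/-! ### Extensions of abelian groups given by cocycles -/

/-- A normalized symmetric 2-cocycle. -/
structure SymmCocycle (A C : Type*) [AddCommGroup A] [AddCommGroup C] where
  toFun : A → A → C
  symm (x y : A) : toFun x y = toFun y x
  zero (x : A) : toFun 0 x = 0
  cocycle (x y z : A) : toFun x y + toFun (x + y) z = toFun y z + toFun x (y + z)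

/-- The extension of abelian groups given by a symmetric cocycle. -/
@[ext]
structure TwistedSum {A C : Type*} [AddCommGroup A] [AddCommGroup C] (c : SymmCocycle A C) where
  fst : A
  snd : C

namespace TwistedSum

variable {A C : Type*} [AddCommGroup A] [AddCommGroup C] (c : SymmCocycle A C)

instance : Add (TwistedSum c) := ⟨fun x y => ⟨x.fst + y.fst, x.snd + y.snd + c.toFun x.fst y.fst⟩⟩
instance : Zero (TwistedSum c) := ⟨⟨0, 0⟩⟩
instance : Neg (TwistedSum c) := ⟨fun x => ⟨-x.fst, -x.snd - c.toFun x.fst (-x.fst)⟩⟩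

@[simp] lemma add_fst (x y : TwistedSum c) : (x + y).fst = x.fst + y.fst := rfl
@[simp] lemma add_snd (x y : TwistedSum c) :
    (x + y).snd = x.snd + y.snd + c.toFun x.fst y.fst := rfl
@[simp] lemma zero_fst : (0 : TwistedSum c).fst = 0 := rfl
@[simp] lemma zero_snd : (0 : TwistedSum c).snd = 0 := rfl
@[simp] lemma neg_fst (x : TwistedSum c) : (-x).fst = -x.fst := rfl
@[simp] lemma neg_snd (x : TwistedSum c) : (-x).snd = -x.snd - c.toFun x.fst (-x.fst) := rfl

instance : AddCommGroup (TwistedSum c) where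
  add_assoc x y z := by
    ext
    · simp [add_assoc]
    · have := c.cocycle x.fst y.fst z.fst
      simp only [add_snd, add_fst]
      rw [show x.snd + y.snd + c.toFun x.fst y.fst + z.snd + c.toFun (x.fst + y.fst) z.fst =
        x.snd + y.snd + z.snd + (c.toFun x.fst y.fst + c.toFun (x.fst + y.fst) z.fst) by abel, this]
      abel
  zero_add x := by ext <;> simp [c.zero]
  add_zero x := by ext <;> simp [c.zero, c.symm x.fst 0]
  add_comm x y := by
    ext
    · simp [add_comm]
    · simp [c.symm x.fst y.fst, add_comm]
  neg_add_cancel x := by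
    ext
    · simp
    · simp only [add_snd, neg_snd, neg_fst, zero_snd, c.symm (-x.fst)]
      abel
  nsmul := nsmulRec
  zsmul := zsmulRec

end TwistedSum

end TwistedSum

noncomputable section Splittings

variable {R : Type u} [Ring R]

/-! ### Existence of splittings -/

/-- The additivity defect of the section `sec φ.C₀ s` is killed by `a`. Lifting it to `C₁` once, for
the two basis vectors of `R²`, and transporting along `R² → V` gives a natural lift. The cocycle
conditions then hold because their defects are natural, lie in the additive functor `B`, and vanish
on the axes. -/
lemma exists_natural_cocycle {B : BAb R} (hB : IsAdd B)
    (φ : ElemExt ((eLower R).obj (I R)) B) (s : φ.C₀.obj.obj (oneFG R))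
    (hs : evAb φ.a (oneFG R) s = (1 : R)) :
    ∃ c : ∀ V : FGProj R, SymmCocycle V.obj (φ.C₁.obj.obj V),
      (∀ {V W : FGProj R} (f : V.obj →ₗ[R] W.obj) (v v' : V.obj),
        mpAb φ.C₁ f ((c V).toFun v v') = (c W).toFun (f v) (f v')) ∧
      ∀ (V : FGProj R) (v v' : V.obj), evAb φ.d V ((c V).toFun v v') =
        sec φ.C₀ s V v + sec φ.C₀ s V v' - sec φ.C₀ s V (v + v') := by
  have ha : ∀ V (v : V.obj), evAb φ.a V (sec φ.C₀ s V v) = v := fun V v => by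
    rw [evAb_sec, hs]; exact sec_I_one V v
  have hex₀ := (exact_iff_evAb _ _ _).1 φ.exact₀
  have hex₁ := (exact_iff_evAb _ _ _).1 φ.exact₁
  -- the universal case
  let o : FGProj R := oneFG R
  let i : (prodFG o o).obj := ((1, 0) : R × R)
  let j : (prodFG o o).obj := ((0, 1) : R × R)
  obtain ⟨x, hx⟩ := hex₀ (prodFG o o)
    (sec φ.C₀ s _ i + sec φ.C₀ s _ j - sec φ.C₀ s _ (i + j)) (by
      rw [map_sub, map_add, ha, ha, ha]; exact sub_self _)
  let p (V : FGProj R) (v v' : V.obj) : (prodFG o o).obj →ₗ[R] V.obj :=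
    LinearMap.coprod (LinearMap.toSpanSingleton R V.obj v) (LinearMap.toSpanSingleton R V.obj v')
  have hpi : ∀ V (v v' : V.obj), p V v v' i = v := fun V v v' => by
    change (1 : R) • v + (0 : R) • v' = v
    rw [one_smul, zero_smul, add_zero]
  have hpj : ∀ V (v v' : V.obj), p V v v' j = v' := fun V v v' => by
    change (0 : R) • v + (1 : R) • v' = v'
    rw [one_smul, zero_smul, zero_add]
  have hp : ∀ {V W : FGProj R} (f : V.obj →ₗ[R] W.obj) (v v' : V.obj),
      f ∘ₗ p V v v' = p W (f v) (f v') := fun f v v' => by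
    refine LinearMap.ext fun (r : R × R) => ?_
    change f (r.1 • v + r.2 • v') = r.1 • f v + r.2 • f v'
    rw [map_add, map_smul, map_smul]
  let y (V : FGProj R) (v v' : V.obj) : φ.C₁.obj.obj V := mpAb φ.C₁ (p V v v') x
  have hyn : ∀ {V W : FGProj R} (f : V.obj →ₗ[R] W.obj) (v v' : V.obj),
      mpAb φ.C₁ f (y V v v') = y W (f v) (f v') := fun f v v' => by
    dsimp only [y]
    rw [← mpAb_comp, hp]
  have hyd : ∀ V (v v' : V.obj), evAb φ.d V (y V v v') =
      sec φ.C₀ s V v + sec φ.C₀ s V v' - sec φ.C₀ s V (v + v') := fun V v v' => by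
    dsimp only [y]
    rw [evAb_mpAb, hx, map_sub, map_add, mpAb_sec, mpAb_sec, mpAb_sec, map_add, hpi, hpj]
  have hy0 : ∀ V : FGProj R, y V 0 0 = 0 := fun V => by
    have h : p V 0 0 = 0 := LinearMap.ext fun (r : R × R) => by
      change r.1 • (0 : V.obj) + r.2 • (0 : V.obj) = 0
      rw [smul_zero, smul_zero, add_zero]
    dsimp only [y]
    rw [h, mpAb_zero]
    rfl
  -- normalization
  let c (V : FGProj R) (v v' : V.obj) : φ.C₁.obj.obj V := y V v v' - y V v 0 - y V 0 v'
  have hcn : ∀ {V W : FGProj R} (f : V.obj →ₗ[R] W.obj) (v v' : V.obj),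
      mpAb φ.C₁ f (c V v v') = c W (f v) (f v') := fun f v v' => by
    simp only [c, map_sub, hyn, map_zero]
  -- Normalization does not change the image under `d`: the section vanishes at `0`, so the
  -- subtracted terms are killed by `d`.
  have hcd : ∀ V (v v' : V.obj), evAb φ.d V (c V v v') =
      sec φ.C₀ s V v + sec φ.C₀ s V v' - sec φ.C₀ s V (v + v') := fun V v v' => by
    simp only [c, map_sub, hyd, add_zero, zero_add, sec_zero, sub_self, sub_zero]
  have hc₁ : ∀ V (v : V.obj), c V v 0 = 0 := fun V v => by simp [c, hy0]
  have hc₂ : ∀ V (v : V.obj), c V 0 v = 0 := fun V v => by simp [c, hy0]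
  have hrange : ∀ V (z : φ.C₁.obj.obj V), evAb φ.d V z = 0 → ∃ b, evAb φ.b V b = z := hex₁
  -- The defects of symmetry and of the cocycle identity are killed by `d`, since the image of `c`
  -- is the symmetric coboundary of `sec`. So they come from `B`, and the rigidity lemmas apply.
  refine ⟨fun V => ⟨c V, fun v v' => ?_, hc₂ V, fun v v' v'' => ?_⟩, hcn, hcd⟩
  · rw [← sub_eq_zero]
    refine eq_zero_of_natural₂ hB φ.b (fun V v v' => c V v v' - c V v' v) (fun f v v' => ?_)
      (fun V v v' => ?_) (fun V v => ?_) (fun V v => ?_) V v v'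
    · rw [map_sub, hcn, hcn]
    · refine hrange _ _ ?_
      rw [map_sub, hcd, hcd, add_comm v v']
      abel
    · rw [hc₁, hc₂, sub_zero]
    · rw [hc₁, hc₂, sub_zero]
  · rw [← sub_eq_zero]
    refine eq_zero_of_natural₃ hB φ.b
      (fun V v v' v'' => c V v v' + c V (v + v') v'' - (c V v' v'' + c V v (v' + v'')))
      (fun f v v' v'' => ?_) (fun V v v' v'' => ?_) (fun V v => ?_) (fun V v => ?_) (fun V v => ?_)
      V v v' v''
    · simp only [map_sub, map_add, hcn]
    · refine hrange _ _ ?_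
      rw [map_sub, map_add, map_add, hcd, hcd, hcd, hcd, add_assoc v v' v'']
      abel
    · simp only [add_zero, hc₁, sub_self]
    · simp only [add_zero, zero_add, hc₁, hc₂, sub_self]
    · simp only [add_zero, zero_add, hc₂, sub_self]

/-- `C₀₁(V)` is `V × C₁(V)` with addition twisted by the natural cocycle, and `c₀` sends `(v, x)` to
`sec v + d x`. The cocycle is exactly what makes `c₀` additive. -/
lemma exists_splitting {B : BAb R} (hB : IsAdd B) (φ : ElemExt ((eLower R).obj (I R)) B) :
    Nonempty φ.Splitting := by
  obtain ⟨s, hs⟩ := (epi_iff_surjective_evAb φ.a).1 φ.epi_a (oneFG R) (1 : R)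
  obtain ⟨c, hcn, hcd⟩ := exists_natural_cocycle hB φ s hs
  have ha : ∀ V (v : V.obj), evAb φ.a V (sec φ.C₀ s V v) = v := fun V v => by
    rw [evAb_sec, hs]; exact sec_I_one V v
  have hda : ∀ V x, evAb φ.a V (evAb φ.d V x) = 0 := fun V x =>
    congrArg (fun t => evAb t V x) φ.d_a
  have hbd : ∀ V x, evAb φ.d V (evAb φ.b V x) = 0 := fun V x =>
    congrArg (fun t => evAb t V x) φ.b_d
  have hex₀ := (exact_iff_evAb _ _ _).1 φ.exact₀
  have hex₁ := (exact_iff_evAb _ _ _).1 φ.exact₁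
  have hb := (mono_iff_injective_evAb φ.b).1 φ.mono_b
  let D : BAb R := mkFunAb (fun V => TwistedSum (c V))
    (fun f => AddMonoidHom.mk' (fun x => ⟨f x.fst, mpAb φ.C₁ f x.snd⟩) fun x y =>
      TwistedSum.ext (map_add f _ _) (by
        simp only [TwistedSum.add_snd, map_add, hcn]))
    (fun V => AddMonoidHom.ext fun x => TwistedSum.ext rfl (by
      change mpAb φ.C₁ LinearMap.id x.snd = x.snd
      rw [mpAb_id]; rfl))
    (fun f g => AddMonoidHom.ext fun x => TwistedSum.ext rfl (mpAb_comp _ f g _))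
    (fun V => AddMonoidHom.ext fun x => TwistedSum.ext rfl (by
      change mpAb φ.C₁ 0 x.snd = 0
      rw [mpAb_zero]; rfl))
  let c₁ : φ.C₁ ⟶ D := mkHomAb
    (fun V => (AddMonoidHom.mk' (fun x => ⟨0, x⟩) fun x y => TwistedSum.ext (add_zero _).symm (by
      rw [TwistedSum.add_snd, (c V).zero, add_zero]) : φ.C₁.obj.obj V →+ TwistedSum (c V)))
    fun V W f x => TwistedSum.ext (map_zero f).symm rfl
  let c₀ : D ⟶ φ.C₀ := mkHomAb
    (fun V => (AddMonoidHom.mk' (fun x => sec φ.C₀ s V x.fst + evAb φ.d V x.snd) fun x y => by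
      simp only [TwistedSum.add_fst, TwistedSum.add_snd, map_add, hcd]
      abel : TwistedSum (c V) →+ φ.C₀.obj.obj V))
    fun V W f x => by
      change sec φ.C₀ s W (f x.fst) + evAb φ.d W (mpAb φ.C₁ f x.snd) =
        mpAb φ.C₀ f (sec φ.C₀ s V x.fst + evAb φ.d V x.snd)
      rw [map_add, mpAb_sec, evAb_mpAb]
  have hc₁ : ∀ V (x : φ.C₁.obj.obj V), evAb c₁ V x = (⟨0, x⟩ : TwistedSum (c V)) :=
    fun _ _ => rfl
  have hc₀ : ∀ V (x : D.obj.obj V), evAb c₀ V x = sec φ.C₀ s V (TwistedSum.fst (c := c V) x) +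
    evAb φ.d V (TwistedSum.snd (c := c V) x) := fun _ _ => rfl
  have hac₀ : ∀ V (x : D.obj.obj V),
      evAb (c₀ ≫ φ.a) V x = TwistedSum.fst (c := c V) x := fun V x => by
    rw [evAb_comp, hc₀, map_add, ha, hda]
    exact add_zero (TwistedSum.fst (c := c V) x)
  refine ⟨⟨D, c₁, c₀, evAb_ext fun V x => ?_, ?_, ?_⟩⟩
  · refine (hc₀ V _).trans ?_
    exact (congrArg (· + evAb φ.d V x) (sec_zero _ _ _)).trans (zero_add _)
  · refine (shortExact_iff_evAb _ _ _).2 fun V => ⟨fun x y h => congrArg TwistedSum.snd h,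
      fun x hx => ?_, fun v => ⟨⟨v, 0⟩, hac₀ V _⟩⟩
    have hx' : TwistedSum.fst (c := c V) x = 0 := (hac₀ V x).symm.trans hx
    exact ⟨TwistedSum.snd x, TwistedSum.ext hx'.symm rfl⟩
  · refine (shortExact_iff_evAb _ _ _).2 fun V => ⟨fun x y h => hb V (congrArg TwistedSum.snd h),
      fun x hx => ?_, fun z => ?_⟩
    · have hx' : TwistedSum.fst (c := c V) x = 0 := by
        rw [← hac₀ V x, evAb_comp, hx, map_zero]
        rfl
      have hx'' : evAb φ.d V (TwistedSum.snd (c := c V) x) = 0 := by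
        rw [hc₀, hx', sec_zero, zero_add] at hx
        exact hx
      obtain ⟨y, hy⟩ := hex₁ V _ hx''
      exact ⟨y, TwistedSum.ext hx'.symm hy⟩
    · let v : V.obj := evAb φ.a V z
      obtain ⟨x, hx⟩ := hex₀ V (z - sec φ.C₀ s V v) (by
        rw [map_sub, sub_eq_zero]
        exact (ha V v).symm)
      refine ⟨⟨v, x⟩, (hc₀ V _).trans ?_⟩
      change sec φ.C₀ s V v + evAb φ.d V x = z
      rw [hx, add_sub_cancel]

/-! ### Maps between splittings -/

namespace ElemExt.Splitting

variable {B B' : BAb R} {φ : ElemExt ((eLower R).obj (I R)) B}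
  {ψ : ElemExt ((eLower R).obj (I R)) B'} (S : φ.Splitting) (S' : ψ.Splitting)

/-- Each element of `C₀₁(V)` is uniquely `sec σ v + c₁ z`, where `σ` lifts `1 ∈ R`. With `τ` a
suitable image of `σ`, put `h(sec σ v + c₁ z) = sec τ v + c₁' f₁ z`; rigidity shows that this is
additive. The pair `f₁`, `f₀` need not be the identity on the ends, so multiplications by `r` are
allowed as well. -/
lemma exists_lift (hB' : IsAdd B') (f₁ : φ.C₁ ⟶ ψ.C₁) (f₀ : φ.C₀ ⟶ ψ.C₀)
    (hf : φ.d ≫ f₀ = f₁ ≫ ψ.d) :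
    ∃ h : S.C₀₁ ⟶ S'.C₀₁, S.c₁ ≫ h = f₁ ≫ S'.c₁ ∧ h ≫ S'.c₀ = S.c₀ ≫ f₀ := by
  have hS₁ := (shortExact_iff_evAb _ _ _).1 S.shortExact₁
  have hS₀' := (shortExact_iff_evAb _ _ _).1 S'.shortExact₀
  have hc : ∀ V x, evAb S.c₀ V (evAb S.c₁ V x) = evAb φ.d V x := fun V x =>
    congrArg (fun t => evAb t V x) S.c₁_c₀
  have hc' : ∀ V x, evAb S'.c₀ V (evAb S'.c₁ V x) = evAb ψ.d V x := fun V x =>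
    congrArg (fun t => evAb t V x) S'.c₁_c₀
  have hf' : ∀ V x, evAb f₀ V (evAb φ.d V x) = evAb ψ.d V (evAb f₁ V x) := fun V x =>
    congrArg (fun t => evAb t V x) hf
  obtain ⟨σ, hσ⟩ := (hS₁ (oneFG R)).2.2 (1 : R)
  -- The second condition on `h` forces the image `τ` of `σ` to lie over `f₀ (c₀ σ)`.
  obtain ⟨τ, hτ⟩ := (hS₀' (oneFG R)).2.2 (evAb f₀ _ (evAb S.c₀ _ σ))
  let q (V : FGProj R) (x : S.C₀₁.obj.obj V) : V.obj := evAb (S.c₀ ≫ φ.a) V x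
  have hqadd : ∀ V x y, q V (x + y) = q V x + q V y := fun V x y => map_add _ _ _
  have hqσ : ∀ V (v : V.obj), q V (sec S.C₀₁ σ V v) = v := fun V v => by
    dsimp only [q]
    rw [evAb_sec, hσ]; exact sec_I_one V v
  -- elements of `C₀₁` as sums of a section and an element of `C₁`
  have hz : ∀ V (x : S.C₀₁.obj.obj V), ∃ z, evAb S.c₁ V z = x - sec S.C₀₁ σ V (q V x) :=
    fun V x => (hS₁ V).2.1 _ (by
      rw [map_sub]
      exact (congrArg (fun t : V.obj => q V x - t) (hqσ V (q V x))).trans (sub_self (q V x)))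
  choose z hz using hz
  have hκ : ∀ V (v v' : V.obj), ∃ k, evAb S.c₁ V k =
      sec S.C₀₁ σ V (v + v') - sec S.C₀₁ σ V v - sec S.C₀₁ σ V v' :=
    fun V v v' => (hS₁ V).2.1 _ (by
      change q V _ = 0
      have h1 : ∀ x y, q V (x - y) = q V x - q V y := fun x y => map_sub _ _ _
      rw [h1, h1, hqσ, hqσ, hqσ]
      abel)
  choose κ hκ using hκ
  have hκn : ∀ {V W : FGProj R} (f : V.obj →ₗ[R] W.obj) (v v' : V.obj),
      mpAb φ.C₁ f (κ V v v') = κ W (f v) (f v') := fun f v v' => (hS₁ _).1 (by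
    rw [evAb_mpAb, hκ, hκ, map_sub, map_sub, mpAb_sec, mpAb_sec, mpAb_sec, map_add])
  have hκ0 : ∀ V (v v' : V.obj), v = 0 ∨ v' = 0 → κ V v v' = 0 := fun V v v' h => (hS₁ V).1 (by
    rw [hκ, map_zero]
    obtain rfl | rfl := h
    · rw [zero_add, sec_zero, sub_zero, sub_self]
    · rw [add_zero, sec_zero, sub_zero, sub_self])
  -- the defect of additivity of the section `τ` is the image of `κ`
  have key : ∀ V (v v' : V.obj), sec S'.C₀₁ τ V (v + v') - sec S'.C₀₁ τ V v - sec S'.C₀₁ τ V v' -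
      evAb S'.c₁ V (evAb f₁ V (κ V v v')) = 0 := by
    have h0 : ∀ V (v v' : V.obj), v = 0 ∨ v' = 0 →
        sec S'.C₀₁ τ V (v + v') - sec S'.C₀₁ τ V v - sec S'.C₀₁ τ V v' -
          evAb S'.c₁ V (evAb f₁ V (κ V v v')) = 0 := fun V v v' h => by
      rw [hκ0 V v v' h, map_zero, map_zero, sub_zero]
      obtain rfl | rfl := h
      · rw [zero_add, sec_zero, sub_zero, sub_self]
      · rw [add_zero, sec_zero, sub_zero, sub_self]
    intro V v v'
    refine eq_zero_of_natural₂ hB' (ψ.b ≫ S'.c₁) (fun V v v' =>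
      sec S'.C₀₁ τ V (v + v') - sec S'.C₀₁ τ V v - sec S'.C₀₁ τ V v' -
        evAb S'.c₁ V (evAb f₁ V (κ V v v'))) (fun {V W} f v v' => ?_)
      (fun V v v' => (hS₀' V).2.1 _ ?_) (fun V v => h0 V v 0 (Or.inr rfl))
      (fun V v => h0 V 0 v (Or.inl rfl)) V v v'
    · rw [map_sub, map_sub, map_sub, mpAb_sec, mpAb_sec, mpAb_sec, map_add, ← evAb_mpAb,
        ← evAb_mpAb, hκn]
    -- Both sections have matching images in `ψ.C₀`, so the difference of the two defects is killed
    -- by `c₀` and comes from `B'`.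
    · have hsec : ∀ v : V.obj, evAb S'.c₀ V (sec S'.C₀₁ τ V v) =
          evAb f₀ V (evAb S.c₀ V (sec S.C₀₁ σ V v)) := fun v => by
        rw [evAb_sec, hτ, evAb_sec, evAb_sec]
      rw [map_sub, map_sub, map_sub, hsec, hsec, hsec, hc', ← hf', ← hc, hκ, ← map_sub, ← map_sub,
        ← map_sub, ← map_sub, ← map_sub, sub_self, map_zero]
  let H (V : FGProj R) (x : S.C₀₁.obj.obj V) : S'.C₀₁.obj.obj V :=
    sec S'.C₀₁ τ V (q V x) + evAb S'.c₁ V (evAb f₁ V (z V x))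
  have hadd : ∀ V x y, H V (x + y) = H V x + H V y := fun V x y => by
    have hzadd : z V (x + y) = z V x + z V y - κ V (q V x) (q V y) := (hS₁ V).1 (by
      rw [map_sub, map_add, hz, hz, hz, hκ, hqadd]
      abel)
    have hk := key V (q V x) (q V y)
    dsimp only [H]
    rw [hqadd, hzadd, map_sub, map_sub, map_add, map_add]
    rw [sub_eq_zero] at hk
    rw [← hk]
    abel
  have hnat : ∀ V W (f : V.obj →ₗ[R] W.obj) (x : S.C₀₁.obj.obj V),
      H W (mpAb S.C₀₁ f x) = mpAb S'.C₀₁ f (H V x) := fun V W f x => by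
    have hqn : q W (mpAb S.C₀₁ f x) = f (q V x) := evAb_mpAb (S.c₀ ≫ φ.a) f x
    have hzn : z W (mpAb S.C₀₁ f x) = mpAb φ.C₁ f (z V x) := (hS₁ W).1 (by
      rw [hz, evAb_mpAb, hz, map_sub, mpAb_sec, hqn])
    dsimp only [H]
    rw [hqn, hzn, map_add, mpAb_sec, evAb_mpAb, evAb_mpAb]
  refine ⟨mkHomAb (fun V => AddMonoidHom.mk' (H V) (hadd V)) hnat, evAb_ext fun V x => ?_,
    evAb_ext fun V x => ?_⟩
  · have hqc : q V (evAb S.c₁ V x) = 0 := by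
      dsimp only [q]
      rw [evAb_comp, hc]
      exact congrArg (fun t => evAb t V x) φ.d_a
    have hzc : z V (evAb S.c₁ V x) = x := (hS₁ V).1 (by
      rw [hz, hqc, sec_zero, sub_zero])
    change H V (evAb S.c₁ V x) = evAb S'.c₁ V (evAb f₁ V x)
    dsimp only [H]
    rw [hqc, hzc, sec_zero, zero_add]
  · change evAb S'.c₀ V (H V x) = evAb f₀ V (evAb S.c₀ V x)
    dsimp only [H]
    rw [map_add, evAb_sec, hτ, ← evAb_sec, ← evAb_sec, hc', ← hf', ← hc, hz, map_sub, map_sub,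
      add_sub_cancel]

/-- A map killing `C₁` factors through the quotient `𝖨`, and one killed by `c₀` lands in the
subobject `B'`. It applies to the difference of two maps with the same behaviour on `C₁` and `C₀`.
-/
lemma eq_of_comp_eq_zero (δ : S.C₀₁ ⟶ S'.C₀₁) (h₁ : S.c₁ ≫ δ = 0) (h₀ : δ ≫ S'.c₀ = 0) :
    ∃ t : (eLower R).obj (I R) ⟶ B', δ = (S.c₀ ≫ φ.a) ≫ t ≫ (ψ.b ≫ S'.c₁) := by
  have := S.shortExact₁.epi_g
  have := S'.shortExact₀.mono_f
  let t₁ := S.shortExact₁.exact.desc δ h₁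
  have ht₁ : (S.c₀ ≫ φ.a) ≫ t₁ = δ := S.shortExact₁.exact.g_desc δ h₁
  have ht₁' : t₁ ≫ S'.c₀ = 0 := by
    refine (cancel_epi (S.c₀ ≫ φ.a)).1 ?_
    rw [← Category.assoc, ht₁, h₀, comp_zero]
  exact ⟨S'.shortExact₀.exact.lift t₁ ht₁',
    by rw [S'.shortExact₀.exact.lift_f t₁ ht₁', ht₁]⟩

end ElemExt.Splitting

end Splittings


/-! ### The regular endomorphisms as a square-zero extension -/

noncomputable section RegularRing

variable {R : Type u} [Ring R] {M : Type u} [AddCommGroup M] [Module R M] [Module Rᵐᵒᵖ M]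

lemma eLower_map_scal {F G : BCat R R} (f : F ⟶ G) (r : R) :
    (eLower R).map f ≫ scal G r = scal F r ≫ (eLower R).map f :=
  evAb_ext fun V x => ((ev f V).map_smul r x).symm

lemma scal_tmulMap (m : M) (r : R) :
    scal (I R) r ≫ tmulMap m = tmulMap (MulOpposite.op r • m) :=
  evAb_ext fun V v => btmul_smul (RingHom.id R) R M m r (V := V.obj) v

lemma tmulMap_scal (m : M) (r : R) : tmulMap m ≫ scal (IM R M) r = tmulMap (r • m) := rfl

lemma tmulMap_add (m n : M) : tmulMap (R := R) (m + n) = tmulMap m + tmulMap n :=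
  evAb_ext fun V v => add_btmul (RingHom.id R) R M m n (V := V.obj) v

lemma scal_I_injective {r s : R} (h : scal (I R) r = scal (I R) s) : r = s := by
  have : r * (1 : R) = s * (1 : R) :=
    congrArg (fun t : (eLower R).obj (I R) ⟶ (eLower R).obj (I R) => evAb t (oneFG R) (1 : R)) h
  rwa [mul_one, mul_one] at this

variable {φ ψ : RingElemExt R M} (S : (eLowerExt φ).Splitting) (S' : (eLowerExt ψ).Splitting)

/-- The endomorphism of a splitting given by an element of `M`. -/
def regularEmb (m : M) : End S.C₀₁ :=
  (S.c₀ ≫ (eLowerExt φ).a) ≫ tmulMap m ≫ ((eLowerExt φ).b ≫ S.c₁)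

lemma c₁_proj : S.c₁ ≫ S.c₀ ≫ (eLowerExt φ).a = 0 := by
  rw [← Category.assoc, S.c₁_c₀, (eLowerExt φ).d_a]

lemma emb_c₀ : ((eLowerExt φ).b ≫ S.c₁) ≫ S.c₀ = 0 := by
  rw [Category.assoc, S.c₁_c₀, (eLowerExt φ).b_d]

lemma regularEmb_isRegularOver (m : M) : IsRegularOver S (regularEmb S m) 0 := by
  constructor
  · rw [map_zero, regularEmb, ← Category.assoc, c₁_proj, zero_comp]
    exact zero_comp.symm
  · rw [map_zero, regularEmb, Category.assoc, Category.assoc, Category.assoc, emb_c₀, comp_zero,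
      comp_zero]

variable {S}

lemma IsRegularOver.proj {x : End S.C₀₁} {r : R} (h : IsRegularOver S x r) :
    x ≫ S.c₀ ≫ (eLowerExt φ).a = (S.c₀ ≫ (eLowerExt φ).a) ≫ scal (I R) r := by
  rw [← Category.assoc, h.2, Category.assoc, Category.assoc, ← eLower_map_scal]

lemma IsRegularOver.emb {x : End S.C₀₁} {r : R} (h : IsRegularOver S x r) :
    ((eLowerExt φ).b ≫ S.c₁) ≫ x = scal (IM R M) r ≫ (eLowerExt φ).b ≫ S.c₁ := by
  rw [Category.assoc, h.1, ← Category.assoc, eLower_map_scal, Category.assoc]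

/-- A regular endomorphism induces the multiplication by `r` on the quotient `𝖨`, where `r` is
recovered by its value at `1 ∈ R`. -/
lemma IsRegularOver.unique {x : End S.C₀₁} {r s : R} (h : IsRegularOver S x r)
    (h' : IsRegularOver S x s) : r = s := by
  have := S.shortExact₁.epi_g
  exact scal_I_injective ((cancel_epi (S.c₀ ≫ (eLowerExt φ).a)).1 (h.proj.symm.trans h'.proj))

lemma IsRegularOver.mul {x y : End S.C₀₁} {r s : R} (hr : IsRegularOver S x r)
    (hs : IsRegularOver S y s) : IsRegularOver S (x * y) (r * s) := by
  constructor
  · rw [map_mul, End.mul_def, End.mul_def, ← Category.assoc, hs.1, Category.assoc, hr.1,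
      Category.assoc]
  · rw [map_mul, End.mul_def, End.mul_def, Category.assoc, hr.2, ← Category.assoc, hs.2,
      Category.assoc]

lemma IsRegularOver.add {x y : End S.C₀₁} {r s : R} (hr : IsRegularOver S x r)
    (hs : IsRegularOver S y s) : IsRegularOver S (x + y) (r + s) := by
  constructor
  · rw [map_add]
    exact (Preadditive.comp_add _ _ _ _ _ _).trans
      ((congrArg₂ (· + ·) hr.1 hs.1).trans (Preadditive.add_comp _ _ _ _ _ _).symm)
  · rw [map_add]
    exact (Preadditive.add_comp _ _ _ _ _ _).trans
      ((congrArg₂ (· + ·) hr.2 hs.2).trans (Preadditive.comp_add _ _ _ _ _ _).symm)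

lemma IsRegularOver.neg {x : End S.C₀₁} {r : R} (hr : IsRegularOver S x r) :
    IsRegularOver S (-x) (-r) := by
  constructor
  · rw [map_neg]
    exact (Preadditive.comp_neg _ _).trans
      ((congrArg Neg.neg hr.1).trans (Preadditive.neg_comp _ _).symm)
  · rw [map_neg]
    exact (Preadditive.neg_comp _ _).trans
      ((congrArg Neg.neg hr.2).trans (Preadditive.comp_neg _ _).symm)

lemma IsRegularOver.one : IsRegularOver S 1 1 :=
  ⟨by rw [map_one]; simp [End.one_def], by rw [map_one]; simp [End.one_def]⟩

lemma IsRegularOver.exists_regularEmb {x : End S.C₀₁} (h : IsRegularOver S x 0) :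
    ∃ m : M, regularEmb S m = x := by
  have h₁ : S.c₁ ≫ x = 0 := by rw [h.1, map_zero]; exact zero_comp
  have h₀ : x ≫ S.c₀ = 0 := by rw [h.2, map_zero]; exact comp_zero
  obtain ⟨t, ht⟩ := ElemExt.Splitting.eq_of_comp_eq_zero S S x h₁ h₀
  obtain ⟨m, rfl⟩ := exists_tmulMap_eq t
  exact ⟨m, ht.symm⟩

/-- In `End`, the product `f * g` is `g ≫ f`. So `x` acts first here, and only through the quotient
`𝖨`, which yields the right action; in `mul_regularEmb` it acts last, on the subobject `𝖨(M)`, which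
yields the left action. -/
lemma regularEmb_mul (m : M) {x : End S.C₀₁} {r : R} (h : IsRegularOver S x r) :
    regularEmb S m * x = regularEmb S (MulOpposite.op r • m) := by
  rw [End.mul_def, regularEmb, ← Category.assoc, h.proj, Category.assoc, regularEmb,
    ← scal_tmulMap]
  rfl

lemma mul_regularEmb (m : M) {x : End S.C₀₁} {r : R} (h : IsRegularOver S x r) :
    x * regularEmb S m = regularEmb S (r • m) := by
  rw [End.mul_def, regularEmb, Category.assoc, Category.assoc (tmulMap m), h.emb, regularEmb,
    ← tmulMap_scal]
  rfl

lemma regularEmb_add (m n : M) : regularEmb S (m + n) = regularEmb S m + regularEmb S n := by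
  rw [regularEmb, tmulMap_add, Preadditive.add_comp, Preadditive.comp_add]
  rfl

variable (S) in
/-- The embedding of `M` in the endomorphisms of a splitting. -/
def regularEmbHom : M →+ End S.C₀₁ := AddMonoidHom.mk' (regularEmb S) regularEmb_add

lemma regularEmb_zero : regularEmb S 0 = 0 := (regularEmbHom S).map_zero

lemma regularEmb_mul_regularEmb (m n : M) : regularEmb S m * regularEmb S n = 0 := by
  rw [regularEmb_mul m (regularEmb_isRegularOver S n), MulOpposite.op_zero, zero_smul,
    regularEmb_zero]

lemma comp_tmulMap_comp_injective [SMulCommClass R Rᵐᵒᵖ M] {m n : M}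
    (h : (S.c₀ ≫ (eLowerExt φ).a) ≫ tmulMap m ≫ ((eLowerExt ψ).b ≫ S'.c₁) =
      (S.c₀ ≫ (eLowerExt φ).a) ≫ tmulMap n ≫ ((eLowerExt ψ).b ≫ S'.c₁)) : m = n := by
  have := S.shortExact₁.epi_g
  have := S'.shortExact₀.mono_f
  exact tmulMap_injective ((cancel_mono ((eLowerExt ψ).b ≫ S'.c₁)).1
    ((cancel_epi (S.c₀ ≫ (eLowerExt φ).a)).1 h))

variable (S) in
-- The multiplications by `r` on `C₁` and `C₀` form a map of complexes, and a regular endomorphism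
-- over `r` is an extension of it to the splitting.
lemma exists_isRegularOver (r : R) : ∃ x, IsRegularOver S x r :=
  ElemExt.Splitting.exists_lift S S isAdd_IM (scal φ.C₁ r) (scal φ.C₀ r) (eLower_map_scal φ.d r)

variable (S) in
/-- The map from the ring of regular endomorphisms to `R`. -/
def regularQ : regularEnd S →+* R where
  toFun x := x.2.choose
  map_one' := (Subtype.property (1 : regularEnd S)).choose_spec.unique IsRegularOver.one
  map_zero' := (Subtype.property (0 : regularEnd S)).choose_spec.unique (by
    have := regularEmb_isRegularOver S 0
    rwa [regularEmb_zero] at this)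
  map_mul' x y := (Subtype.property (x * y)).choose_spec.unique
    (x.2.choose_spec.mul y.2.choose_spec)
  map_add' x y := (Subtype.property (x + y)).choose_spec.unique
    (x.2.choose_spec.add y.2.choose_spec)

lemma isRegularOver_regularQ (x : regularEnd S) : IsRegularOver S x (regularQ S x) :=
  x.2.choose_spec

lemma regularQ_eq {x : regularEnd S} {r : R} (h : IsRegularOver S x r) : regularQ S x = r :=
  (isRegularOver_regularQ x).unique h

variable (S) in
-- Endomorphisms of a functor on `R-proj` form a type in a larger universe, but the regular ones are
-- parametrized by `R × M`: a chosen endomorphism over `r` plus a correction from `M`.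
lemma small_regularEnd : Small.{u} (regularEnd S) := by
  choose f hf using exists_isRegularOver S
  have : Function.Surjective fun p : R × M =>
      (⟨f p.1 + regularEmb S p.2, p.1 + 0, (hf p.1).add (regularEmb_isRegularOver S p.2)⟩ :
        regularEnd S) := fun ⟨x, r, hx⟩ => by
    have h := hx.add (hf r).neg
    rw [add_neg_cancel] at h
    obtain ⟨m, hm⟩ := h.exists_regularEmb
    refine ⟨(r, m), Subtype.ext ?_⟩
    change f r + regularEmb S m = x
    rw [hm]
    abel
  exact small_of_surjective this

variable (S) in
/-- A ring map from a square-zero extension to the endomorphisms of a splitting, sending elements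
over `r` to regular endomorphisms over `r`, and compatible with the embeddings of `M`. -/
structure RegularAction (X : SqZeroExt R M) where
  ρ : X.carrier →+* End S.C₀₁
  isRegularOver (x : X.carrier) : IsRegularOver S (ρ x) (X.q x)
  ρ_i (m : M) : ρ (X.i m) = regularEmb S m

/-- The action of the ring of regular endomorphisms. -/
def IsRegularExt.regularAction {X : SqZeroExt R M} (h : IsRegularExt S X) : RegularAction S X where
  ρ := (regularEnd S).subtype.comp h.choose.toRingHom
  isRegularOver := h.choose_spec.1
  ρ_i := h.choose_spec.2

/-- A relation compatible with the ring operations is the graph of a ring map once each `x` has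
exactly one partner over `q x`. Two elements of `Y` over the same element of `R` differ by some `i
m`, which explains the form of the uniqueness hypothesis. -/
lemma SqZeroExt.nonempty_hom_of_rel (X Y : SqZeroExt R M) (rel : X.carrier → Y.carrier → Prop)
    (hex : ∀ x, ∃ y, Y.q y = X.q x ∧ rel x y)
    (huniq : ∀ (x : X.carrier) (m : M) (y : Y.carrier), rel x y → rel x (y + Y.i m) → m = 0)
    (hone : rel 1 1) (hmul : ∀ x y x' y', rel x y → rel x' y' → rel (x * x') (y * y'))
    (hadd : ∀ x y x' y', rel x y → rel x' y' → rel (x + x') (y + y'))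
    (hi : ∀ m, rel (X.i m) (Y.i m)) : Nonempty (X ⟶ Y) := by
  have huniq' : ∀ (x : X.carrier) (y y' : Y.carrier), Y.q y = X.q x → rel x y →
      Y.q y' = X.q x → rel x y' → y = y' := by
    intro x y y' hy hy₁ hy' hy₁'
    obtain ⟨m, hm⟩ := (Y.exact (y - y')).1 (by rw [map_sub, hy, hy', sub_self])
    have h0 := huniq x m y' hy₁' (by rwa [hm, add_sub_cancel])
    rw [h0, map_zero] at hm
    exact sub_eq_zero.1 hm.symm
  choose F hF₁ hF₂ using hex
  have hFadd : ∀ x y, F (x + y) = F x + F y := fun x y =>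
    huniq' (x + y) _ _ (hF₁ _) (hF₂ _) (by rw [map_add, map_add, hF₁, hF₁])
      (hadd _ _ _ _ (hF₂ x) (hF₂ y))
  refine ⟨⟨RingHom.mk' ⟨⟨F, ?_⟩, fun x y => ?_⟩ hFadd, fun m => ?_, hF₁⟩⟩
  · exact huniq' 1 _ _ (hF₁ _) (hF₂ _) (by rw [map_one, map_one]) hone
  · exact huniq' (x * y) _ _ (hF₁ _) (hF₂ _) (by rw [map_mul, map_mul, hF₁, hF₁])
      (hmul _ _ _ _ (hF₂ x) (hF₂ y))
  · exact huniq' (X.i m) _ _ (hF₁ _) (hF₂ _)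
      (by rw [(Y.exact (Y.i m)).2 ⟨m, rfl⟩, (X.exact (X.i m)).2 ⟨m, rfl⟩]) (hi m)

/-- The five lemma. Hence any morphism of square-zero extensions identifies their classes in `Sq(R,
M)`. -/
lemma SqZeroExt.Hom.bijective {X Y : SqZeroExt R M} (f : X ⟶ Y) : Function.Bijective f.f := by
  constructor
  · rw [injective_iff_map_eq_zero]
    intro x hx
    obtain ⟨m, rfl⟩ := (X.exact x).1 (by rw [← f.q_f, hx, map_zero])
    rw [f.f_i, ← Y.i.map_zero] at hx
    rw [Y.i_injective hx, map_zero]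
  · intro y
    obtain ⟨x, hx⟩ := X.q_surjective (Y.q y)
    obtain ⟨m, hm⟩ := (Y.exact (y - f.f x)).1 (by rw [map_sub, f.q_f, hx, sub_self])
    exact ⟨x + X.i m, by rw [map_add, f.f_i, hm, add_sub_cancel]⟩

lemma Sq.mk_eq_of_hom {X Y : SqZeroExt R M} (f : X ⟶ Y) : Sq.mk X = Sq.mk Y := by
  let e : X.carrier ≃+* Y.carrier := RingEquiv.ofBijective f.f (SqZeroExt.Hom.bijective f)
  have he : ∀ x, e x = f.f x := fun _ => rfl
  refine Quotient.sound ⟨⟨f, ⟨e.symm.toRingHom, fun m => ?_, fun y => ?_⟩, ?_, ?_⟩⟩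
  · exact e.symm_apply_eq.2 (f.f_i m).symm
  · change X.q (e.symm y) = Y.q y
    rw [← f.q_f, ← he, e.apply_symm_apply]
  · exact SqZeroExt.Hom.ext (RingHom.ext fun x => e.symm_apply_apply x)
  · exact SqZeroExt.Hom.ext (RingHom.ext fun x => e.apply_symm_apply x)

section

variable [SMulCommClass R Rᵐᵒᵖ M]

lemma regularEmb_injective : Function.Injective (regularEmb S) := fun _ _ h =>
  comp_tmulMap_comp_injective S h

variable (S) in
lemma exists_isRegularExt : ∃ X : SqZeroExt R M, IsRegularExt S X := by
  have := small_regularEnd S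
  -- The carrier of a square-zero extension has to lie in `Type u`, hence the transport to a small
  -- copy.
  let Θ : Shrink.{u} (regularEnd S) ≃+* regularEnd S := Shrink.ringEquiv _
  let j : M →+ regularEnd S := AddMonoidHom.mk'
    (fun m => ⟨regularEmb S m, 0, regularEmb_isRegularOver S m⟩)
    fun m n => Subtype.ext (regularEmb_add m n)
  have hj : ∀ m, (j m : End S.C₀₁) = regularEmb S m := fun _ => rfl
  let X : SqZeroExt R M :=
    { carrier := Shrink.{u} (regularEnd S)
      i := Θ.symm.toAddMonoidHom.comp j
      q := (regularQ S).comp Θ.toRingHom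
      i_injective := fun m n h => regularEmb_injective (S := S)
        (congrArg Subtype.val (Θ.symm.injective h))
      q_surjective := fun r => by
        obtain ⟨x, hx⟩ := exists_isRegularOver S r
        refine ⟨Θ.symm ⟨x, r, hx⟩, ?_⟩
        change regularQ S (Θ (Θ.symm _)) = r
        rw [Θ.apply_symm_apply]
        exact regularQ_eq hx
      exact := fun x => by
        change regularQ S (Θ x) = 0 ↔ ∃ m, Θ.symm (j m) = x
        constructor
        · intro h
          have h' := isRegularOver_regularQ (Θ x)
          rw [h] at h'
          obtain ⟨m, hm⟩ := h'.exists_regularEmb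
          exact ⟨m, Θ.symm_apply_eq.2 (Subtype.ext hm)⟩
        · rintro ⟨m, rfl⟩
          rw [Θ.apply_symm_apply]
          exact regularQ_eq (regularEmb_isRegularOver S m)
      i_mul := fun m x => by
        change Θ.symm (j m) * x = Θ.symm (j (MulOpposite.op (regularQ S (Θ x)) • m))
        rw [Θ.eq_symm_apply, map_mul, Θ.apply_symm_apply]
        exact Subtype.ext (regularEmb_mul m (isRegularOver_regularQ (Θ x)))
      mul_i := fun x m => by
        change x * Θ.symm (j m) = Θ.symm (j (regularQ S (Θ x) • m))
        rw [Θ.eq_symm_apply, map_mul, Θ.apply_symm_apply]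
        exact Subtype.ext (mul_regularEmb m (isRegularOver_regularQ (Θ x)))
      i_mul_i := fun m n => by
        change Θ.symm (j m) * Θ.symm (j n) = 0
        rw [← map_mul, EmbeddingLike.map_eq_zero_iff]
        exact Subtype.ext (regularEmb_mul_regularEmb m n) }
  refine ⟨X, Θ, fun x => isRegularOver_regularQ (Θ x), fun m => ?_⟩
  change ((Θ (Θ.symm (j m)) : regularEnd S) : End S.C₀₁) = _
  rw [Θ.apply_symm_apply]
  rfl

/-- The action is the identity on `M` and on `R`, so by the five lemma it is an isomorphism onto the
ring of regular endomorphisms. -/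
lemma RegularAction.isRegularExt {X : SqZeroExt R M} (h : RegularAction S X) :
    IsRegularExt S X := by
  let ρ : X.carrier →+* regularEnd S := h.ρ.codRestrict _ fun x => ⟨X.q x, h.isRegularOver x⟩
  have hρ : Function.Bijective ρ := by
    constructor
    · rw [injective_iff_map_eq_zero]
      intro x hx
      have hx' : h.ρ x = 0 := congrArg Subtype.val hx
      have hq := h.isRegularOver x
      rw [hx', ← regularEmb_zero] at hq
      obtain ⟨m, rfl⟩ := (X.exact x).1 (hq.unique (regularEmb_isRegularOver S 0))
      rw [h.ρ_i, ← regularEmb_zero] at hx'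
      rw [regularEmb_injective hx', map_zero]
    · rintro ⟨y, r, hy⟩
      obtain ⟨x, rfl⟩ := X.q_surjective r
      have hd := hy.add (h.isRegularOver x).neg
      rw [add_neg_cancel] at hd
      obtain ⟨m, hm⟩ := hd.exists_regularEmb
      refine ⟨x + X.i m, Subtype.ext ?_⟩
      change h.ρ (x + X.i m) = y
      rw [map_add, h.ρ_i, hm]
      abel
  exact ⟨RingEquiv.ofBijective ρ hρ, h.isRegularOver, h.ρ_i⟩

/-- A map of elementary extensions induces a map of the square-zero extensions acting on
splittings. -/
lemma RegularAction.exists_hom {S' : (eLowerExt ψ).Splitting} {X Y : SqZeroExt R M}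
    (h : RegularAction S X) (h' : RegularAction S' Y) (f : φ ⟶ ψ) : Nonempty (X ⟶ Y) := by
  have hfd : (eLowerExt φ).d ≫ (eLower R).map f.f₀ = (eLower R).map f.f₁ ≫ (eLowerExt ψ).d := by
    change (eLower R).map _ ≫ _ = _ ≫ (eLower R).map _
    rw [← Functor.map_comp, f.d_f₀, Functor.map_comp]
  have hfa : (eLower R).map f.f₀ ≫ (eLowerExt ψ).a = (eLowerExt φ).a := by
    change _ ≫ (eLower R).map _ = (eLower R).map _
    rw [← Functor.map_comp, f.f₀_a]
  have hfb : (eLowerExt φ).b ≫ (eLower R).map f.f₁ = (eLowerExt ψ).b := by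
    change (eLower R).map _ ≫ _ = (eLower R).map _
    rw [← Functor.map_comp, f.b_f₁]
  obtain ⟨g, hg₁, hg₀⟩ := ElemExt.Splitting.exists_lift S S' isAdd_IM _ _ hfd
  let k (m : M) := (S.c₀ ≫ (eLowerExt φ).a) ≫ tmulMap m ≫ ((eLowerExt ψ).b ≫ S'.c₁)
  have hk : ∀ m, k m = (S.c₀ ≫ (eLowerExt φ).a) ≫ tmulMap m ≫ ((eLowerExt ψ).b ≫ S'.c₁) :=
    fun _ => rfl
  have hk₁ : ∀ m, regularEmb S m ≫ g = k m := fun m => by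
    rw [hk, regularEmb, Category.assoc, Category.assoc (tmulMap m), Category.assoc _ S.c₁ g, hg₁,
      ← Category.assoc (eLowerExt φ).b, hfb]
  have hk₂ : ∀ m, g ≫ regularEmb S' m = k m := fun m => by
    rw [hk, regularEmb, ← Category.assoc, ← Category.assoc g, hg₀, Category.assoc S.c₀, hfa]
  have hkadd : ∀ m n, k (m + n) = k m + k n := fun m n => by
    rw [← hk₁, regularEmb_add, Preadditive.add_comp, hk₁, hk₁]
  -- For any `y` over `q x` the commutation defect with `g` vanishes on `C₁` and in `C₀`, so it
  -- equals `k m` for some `m`, and replacing `y` by `y + i m` removes it.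
  have hex : ∀ x : X.carrier, ∃ y : Y.carrier, Y.q y = X.q x ∧ h.ρ x ≫ g = g ≫ h'.ρ y := by
    intro x
    obtain ⟨y, hy⟩ := Y.q_surjective (X.q x)
    have hx := h.isRegularOver x
    have hy' := h'.isRegularOver y
    obtain ⟨t, ht⟩ := ElemExt.Splitting.eq_of_comp_eq_zero S S' (h.ρ x ≫ g - g ≫ h'.ρ y) (by
      rw [Preadditive.comp_sub, ← Category.assoc, hx.1, Category.assoc, hg₁, ← Category.assoc S.c₁,
        hg₁, Category.assoc, hy'.1, hy, ← Category.assoc, ← Category.assoc, eLower_map_scal,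
        sub_self]) (by
      rw [Preadditive.sub_comp, Category.assoc, hg₀, ← Category.assoc, hx.2, Category.assoc,
        Category.assoc, hy'.2, ← Category.assoc g, hg₀, hy, Category.assoc, eLower_map_scal,
        sub_self])
    obtain ⟨m, rfl⟩ := exists_tmulMap_eq t
    refine ⟨y + Y.i m, ?_, ?_⟩
    · rw [map_add, hy, (Y.exact (Y.i m)).2 ⟨m, rfl⟩, add_zero]
    · rw [map_add, h'.ρ_i]
      refine Eq.trans ?_ (Preadditive.comp_add _ _ _ _ _ _).symm
      rw [hk₂, ← sub_eq_iff_eq_add']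
      exact ht
  -- The map sends `x` to the unique `y` over `q x` whose action is intertwined with that of `x` by
  -- `g`.
  refine X.nonempty_hom_of_rel Y (fun x y => h.ρ x ≫ g = g ≫ h'.ρ y) hex
    (fun x m y hy hy' => ?_) ?_ (fun x y x' y' hx hx' => ?_) (fun x y x' y' hx hx' => ?_)
    fun m => ?_
  · rw [map_add, hy, h'.ρ_i] at hy'
    have h0 := left_eq_add.1 (hy'.trans (Preadditive.comp_add _ _ _ _ _ _))
    rw [hk₂] at h0
    have hk0 : k 0 = 0 := by simpa using hkadd 0 0
    exact comp_tmulMap_comp_injective S' (h0.trans hk0.symm)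
  · rw [map_one, map_one]
    exact (Category.id_comp g).trans (Category.comp_id g).symm
  · rw [map_mul, map_mul, End.mul_def, End.mul_def, Category.assoc, hx, ← Category.assoc, hx',
      Category.assoc]
  · rw [map_add, map_add]
    refine (Preadditive.add_comp _ _ _ _ _ _).trans ?_
    rw [hx, hx']
    exact (Preadditive.comp_add _ _ _ _ _ _).symm
  · rw [h.ρ_i, h'.ρ_i, hk₁, hk₂]

/-- Pulling back an action along a map of square-zero extensions. -/
def RegularAction.comp {X Y : SqZeroExt R M} (h : RegularAction S Y) (f : X ⟶ Y) :
    RegularAction S X where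
  ρ := h.ρ.comp f.f
  isRegularOver x := by
    rw [← f.q_f]
    exact h.isRegularOver (f.f x)
  ρ_i m := by rw [RingHom.comp_apply, f.f_i, h.ρ_i]

lemma IsRegularExt.mk_eq {S' : (eLowerExt ψ).Splitting} {X Y : SqZeroExt R M}
    (h : IsRegularExt S X) (h' : IsRegularExt S' Y) (f : φ ⟶ ψ) : Sq.mk X = Sq.mk Y :=
  Sq.mk_eq_of_hom (h.regularAction.exists_hom h'.regularAction f).some

/-- The class in `Sq(R, M)` of the ring of regular endomorphisms of a splitting. -/
def regularClass (φ : RingElemExt R M) : Sq R M :=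
  Sq.mk (exists_isRegularExt (exists_splitting isAdd_IM (eLowerExt φ)).some).choose

/-- Independence of the splitting is the case of the identity of `φ`: `exists_hom` allows arbitrary
splittings on both sides. -/
lemma IsRegularExt.regularClass_eq {X : SqZeroExt R M} (h : IsRegularExt S X) :
    regularClass φ = Sq.mk X :=
  (exists_isRegularExt (exists_splitting isAdd_IM (eLowerExt φ)).some).choose_spec.mk_eq h (𝟙 φ)

lemma regularClass_eq_of_hom (f : φ ⟶ ψ) : regularClass φ = regularClass ψ :=
  (exists_isRegularExt (exists_splitting isAdd_IM (eLowerExt φ)).some).choose_spec.mk_eq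
    (exists_isRegularExt (exists_splitting isAdd_IM (eLowerExt ψ)).some).choose_spec f

/-- The map `Ψ` from elementary extensions to square-zero extensions. -/
def elToSq : El R M → Sq R M :=
  Quotient.lift regularClass fun _ _ h => zigzag_congr _ regularClass_eq_of_hom h

end

end RegularRing


noncomputable section SqZeroModules

variable {R : Type u} [Ring R] {M : Type u} [AddCommGroup M] [Module R M] [Module Rᵐᵒᵖ M]

/-! ### Modules over a square-zero extension -/

namespace SqZeroExt

variable (X : SqZeroExt R M)

@[simp]
lemma q_i (m : M) : X.q (X.i m) = 0 := (X.exact _).2 ⟨m, rfl⟩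

section

variable [SMulCommClass R Rᵐᵒᵖ M] (W : Type u) [AddCommGroup W] [Module X.carrier W]

/-- The multiplication map `M ⊗_{R'} W → W`. -/
def mulMap : BTensor X.q R M W →+ W :=
  btLift X.q R M (AddMonoidHom.mk' (fun m => AddMonoidHom.mk' (fun w => X.i m • w)
    fun _ _ => smul_add _ _ _) fun m n => AddMonoidHom.ext fun w => by
      change X.i (m + n) • w = X.i m • w + X.i n • w
      rw [map_add, add_smul]) fun m x w => by
    change X.i (MulOpposite.op (X.q x) • m) • w = X.i m • x • w
    rw [← X.i_mul, mul_smul]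

variable {W}

@[simp]
lemma mulMap_btmul (m : M) (w : W) : X.mulMap W (btmul X.q R M m w) = X.i m • w := rfl

lemma smul_mulMap (x : X.carrier) (z : BTensor X.q R M W) :
    x • X.mulMap W z = X.mulMap W (X.q x • z) := by
  refine bt_induction X.q R M (P := fun z => x • X.mulMap W z = X.mulMap W (X.q x • z))
    (fun m w => ?_) (fun y z hy hz => ?_) z
  · rw [smul_btmul, mulMap_btmul, mulMap_btmul, ← mul_smul, X.mul_i]
  · rw [map_add, smul_add, hy, hz, smul_add, map_add]

lemma mulMap_btensorMap {W' : Type u} [AddCommGroup W'] [Module X.carrier W']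
    (g : W →ₗ[X.carrier] W') (z : BTensor X.q R M W) :
    X.mulMap W' (btensorMap X.q R M g z) = g (X.mulMap W z) := by
  refine bt_induction X.q R M
    (P := fun z => X.mulMap W' (btensorMap X.q R M g z) = g (X.mulMap W z))
    (fun m w => ?_) (fun y z hy hz => ?_) z
  · rw [btensorMap_btmul, mulMap_btmul, mulMap_btmul, map_smul]
  · rw [map_add, map_add, hy, hz, map_add, map_add]

variable (W) in
/-- The submodule `M W` of `W`. -/
def mulSubmodule : Submodule X.carrier W where
  carrier := Set.range (X.mulMap W)
  add_mem' := by
    rintro _ _ ⟨y, rfl⟩ ⟨z, rfl⟩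
    exact ⟨y + z, map_add _ _ _⟩
  zero_mem' := ⟨0, map_zero _⟩
  smul_mem' := by
    rintro x _ ⟨z, rfl⟩
    exact ⟨X.q x • z, (X.smul_mulMap x z).symm⟩

lemma smul_sub_smul_mem {x y : X.carrier} (h : X.q x = X.q y) (w : W) :
    x • w - y • w ∈ X.mulSubmodule W := by
  obtain ⟨m, hm⟩ := (X.exact (x - y)).1 (by rw [map_sub, h, sub_self])
  exact ⟨btmul X.q R M m w, by rw [mulMap_btmul, hm, sub_smul]⟩

/-- The multiplication map is injective for projective modules. -/
lemma mulMap_injective [Module.Projective X.carrier W] : Function.Injective (X.mulMap W) := by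
  -- `W` is a summand, via `s`, of the free module on its underlying set. `C` is the induced map
  -- from `M ⊗ W` to a sum of copies of `M`, and `D` retracts it.
  obtain ⟨s, hs⟩ := (Module.projective_def' (R := X.carrier) (P := W)).1 inferInstance
  let ν (m : M) : X.carrier →+ M := AddMonoidHom.mk' (fun x => MulOpposite.op (X.q x) • m)
    fun x y => by rw [map_add, MulOpposite.op_add, add_smul]
  let C : BTensor X.q R M W →+ (W →₀ M) :=
    btLift X.q R M (AddMonoidHom.mk' (fun m => (Finsupp.mapRange.addMonoidHom (ν m)).comp
      s.toAddMonoidHom) fun m n => AddMonoidHom.ext fun w => Finsupp.ext fun p =>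
        smul_add (MulOpposite.op (X.q (s w p))) m n) fun m x w => Finsupp.ext fun p => by
      change MulOpposite.op (X.q (s w p)) • MulOpposite.op (X.q x) • m =
        MulOpposite.op (X.q (s (x • w) p)) • m
      rw [map_smul, Finsupp.smul_apply, smul_eq_mul, map_mul, MulOpposite.op_mul, mul_smul]
  have hC : ∀ m w p, C (btmul X.q R M m w) p = MulOpposite.op (X.q (s w p)) • m :=
    fun _ _ _ => rfl
  let D : (W →₀ M) →+ BTensor X.q R M W :=
    Finsupp.liftAddHom fun p => (btmulHom X.q R M (V := W)).flip p
  have hDC : ∀ z, D (C z) = z := fun z => by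
    refine bt_induction X.q R M (P := fun z => D (C z) = z) (fun m w => ?_)
      (fun y z hy hz => by rw [map_add, map_add, hy, hz]) z
    have hw : w = (s w).sum fun p x => x • p := (LinearMap.congr_fun hs w).symm
    have h₁ : D (C (btmul X.q R M m w)) = (s w).sum fun p x => btmul X.q R M (ν m x) p :=
      (Finsupp.sum_mapRange_index (f := ν m) (hf := map_zero (ν m)) (g := s w)
        (h := fun p n => btmul X.q R M n p) fun p => zero_btmul X.q R M p)
    have h₂ : btmul X.q R M m ((s w).sum fun p x => x • p) =
        (s w).sum fun p x => btmul X.q R M m (x • p) :=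
      map_finsuppSum (btmulHom X.q R M m) (s w) _
    rw [h₁]
    conv_rhs => rw [hw, h₂]
    exact Finsupp.sum_congr fun p _ => (btmul_smul X.q R M m _ p).symm
  -- In the coordinates of the free module, multiplication is `i : M → R'` on each copy of `M`, and
  -- `i` is injective.
  have hiC : ∀ z p, X.i (C z p) = s (X.mulMap W z) p := fun z p => by
    refine bt_induction X.q R M (P := fun z => X.i (C z p) = s (X.mulMap W z) p)
      (fun m w => ?_) (fun y z hy hz => ?_) z
    · rw [hC, mulMap_btmul, ← X.i_mul, map_smul s, Finsupp.smul_apply, smul_eq_mul]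
    · rw [map_add, map_add, map_add, Finsupp.add_apply, Finsupp.add_apply, map_add, hy, hz]
  rw [injective_iff_map_eq_zero]
  intro z hz
  have : C z = 0 := Finsupp.ext fun p => X.i_injective (by
    rw [hiC, hz, map_zero, Finsupp.zero_apply, Finsupp.zero_apply, map_zero])
  rw [← hDC z, this, map_zero]

/-- The map `R ⊗_{R'} W → W / M W`. -/
def baseChangeTo : BTensor X.q R R W →+ W ⧸ X.mulSubmodule W :=
  -- The set-theoretic lift of `r` to `R'` is defined up to `i(M)`, which sends `W` into `M W`; so
  -- the class in `W / M W` does not depend on it.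
  btLift X.q R R (AddMonoidHom.mk' (fun r => ((X.mulSubmodule W).mkQ.toAddMonoidHom).comp
      (DistribSMul.toAddMonoidHom W (Function.surjInv X.q_surjective r)))
    fun r s => AddMonoidHom.ext fun w => by
      refine (Submodule.Quotient.eq _).2 ?_
      change Function.surjInv X.q_surjective (r + s) • w -
        (Function.surjInv X.q_surjective r • w + Function.surjInv X.q_surjective s • w) ∈ _
      rw [← add_smul]
      refine X.smul_sub_smul_mem ?_ w
      simp only [map_add, Function.surjInv_eq]) fun r x w => by
    refine (Submodule.Quotient.eq _).2 ?_
    change _ - Function.surjInv X.q_surjective r • x • w ∈ _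
    rw [← mul_smul]
    refine X.smul_sub_smul_mem ?_ w
    simp only [map_mul, Function.surjInv_eq]
    rfl

/-- This is `R ⊗_{R'} W ≅ W / M W`: `baseChangeTo` detects when `1 ⊗ w` vanishes. -/
lemma btmul_one_eq_zero_iff (w : W) :
    btmul X.q R R (1 : R) w = 0 ↔ w ∈ X.mulSubmodule W := by
  constructor
  · intro h
    have h' : X.baseChangeTo (btmul X.q R R (1 : R) w) = 0 := by rw [h, map_zero]
    have h₁ : Function.surjInv X.q_surjective (1 : R) • w ∈ X.mulSubmodule W :=
      (Submodule.Quotient.mk_eq_zero _).1 h'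
    have h₂ := X.smul_sub_smul_mem (x := 1) (y := Function.surjInv X.q_surjective (1 : R))
      (by rw [Function.surjInv_eq X.q_surjective, map_one]) w
    rw [one_smul] at h₂
    simpa using add_mem h₂ h₁
  · rintro ⟨z, rfl⟩
    refine bt_induction X.q R M (P := fun z => btmul X.q R R (1 : R) (X.mulMap W z) = 0)
      (fun m w => ?_) (fun y z hy hz => ?_) z
    · rw [mulMap_btmul, btmul_smul, q_i, MulOpposite.op_zero, zero_smul, zero_btmul]
    · rw [map_add, btmul_add, hy, hz, add_zero]

end

lemma btmul_one_smul {W : Type u} [AddCommGroup W] [Module X.carrier W] (x : X.carrier) (w : W) :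
    btmul X.q R R (1 : R) (x • w) = X.q x • btmul X.q R R (1 : R) w := by
  rw [btmul_smul, smul_btmul]
  congr 1
  change (1 : R) * X.q x = X.q x * 1
  rw [one_mul, mul_one]

lemma btmul_one_surjective {W : Type u} [AddCommGroup W] [Module X.carrier W] :
    Function.Surjective (btmul X.q R R (1 : R) (V := W)) := by
  intro y
  refine bt_induction X.q R R (P := fun y => ∃ w, btmul X.q R R (1 : R) w = y)
    (fun r w => ?_) ?_ y
  · obtain ⟨x, rfl⟩ := X.q_surjective r
    exact ⟨x • w, by rw [btmul_one_smul, smul_btmul, smul_eq_mul, mul_one]⟩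
  · rintro _ _ ⟨w, rfl⟩ ⟨w', rfl⟩
    exact ⟨w + w', btmul_add _ _ _ _ _ _⟩

end SqZeroExt

end SqZeroModules


noncomputable section Truncation

variable {R : Type u} [Ring R] {M : Type u} [AddCommGroup M] [Module R M] [Module Rᵐᵒᵖ M]

namespace SqZeroExt

variable {X : SqZeroExt R M} (P' : ProjectiveResolution (X.qLower.obj (I R))) (V : FGProj R)

/-! ### Elements of projective resolutions of `q_* 𝖨` -/

lemma aug_add (x y : (P'.complex.X 0).obj.obj V) :
    X.aug P' V (x + y) = X.aug P' V x + X.aug P' V y := map_add (ev (P'.π.f 0) V) x y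

lemma aug_smul (r : X.carrier) (x : (P'.complex.X 0).obj.obj V) :
    X.aug P' V (r • x) = X.q r • X.aug P' V x := map_smul (ev (P'.π.f 0) V) r x

/-- The augmentation, as an additive map. -/
def augHom : (P'.complex.X 0).obj.obj V →+ V.obj := AddMonoidHom.mk' (X.aug P' V) (aug_add P' V)

@[simp]
lemma augHom_apply (x : (P'.complex.X 0).obj.obj V) : augHom P' V x = X.aug P' V x := rfl

lemma aug_mp {V W : FGProj R} (f : V.obj →ₗ[R] W.obj) (x : (P'.complex.X 0).obj.obj V) :
    X.aug P' W (mp (P'.complex.X 0) f x) = f (X.aug P' V x) := ev_mp (P'.π.f 0) f x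

lemma aug_surjective : Function.Surjective (X.aug P' V) :=
  (epi_iff_surjective (P'.π.f 0)).1 inferInstance V

lemma aug_d (x : (P'.complex.X 1).obj.obj V) : X.aug P' V (ev (P'.complex.d 1 0) V x) = 0 :=
  congrArg (fun t => ev t V x) P'.complex_d_comp_π_f_zero

lemma exists_d_eq_of_aug {x : (P'.complex.X 0).obj.obj V} (h : X.aug P' V x = 0) :
    ∃ y, ev (P'.complex.d 1 0) V y = x :=
  (exact_iff_ev _ _ _).1 P'.exact₀ V x h

lemma d_d_apply (x : (P'.complex.X 2).obj.obj V) :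
    ev (P'.complex.d 1 0) V (ev (P'.complex.d 2 1) V x) = 0 :=
  congrArg (fun t => ev t V x) (P'.complex.d_comp_d 2 1 0)

lemma exists_d_eq {x : (P'.complex.X 1).obj.obj V} (h : ev (P'.complex.d 1 0) V x = 0) :
    ∃ y, ev (P'.complex.d 2 1) V y = x :=
  (exact_iff_ev _ _ _).1 (P'.exact_succ 0) V x h

lemma exists_d_eq_smul (m : M) (x : (P'.complex.X 0).obj.obj V) :
    ∃ y, ev (P'.complex.d 1 0) V y = X.i m • x :=
  exists_d_eq_of_aug P' V (by rw [aug_smul, q_i, zero_smul])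

/-- The map `P'₀(V) → R ⊗_{R'} P'₀(V)`. -/
def toPull₀ : (P'.complex.X 0).obj.obj V →+ ((X.pullback P').X 0).obj.obj V :=
  btmulHom X.q R R (1 : R)

/-- The map from `P'₁(V)` to the cokernel of `R ⊗_{R'} P'₂(V) → R ⊗_{R'} P'₁(V)`. -/
def toPull₁ : (P'.complex.X 1).obj.obj V →+ ((X.pullback P').opcycles 1).obj.obj V :=
  (ev ((X.pullback P').pOpcycles 1) V).toAddMonoidHom.comp (btmulHom X.q R R (1 : R))

lemma toPull₀_smul (r : X.carrier) (x : (P'.complex.X 0).obj.obj V) :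
    toPull₀ P' V (r • x) = X.q r • toPull₀ P' V x := X.btmul_one_smul r x

lemma toPull₁_smul (r : X.carrier) (x : (P'.complex.X 1).obj.obj V) :
    toPull₁ P' V (r • x) = X.q r • toPull₁ P' V x :=
  (congrArg (ev ((X.pullback P').pOpcycles 1) V) (X.btmul_one_smul r x)).trans
    (map_smul (ev ((X.pullback P').pOpcycles 1) V) (X.q r) _)

lemma toPull₀_mp {V W : FGProj R} (f : V.obj →ₗ[R] W.obj) (x : (P'.complex.X 0).obj.obj V) :
    toPull₀ P' W (mp (P'.complex.X 0) f x) = mp ((X.pullback P').X 0) f (toPull₀ P' V x) := rfl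

lemma toPull₁_mp {V W : FGProj R} (f : V.obj →ₗ[R] W.obj) (x : (P'.complex.X 1).obj.obj V) :
    toPull₁ P' W (mp (P'.complex.X 1) f x) = mp ((X.pullback P').opcycles 1) f (toPull₁ P' V x) :=
  ev_mp ((X.pullback P').pOpcycles 1) f (X.tmulUpper (P'.complex.X 1) V 1 x)

lemma toPull₀_surjective : Function.Surjective (toPull₀ P' V) :=
  X.btmul_one_surjective

lemma pOpcycles_surjective :
    Function.Surjective (ev ((X.pullback P').pOpcycles 1) V) :=
  (epi_iff_surjective _).1 inferInstance V

lemma toPull₁_surjective : Function.Surjective (toPull₁ P' V) :=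
  (pOpcycles_surjective P' V).comp X.btmul_one_surjective

lemma exists_d_eq_of_pOpcycles {x : ((X.pullback P').X 1).obj.obj V}
    (h : ev ((X.pullback P').pOpcycles 1) V x = 0) :
    ∃ y, ev ((X.pullback P').d 2 1) V y = x :=
  (exact_iff_ev _ _ ((X.pullback P').d_pOpcycles 2 1)).1 (ShortComplex.exact_of_g_is_cokernel _
    ((X.pullback P').opcyclesIsCokernel 2 1 (by simp))) V x h

lemma pullback_d_apply (i j : ℕ) (x : (P'.complex.X i).obj.obj V) :
    ev ((X.pullback P').d i j) V (X.tmulUpper (P'.complex.X i) V 1 x) =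
      X.tmulUpper (P'.complex.X j) V 1 (ev (P'.complex.d i j) V x) := rfl

lemma fromOpcycles_toPull₁ (x : (P'.complex.X 1).obj.obj V) :
    ev ((X.pullback P').fromOpcycles 1 0) V (toPull₁ P' V x) =
      toPull₀ P' V (ev (P'.complex.d 1 0) V x) :=
  congrArg (fun t => ev t V (X.tmulUpper (P'.complex.X 1) V 1 x))
    ((X.pullback P').p_fromOpcycles 1 0)

variable [SMulCommClass R Rᵐᵒᵖ M]

lemma toPull₀_eq_zero_iff (x : (P'.complex.X 0).obj.obj V) :
    toPull₀ P' V x = 0 ↔ ∃ z, X.mulMap _ z = x := X.btmul_one_eq_zero_iff x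

/-- By right exactness, the cokernel of `R ⊗ P'₂ → R ⊗ P'₁` is `P'₁ / (M P'₁ + d P'₂)`. -/
lemma toPull₁_eq_zero_iff (x : (P'.complex.X 1).obj.obj V) :
    toPull₁ P' V x = 0 ↔ ∃ z y, X.mulMap _ z + ev (P'.complex.d 2 1) V y = x := by
  constructor
  · intro h
    obtain ⟨u, hu⟩ := exists_d_eq_of_pOpcycles P' V h
    obtain ⟨y, rfl⟩ := X.btmul_one_surjective u
    have h₁ : btmul X.q R R (1 : R) (x - ev (P'.complex.d 2 1) V y) = 0 := by
      have := map_sub (btmulHom X.q R R (1 : R)) x (ev (P'.complex.d 2 1) V y)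
      refine this.trans (sub_eq_zero.2 ?_)
      exact hu.symm.trans (pullback_d_apply P' V 2 1 y)
    obtain ⟨z, hz⟩ := (X.btmul_one_eq_zero_iff _).1 h₁
    exact ⟨z, y, by rw [hz, sub_add_cancel]⟩
  · rintro ⟨z, y, rfl⟩
    have h₁ : btmul X.q R R (1 : R) (X.mulMap _ z) = 0 :=
      (X.btmul_one_eq_zero_iff _).2 ⟨z, rfl⟩
    have h₂ : toPull₁ P' V (X.mulMap _ z) = 0 :=
      (congrArg (ev ((X.pullback P').pOpcycles 1) V) h₁).trans (map_zero _)
    rw [map_add, h₂, zero_add]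
    exact congrArg (fun t => ev t V (X.tmulUpper (P'.complex.X 2) V 1 y))
      ((X.pullback P').d_pOpcycles 2 1)

/-- The map `M ⊗_{R'} P'₀(V) → M ⊗_R V`. -/
def tensorAug : BTensor X.q R M ((P'.complex.X 0).obj.obj V) →+ (IM R M).obj.obj V :=
  btLift X.q R M (AddMonoidHom.mk' (fun m => (tmulHom V m).comp (augHom P' V))
      fun m n => AddMonoidHom.ext fun x => add_btmul (RingHom.id R) R M m n (V := V.obj) _)
    fun m r x => by
      change tmulIM M V (MulOpposite.op (X.q r) • m) (X.aug P' V x) =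
        tmulIM M V m (X.aug P' V (r • x))
      rw [aug_smul]
      exact (btmul_smul (RingHom.id R) R M m (X.q r) (V := V.obj) _).symm

@[simp]
lemma tensorAug_btmul (m : M) (x : (P'.complex.X 0).obj.obj V) :
    tensorAug P' V (btmul X.q R M m x) = tmulIM M V m (X.aug P' V x) := rfl

lemma tensorAug_surjective : Function.Surjective (tensorAug P' V) := by
  intro y
  refine IM_induction (P := fun y => ∃ z, tensorAug P' V z = y) (fun m v => ?_) ?_ y
  · obtain ⟨x, rfl⟩ := aug_surjective P' V v
    exact ⟨btmul X.q R M m x, rfl⟩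
  · rintro _ _ ⟨z, rfl⟩ ⟨z', rfl⟩
    exact ⟨z + z', map_add _ _ _⟩

lemma tensorAug_btensorMap_d (z : BTensor X.q R M ((P'.complex.X 1).obj.obj V)) :
    tensorAug P' V (btensorMap X.q R M (ev (P'.complex.d 1 0) V) z) = 0 := by
  refine bt_induction X.q R M
    (P := fun z => tensorAug P' V (btensorMap X.q R M (ev (P'.complex.d 1 0) V) z) = 0)
    (fun m x => ?_) (fun y z hy hz => ?_) z
  · rw [btensorMap_btmul, tensorAug_btmul, aug_d]
    exact btmul_zero (RingHom.id R) R M m (V := V.obj)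
  · rw [map_add, map_add, hy, hz, add_zero]

lemma exists_d_eq_mulMap (z : BTensor X.q R M ((P'.complex.X 0).obj.obj V)) :
    ∃ y, ev (P'.complex.d 1 0) V y = X.mulMap _ z := by
  refine bt_induction X.q R M (P := fun z => ∃ y, ev (P'.complex.d 1 0) V y = X.mulMap _ z)
    (fun m x => exists_d_eq_smul P' V m x) ?_ z
  rintro z z' ⟨y, hy⟩ ⟨y', hy'⟩
  exact ⟨y + y', by rw [map_add, map_add, hy, hy']⟩

/-! ### Truncations in terms of elements -/

/-- The canonical truncation of `q^* P'`, described by elements: maps `π₁` and `π₀` to an elementary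
extension which identify its terms with the quotients of `P'₁(V)` and `P'₀(V)`. -/
structure TruncationData (φ : RingElemExt R M) where
  π₁ (V : FGProj R) : (P'.complex.X 1).obj.obj V →+ φ.C₁.obj.obj V
  π₀ (V : FGProj R) : (P'.complex.X 0).obj.obj V →+ φ.C₀.obj.obj V
  mp_π₁ {V W : FGProj R} (f : V.obj →ₗ[R] W.obj) (x : (P'.complex.X 1).obj.obj V) :
    π₁ W (mp (P'.complex.X 1) f x) = mp φ.C₁ f (π₁ V x)
  mp_π₀ {V W : FGProj R} (f : V.obj →ₗ[R] W.obj) (x : (P'.complex.X 0).obj.obj V) :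
    π₀ W (mp (P'.complex.X 0) f x) = mp φ.C₀ f (π₀ V x)
  π₁_smul (V : FGProj R) (r : X.carrier) (x : (P'.complex.X 1).obj.obj V) :
    π₁ V (r • x) = X.q r • π₁ V x
  π₀_smul (V : FGProj R) (r : X.carrier) (x : (P'.complex.X 0).obj.obj V) :
    π₀ V (r • x) = X.q r • π₀ V x
  π₁_surjective (V : FGProj R) : Function.Surjective (π₁ V)
  π₀_surjective (V : FGProj R) : Function.Surjective (π₀ V)
  π₁_eq_zero_iff (V : FGProj R) (x : (P'.complex.X 1).obj.obj V) :
    π₁ V x = 0 ↔ ∃ z y, X.mulMap _ z + ev (P'.complex.d 2 1) V y = x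
  π₀_eq_zero_iff (V : FGProj R) (x : (P'.complex.X 0).obj.obj V) :
    π₀ V x = 0 ↔ ∃ z, X.mulMap _ z = x
  d_π₁ (V : FGProj R) (x : (P'.complex.X 1).obj.obj V) :
    ev φ.d V (π₁ V x) = π₀ V (ev (P'.complex.d 1 0) V x)
  a_π₀ (V : FGProj R) (x : (P'.complex.X 0).obj.obj V) : ev φ.a V (π₀ V x) = X.aug P' V x
  b_tmulIM (V : FGProj R) (m : M) (x₀ : (P'.complex.X 0).obj.obj V)
    (x₁ : (P'.complex.X 1).obj.obj V) : ev (P'.complex.d 1 0) V x₁ = X.i m • x₀ →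
    ev φ.b V (tmulIM M V m (X.aug P' V x₀)) = π₁ V x₁

variable {P'}

/-- The description by elements of a canonical truncation. -/
def IsTruncation.data {φ : RingElemExt R M} (h : X.IsTruncation P' φ) :
    TruncationData P' φ := by
  let e₁ := h.choose
  let e₀ := h.choose_spec.choose
  obtain ⟨hd, ha, hb⟩ := h.choose_spec.choose_spec
  have he₁ : ∀ V x, ev e₁.hom V (ev e₁.inv V x) = x := fun V x =>
    congrArg (fun t => ev t V x) e₁.inv_hom_id
  have he₁' : ∀ V x, ev e₁.inv V (ev e₁.hom V x) = x := fun V x =>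
    congrArg (fun t => ev t V x) e₁.hom_inv_id
  have he₀ : ∀ V x, ev e₀.hom V (ev e₀.inv V x) = x := fun V x =>
    congrArg (fun t => ev t V x) e₀.inv_hom_id
  have he₀' : ∀ V x, ev e₀.inv V (ev e₀.hom V x) = x := fun V x =>
    congrArg (fun t => ev t V x) e₀.hom_inv_id
  exact
    { π₁ := fun V => (ev e₁.inv V).toAddMonoidHom.comp (toPull₁ P' V)
      π₀ := fun V => (ev e₀.inv V).toAddMonoidHom.comp (toPull₀ P' V)
      mp_π₁ := fun {V W} f x => by
        change ev e₁.inv W (toPull₁ P' W _) = mp φ.C₁ f (ev e₁.inv V (toPull₁ P' V x))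
        rw [toPull₁_mp, ev_mp]
      mp_π₀ := fun {V W} f x => by
        change ev e₀.inv W (toPull₀ P' W _) = mp φ.C₀ f (ev e₀.inv V (toPull₀ P' V x))
        rw [toPull₀_mp, ev_mp]
      π₁_smul := fun V r x => by
        change ev e₁.inv V (toPull₁ P' V _) = X.q r • ev e₁.inv V (toPull₁ P' V x)
        rw [toPull₁_smul, map_smul]
      π₀_smul := fun V r x => by
        change ev e₀.inv V (toPull₀ P' V _) = X.q r • ev e₀.inv V (toPull₀ P' V x)
        rw [toPull₀_smul, map_smul]
      π₁_surjective := fun V =>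
        (Function.LeftInverse.surjective (he₁' V)).comp (toPull₁_surjective P' V)
      π₀_surjective := fun V =>
        (Function.LeftInverse.surjective (he₀' V)).comp (toPull₀_surjective P' V)
      π₁_eq_zero_iff := fun V x => by
        rw [← toPull₁_eq_zero_iff]
        exact map_eq_zero_iff (ev e₁.inv V) (Function.LeftInverse.injective (he₁ V))
      π₀_eq_zero_iff := fun V x => by
        rw [← toPull₀_eq_zero_iff]
        exact map_eq_zero_iff (ev e₀.inv V) (Function.LeftInverse.injective (he₀ V))
      d_π₁ := fun V x => by
        change ev φ.d V (ev e₁.inv V (toPull₁ P' V x)) = ev e₀.inv V (toPull₀ P' V _)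
        rw [← fromOpcycles_toPull₁, ← he₀' V (ev φ.d V _)]
        congr 1
        refine (congrArg (fun t => ev t V (ev e₁.inv V (toPull₁ P' V x))) hd).trans ?_
        change ev ((X.pullback P').fromOpcycles 1 0) V (ev e₁.hom V _) = _
        rw [he₁]
      a_π₀ := fun V x => (ha V 1 x).trans (one_smul _ _)
      b_tmulIM := fun V m x₀ x₁ hx => by
        have := hb V m x₀ x₁ hx
        refine (he₁' V _).symm.trans ?_
        exact congrArg (ev e₁.inv V) this }

end SqZeroExt

end Truncation


noncomputable section TruncationExistence

variable {R : Type u} [Ring R] {M : Type u} [AddCommGroup M] [Module R M] [Module Rᵐᵒᵖ M]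

namespace SqZeroExt

variable {X : SqZeroExt R M} (P' : ProjectiveResolution (X.qLower.obj (I R))) (V : FGProj R)

/-! ### Existence of canonical truncations -/

/-- The map `R × P'₀(V) → V` given by the augmentation. -/
def pullbackAugBi : R →+ (P'.complex.X 0).obj.obj V →+ V.obj :=
  AddMonoidHom.mk' (fun r => (DistribSMul.toAddMonoidHom V.obj r).comp (augHom P' V))
    fun r s => AddMonoidHom.ext fun x => add_smul r s (X.aug P' V x)

/-- The map `R ⊗_{R'} P'₀(V) → V` given by the augmentation. -/
def pullbackAugAdd : ((X.pullback P').X 0).obj.obj V →+ V.obj :=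
  btLift X.q R R (pullbackAugBi P' V) fun r x v => by
    change (r * X.q x) • X.aug P' V v = r • X.aug P' V (x • v)
    rw [aug_smul, mul_smul]

/-- The map `q^* P'₀ ⟶ 𝖨` given by the augmentation. -/
def pullbackAug : (X.pullback P').X 0 ⟶ I R :=
  mkHom (fun V =>
    { pullbackAugAdd P' V with
      map_smul' := fun r y => by
        change pullbackAugAdd P' V (r • y) = r • pullbackAugAdd P' V y
        refine bt_induction X.q R R (P := fun y => pullbackAugAdd P' V (r • y) =
          r • pullbackAugAdd P' V y) (fun s x => ?_) (fun y z hy hz => ?_) y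
        · exact mul_smul r s (X.aug P' V x)
        · exact (congrArg (pullbackAugAdd P' V) (smul_add r y z)).trans
            ((map_add (pullbackAugAdd P' V) _ _).trans ((congrArg₂ (· + ·) hy hz).trans
            ((smul_add r _ _).symm.trans
              (congrArg (r • ·) (map_add (pullbackAugAdd P' V) y z).symm)))) }) fun V W f y => by
    change pullbackAugAdd P' W (mp ((X.pullback P').X 0) f y) = f (pullbackAugAdd P' V y)
    refine bt_induction X.q R R (P := fun y => pullbackAugAdd P' W (mp ((X.pullback P').X 0) f y) =
      f (pullbackAugAdd P' V y)) (fun s x => ?_) (fun y z hy hz => ?_) y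
    · change s • X.aug P' W (mp (P'.complex.X 0) f x) = f (s • X.aug P' V x)
      rw [aug_mp, map_smul]
    · refine (congrArg (pullbackAugAdd P' W) (map_add (mp ((X.pullback P').X 0) f) y z)).trans
        ((map_add (pullbackAugAdd P' W) _ _).trans ((congrArg₂ (· + ·) hy hz).trans
        ((map_add f _ _).symm.trans (congrArg f (map_add (pullbackAugAdd P' V) y z).symm))))

lemma pullbackAug_tmulUpper (r : R) (x : (P'.complex.X 0).obj.obj V) :
    ev (pullbackAug P') V (X.tmulUpper (P'.complex.X 0) V r x) = (r • X.aug P' V x : V.obj) := rfl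

lemma pullbackAug_toPull₀ (x : (P'.complex.X 0).obj.obj V) :
    ev (pullbackAug P') V (toPull₀ P' V x) = X.aug P' V x := one_smul R _

variable [SMulCommClass R Rᵐᵒᵖ M]

variable {V} in
-- The connecting homomorphism is independent of choices: `x - x' = d w`, so `y - y' - i(m) w` is a
-- cycle, hence a boundary, and `y - y'` lies in `M P'₁ + d P'₂`.
lemma toPull₁_eq_of_d_eq {m : M} {x x' : (P'.complex.X 0).obj.obj V}
    {y y' : (P'.complex.X 1).obj.obj V} (hx : X.aug P' V x = X.aug P' V x')
    (hy : ev (P'.complex.d 1 0) V y = X.i m • x)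
    (hy' : ev (P'.complex.d 1 0) V y' = X.i m • x') : toPull₁ P' V y = toPull₁ P' V y' := by
  obtain ⟨w, hw⟩ := exists_d_eq_of_aug P' V (x := x - x') (by
    rw [← augHom_apply, map_sub, augHom_apply, augHom_apply, hx, sub_self])
  obtain ⟨u, hu⟩ := exists_d_eq P' V (x := y - y' - X.i m • w) (by
    rw [map_sub, map_sub, map_smul, hy, hy', hw, smul_sub, sub_self])
  rw [← sub_eq_zero, ← map_sub, toPull₁_eq_zero_iff]
  exact ⟨btmul X.q R M m w, u, by rw [hu, mulMap_btmul, add_sub_cancel]⟩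

/-- The connecting homomorphism `M ⊗_R V → H₁(q^* P'(V))` on pure tensors. -/
def connectingAux (m : M) (v : V.obj) : ((X.pullback P').opcycles 1).obj.obj V :=
  toPull₁ P' V (exists_d_eq_smul P' V m (Function.surjInv (aug_surjective P' V) v)).choose

variable {V} in
lemma connectingAux_eq {m : M} {x : (P'.complex.X 0).obj.obj V} {v : V.obj}
    {y : (P'.complex.X 1).obj.obj V} (hx : X.aug P' V x = v)
    (hy : ev (P'.complex.d 1 0) V y = X.i m • x) : connectingAux P' V m v = toPull₁ P' V y :=
  toPull₁_eq_of_d_eq P' ((Function.surjInv_eq (aug_surjective P' V) v).trans hx.symm)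
    (exists_d_eq_smul P' V m (Function.surjInv (aug_surjective P' V) v)).choose_spec hy

lemma connectingAux_add_right (m : M) (v v' : V.obj) :
    connectingAux P' V m (v + v') = connectingAux P' V m v + connectingAux P' V m v' := by
  obtain ⟨x, rfl⟩ := aug_surjective P' V v
  obtain ⟨x', rfl⟩ := aug_surjective P' V v'
  obtain ⟨y, hy⟩ := exists_d_eq_smul P' V m x
  obtain ⟨y', hy'⟩ := exists_d_eq_smul P' V m x'
  rw [connectingAux_eq P' rfl hy, connectingAux_eq P' rfl hy', ← map_add]
  exact connectingAux_eq P' (aug_add P' V x x') (by rw [map_add, hy, hy', smul_add])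

lemma connectingAux_add_left (m m' : M) (v : V.obj) :
    connectingAux P' V (m + m') v = connectingAux P' V m v + connectingAux P' V m' v := by
  obtain ⟨x, rfl⟩ := aug_surjective P' V v
  obtain ⟨y, hy⟩ := exists_d_eq_smul P' V m x
  obtain ⟨y', hy'⟩ := exists_d_eq_smul P' V m' x
  rw [connectingAux_eq P' rfl hy, connectingAux_eq P' rfl hy', ← map_add]
  exact connectingAux_eq P' rfl (by rw [map_add, hy, hy', map_add, add_smul])

/-- If `r'` lifts `r`, then `i(m r) x = i(m) (r' x)`, and `r' x` lifts `r v`; so the same `y`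
computes both sides. -/
lemma connectingAux_balanced (m : M) (r : R) (v : V.obj) :
    connectingAux P' V (MulOpposite.op r • m) v = connectingAux P' V m (r • v) := by
  obtain ⟨x, rfl⟩ := aug_surjective P' V v
  obtain ⟨r', rfl⟩ := X.q_surjective r
  obtain ⟨y, hy⟩ := exists_d_eq_smul P' V m (r' • x)
  rw [← aug_smul, connectingAux_eq P' rfl hy]
  exact connectingAux_eq P' rfl (by rw [hy, ← X.i_mul, mul_smul])

/-- The connecting homomorphism on pure tensors, as a biadditive map. -/
def connectingBi : M →+ V.obj →+ ((X.pullback P').opcycles 1).obj.obj V :=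
  AddMonoidHom.mk' (fun m => AddMonoidHom.mk' (connectingAux P' V m)
    (connectingAux_add_right P' V m)) fun m m' => AddMonoidHom.ext fun v =>
      connectingAux_add_left P' V m m' v

/-- The connecting homomorphism `M ⊗_R V → H₁(q^* P'(V))`, as an additive map. -/
def connectingAdd : (IM R M).obj.obj V →+ ((X.pullback P').opcycles 1).obj.obj V :=
  btLift (RingHom.id R) R M (V := V.obj) (connectingBi P' V) (connectingAux_balanced P' V)

variable {V} in
lemma connectingAdd_tmulIM {m : M} {x : (P'.complex.X 0).obj.obj V}
    {y : (P'.complex.X 1).obj.obj V} (hy : ev (P'.complex.d 1 0) V y = X.i m • x) :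
    connectingAdd P' V (tmulIM M V m (X.aug P' V x)) = toPull₁ P' V y :=
  connectingAux_eq P' rfl hy

/-- The connecting homomorphism `𝖨(M) ⟶ H₁(q^* P')`. -/
def connecting : IM R M ⟶ (X.pullback P').opcycles 1 :=
  mkHom (fun V =>
    { connectingAdd P' V with
      map_smul' := fun r y => by
        obtain ⟨r', rfl⟩ := X.q_surjective r
        refine IM_induction (P := fun y => connectingAdd P' V (X.q r' • y) =
          X.q r' • connectingAdd P' V y) (fun m v => ?_) (fun y z hy hz => ?_) y
        · obtain ⟨x, rfl⟩ := aug_surjective P' V v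
          obtain ⟨y, hy⟩ := exists_d_eq_smul P' V m x
          rw [connectingAdd_tmulIM P' hy, ← toPull₁_smul]
          exact connectingAdd_tmulIM P' (m := X.q r' • m) (by
            rw [map_smul, hy, ← mul_smul, X.mul_i])
        · rw [smul_add, map_add, hy, hz, map_add, smul_add] }) fun V W f y => by
    change connectingAdd P' W (mp (IM R M) f y) =
      mp ((X.pullback P').opcycles 1) f (connectingAdd P' V y)
    refine IM_induction (P := fun y => connectingAdd P' W (mp (IM R M) f y) =
      mp ((X.pullback P').opcycles 1) f (connectingAdd P' V y)) (fun m v => ?_)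
      (fun y z hy hz => ?_) y
    · obtain ⟨x, rfl⟩ := aug_surjective P' V v
      obtain ⟨y, hy⟩ := exists_d_eq_smul P' V m x
      rw [connectingAdd_tmulIM P' hy, ← toPull₁_mp, mp_tmulIM, ← aug_mp]
      exact connectingAdd_tmulIM P' (by rw [ev_mp, hy, map_smul])
    · rw [map_add, map_add, hy, hz, map_add, map_add]

variable {V} in
lemma connecting_tmulIM {m : M} {x : (P'.complex.X 0).obj.obj V}
    {y : (P'.complex.X 1).obj.obj V} (hy : ev (P'.complex.d 1 0) V y = X.i m • x) :
    ev (connecting P') V (tmulIM M V m (X.aug P' V x)) = toPull₁ P' V y :=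
  connectingAux_eq P' rfl hy

variable {V} in
-- Sums of pure tensors need a global formula. Induction gives it for one preimage of `M ⊗ P'₀`, and
-- two preimages differ by a cycle, hence by a boundary.
lemma connecting_tensorAug {z : BTensor X.q R M ((P'.complex.X 0).obj.obj V)}
    {y : (P'.complex.X 1).obj.obj V} (hy : ev (P'.complex.d 1 0) V y = X.mulMap _ z) :
    ev (connecting P') V (tensorAug P' V z) = toPull₁ P' V y := by
  have : ∃ y', ev (P'.complex.d 1 0) V y' = X.mulMap _ z ∧
      ev (connecting P') V (tensorAug P' V z) = toPull₁ P' V y' := by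
    refine bt_induction X.q R M (P := fun z => ∃ y', ev (P'.complex.d 1 0) V y' = X.mulMap _ z ∧
      ev (connecting P') V (tensorAug P' V z) = toPull₁ P' V y') (fun m x => ?_) ?_ z
    · obtain ⟨y', hy'⟩ := exists_d_eq_smul P' V m x
      exact ⟨y', hy', connecting_tmulIM P' hy'⟩
    · rintro z z' ⟨y, hy, hy₁⟩ ⟨y', hy', hy₁'⟩
      exact ⟨y + y', by rw [map_add, map_add, hy, hy'], by
        rw [map_add, map_add, map_add, hy₁, hy₁']⟩
  obtain ⟨y', hy', h⟩ := this
  rw [h, ← sub_eq_zero, ← map_sub, toPull₁_eq_zero_iff]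
  obtain ⟨u, hu⟩ := exists_d_eq P' V (x := y' - y) (by rw [map_sub, hy, hy', sub_self])
  exact ⟨0, u, by rw [hu, map_zero, zero_add]⟩

/-- If a preimage `x` of `z` lies in `M P'₁ + d P'₂`, then `d x` is the product of some `(M ⊗ d)
z'`. Since `M ⊗ P'₀(V) → P'₀(V)` is injective, `z = (M ⊗ d) z'`, which has zero image in `M ⊗_R V`.
-/
lemma connecting_injective : Function.Injective (ev (connecting P') V) := by
  have := projective_obj (P'.complex.X 0) V
  rw [injective_iff_map_eq_zero]
  intro y hy
  obtain ⟨z, rfl⟩ := tensorAug_surjective P' V y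
  obtain ⟨x, hx⟩ := exists_d_eq_mulMap P' V z
  rw [connecting_tensorAug P' hx, toPull₁_eq_zero_iff] at hy
  obtain ⟨z', u, hu⟩ := hy
  rw [← hu, map_add, d_d_apply, add_zero, ← mulMap_btensorMap] at hx
  rw [← X.mulMap_injective hx, tensorAug_btensorMap_d]

/-- The canonical truncation of `q^* P'`. -/
def truncation : RingElemExt R M where
  C₁ := (X.pullback P').opcycles 1
  C₀ := (X.pullback P').X 0
  b := connecting P'
  d := (X.pullback P').fromOpcycles 1 0
  a := pullbackAug P'
  b_d := ev_ext fun V y => by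
    obtain ⟨z, rfl⟩ := tensorAug_surjective P' V y
    obtain ⟨x, hx⟩ := exists_d_eq_mulMap P' V z
    rw [ev_comp, connecting_tensorAug P' hx, fromOpcycles_toPull₁, hx]
    exact (toPull₀_eq_zero_iff P' V _).2 ⟨z, rfl⟩
  d_a := ev_ext fun V y => by
    obtain ⟨x, rfl⟩ := toPull₁_surjective P' V y
    rw [ev_comp, fromOpcycles_toPull₁, pullbackAug_toPull₀, aug_d]
    rfl
  mono_b := (mono_iff_injective _).2 fun V => connecting_injective P' V
  exact₁ := (exact_iff_ev _ _ _).2 fun V y hy => by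
    obtain ⟨x, rfl⟩ := toPull₁_surjective P' V y
    rw [fromOpcycles_toPull₁, toPull₀_eq_zero_iff] at hy
    obtain ⟨z, hz⟩ := hy
    exact ⟨tensorAug P' V z, connecting_tensorAug P' hz.symm⟩
  exact₀ := (exact_iff_ev _ _ _).2 fun V y hy => by
    obtain ⟨x, rfl⟩ := toPull₀_surjective P' V y
    rw [pullbackAug_toPull₀] at hy
    obtain ⟨w, rfl⟩ := exists_d_eq_of_aug P' V hy
    exact ⟨toPull₁ P' V w, fromOpcycles_toPull₁ P' V w⟩
  epi_a := (epi_iff_surjective _).2 fun V v => by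
    obtain ⟨x, rfl⟩ := aug_surjective P' V v
    exact ⟨toPull₀ P' V x, pullbackAug_toPull₀ P' V x⟩

lemma isTruncation_truncation : X.IsTruncation P' (truncation P') := by
  refine ⟨Iso.refl _, Iso.refl _, ?_, fun V r x => ?_, fun V m x₀ x₁ h => ?_⟩
  · exact (Category.comp_id _).trans (Category.id_comp _).symm
  · exact pullbackAug_tmulUpper P' V r x
  · exact connecting_tmulIM P' h

end SqZeroExt

end TruncationExistence


noncomputable section TruncationSplitting

variable {R : Type u} [Ring R] {M : Type u} [AddCommGroup M] [Module R M] [Module Rᵐᵒᵖ M]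

/-! ### The splitting of a truncation -/

/-- The map induced on the target of a surjective map of abelian groups. -/
def liftSurj {A B C : Type*} [AddCommGroup A] [AddCommGroup B] [AddCommGroup C] (π : A →+ B)
    (hπ : Function.Surjective π) (g : A →+ C) (h : ∀ x, π x = 0 → g x = 0) : B →+ C :=
  AddMonoidHom.liftOfSurjective π hπ ⟨g, fun x hx => h x hx⟩

lemma liftSurj_apply {A B C : Type*} [AddCommGroup A] [AddCommGroup B] [AddCommGroup C]
    (π : A →+ B) (hπ : Function.Surjective π) (g : A →+ C) (h : ∀ x, π x = 0 → g x = 0) (x : A) :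
    liftSurj π hπ g h (π x) = g x :=
  AddMonoidHom.liftOfRightInverse_comp_apply π _ (Function.rightInverse_surjInv hπ)
    ⟨g, fun x hx => h x hx⟩ x

namespace SqZeroExt

variable [SMulCommClass R Rᵐᵒᵖ M] {X : SqZeroExt R M}
  (P' : ProjectiveResolution (X.qLower.obj (I R)))

/-- The submodule `d(M P'₁(V))` of `P'₀(V)`. -/
def splitSubmodule (V : FGProj R) : Submodule X.carrier ((P'.complex.X 0).obj.obj V) :=
  (X.mulSubmodule ((P'.complex.X 1).obj.obj V)).map (ev (P'.complex.d 1 0) V)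

variable {P'} in
lemma mem_splitSubmodule {V : FGProj R} {x : (P'.complex.X 0).obj.obj V} :
    x ∈ splitSubmodule P' V ↔ ∃ z, ev (P'.complex.d 1 0) V (X.mulMap _ z) = x := by
  constructor
  · rintro ⟨_, ⟨z, rfl⟩, rfl⟩
    exact ⟨z, rfl⟩
  · rintro ⟨z, rfl⟩
    exact ⟨_, ⟨z, rfl⟩, rfl⟩

variable {P'} in
lemma mp_mem_splitSubmodule {V W : FGProj R} (f : V.obj →ₗ[R] W.obj)
    (x : (P'.complex.X 0).obj.obj V) (hx : x ∈ splitSubmodule P' V) :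
    mp (P'.complex.X 0) f x ∈ splitSubmodule P' W := by
  obtain ⟨z, rfl⟩ := mem_splitSubmodule.1 hx
  refine mem_splitSubmodule.2 ⟨btensorMap X.q R M (mp (P'.complex.X 1) f) z, ?_⟩
  rw [mulMap_btensorMap, ev_mp]

/-- The map `P'₀(V) / d(M P'₁(V)) → P'₀(W) / d(M P'₁(W))` induced by a map `V → W`. -/
def splitMap {V W : FGProj R} (f : V.obj →ₗ[R] W.obj) :
    ((P'.complex.X 0).obj.obj V ⧸ splitSubmodule P' V) →ₗ[X.carrier]
      (P'.complex.X 0).obj.obj W ⧸ splitSubmodule P' W :=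
  Submodule.mapQ _ _ (mp (P'.complex.X 0) f) (mp_mem_splitSubmodule f)

/-- The functor `V ↦ P'₀(V) / d(M P'₁(V))`. -/
def splitObj : BAb R :=
  mkFunAb (fun V => (P'.complex.X 0).obj.obj V ⧸ splitSubmodule P' V)
    (fun f => (splitMap P' f).toAddMonoidHom)
    (fun V => AddMonoidHom.ext fun y => by
      obtain ⟨x, rfl⟩ := Submodule.mkQ_surjective _ y
      exact congrArg (splitSubmodule P' V).mkQ
        (LinearMap.congr_fun (mp_id (P'.complex.X 0) V) x))
    (fun {U V W} f g => AddMonoidHom.ext fun y => by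
      obtain ⟨x, rfl⟩ := Submodule.mkQ_surjective _ y
      exact congrArg (splitSubmodule P' W).mkQ (mp_comp_apply (P'.complex.X 0) f g x))
    (fun V => AddMonoidHom.ext fun y => by
      obtain ⟨x, rfl⟩ := Submodule.mkQ_surjective _ y
      exact (congrArg (splitSubmodule P' V).mkQ
        (LinearMap.congr_fun (mp_zero (P'.complex.X 0) V V) x)).trans (map_zero _))

/-- The projection from `P'₀(V)` to its quotient by `d(M P'₁(V))`. -/
def splitProj (V : FGProj R) : (P'.complex.X 0).obj.obj V →+ (splitObj P').obj.obj V :=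
  (splitSubmodule P' V).mkQ.toAddMonoidHom

lemma splitProj_surjective (V : FGProj R) : Function.Surjective (splitProj P' V) :=
  Submodule.mkQ_surjective _

lemma splitProj_eq_zero_iff {V : FGProj R} (x : (P'.complex.X 0).obj.obj V) :
    splitProj P' V x = 0 ↔ ∃ z, ev (P'.complex.d 1 0) V (X.mulMap _ z) = x :=
  (Submodule.Quotient.mk_eq_zero _).trans mem_splitSubmodule

lemma splitProj_mp {V W : FGProj R} (f : V.obj →ₗ[R] W.obj) (x : (P'.complex.X 0).obj.obj V) :
    splitProj P' W (mp (P'.complex.X 0) f x) = mpAb (splitObj P') f (splitProj P' V x) := rfl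

/-- The multiplication by an element of `X` on the functor `V ↦ P'₀(V) / d(M P'₁(V))`. -/
def splitScal (x : X.carrier) : End (splitObj P') :=
  mkHomAb (F := splitObj P') (G := splitObj P') (fun V => DistribSMul.toAddMonoidHom
      ((P'.complex.X 0).obj.obj V ⧸ splitSubmodule P' V) x) fun _ _ f y =>
    ((splitMap P' f).map_smul x y).symm

lemma split_hom_ext {F : BAb R} {s t : splitObj P' ⟶ F}
    (h : ∀ V y, evAb s V (splitProj P' V y) = evAb t V (splitProj P' V y)) : s = t :=
  evAb_ext fun V y => by
    obtain ⟨x, rfl⟩ := splitProj_surjective P' V y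
    exact h V x

/-- The action of `X` on the functor `V ↦ P'₀(V) / d(M P'₁(V))`. -/
def splitAction : X.carrier →+* End (splitObj P') where
  toFun := splitScal P'
  map_one' := split_hom_ext P' fun V y => congrArg (splitProj P' V) (one_smul X.carrier y)
  map_zero' := split_hom_ext P' fun V y =>
    (congrArg (splitProj P' V) (zero_smul X.carrier y)).trans (map_zero _)
  map_mul' r s := split_hom_ext P' fun V y => congrArg (splitProj P' V) (mul_smul r s y)
  map_add' r s := split_hom_ext P' fun V y =>
    (congrArg (splitProj P' V) (add_smul r s y)).trans (map_add _ _ _)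

lemma splitAction_splitProj (x : X.carrier) {V : FGProj R} (y : (P'.complex.X 0).obj.obj V) :
    evAb (splitAction P' x) V (splitProj P' V y) = splitProj P' V (x • y) := rfl

namespace TruncationData

variable {P'} {φ : RingElemExt R M} (D : TruncationData P' φ)

lemma b_tensorAug {V : FGProj R} {z : BTensor X.q R M ((P'.complex.X 0).obj.obj V)}
    {y : (P'.complex.X 1).obj.obj V} (hy : ev (P'.complex.d 1 0) V y = X.mulMap _ z) :
    ev φ.b V (tensorAug P' V z) = D.π₁ V y := by
  have : ∃ y', ev (P'.complex.d 1 0) V y' = X.mulMap _ z ∧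
      ev φ.b V (tensorAug P' V z) = D.π₁ V y' := by
    refine bt_induction X.q R M (P := fun z => ∃ y', ev (P'.complex.d 1 0) V y' = X.mulMap _ z ∧
      ev φ.b V (tensorAug P' V z) = D.π₁ V y') (fun m x => ?_) ?_ z
    · obtain ⟨y', hy'⟩ := exists_d_eq_smul P' V m x
      exact ⟨y', hy', D.b_tmulIM V m x y' hy'⟩
    · rintro z z' ⟨y, hy, hy₁⟩ ⟨y', hy', hy₁'⟩
      exact ⟨y + y', by rw [map_add, map_add, hy, hy'], by
        rw [map_add, map_add, map_add, hy₁, hy₁']⟩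
  obtain ⟨y', hy', h⟩ := this
  rw [h, ← sub_eq_zero, ← map_sub, D.π₁_eq_zero_iff]
  obtain ⟨u, hu⟩ := exists_d_eq P' V (x := y' - y) (by rw [map_sub, hy, hy', sub_self])
  exact ⟨0, u, by rw [hu, map_zero, zero_add]⟩

/-- The embedding of `C₁(V)` in the splitting. -/
def c₁App (V : FGProj R) : φ.C₁.obj.obj V →+ (splitObj P').obj.obj V :=
  liftSurj (D.π₁ V) (D.π₁_surjective V)
    ((splitProj P' V).comp (ev (P'.complex.d 1 0) V).toAddMonoidHom) fun x hx => by
      obtain ⟨z, y, rfl⟩ := (D.π₁_eq_zero_iff V x).1 hx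
      refine (splitProj_eq_zero_iff P' _).2 ⟨z, ?_⟩
      change _ = ev (P'.complex.d 1 0) V (_ + _)
      rw [map_add, d_d_apply, add_zero]

lemma c₁App_π₁ {V : FGProj R} (x : (P'.complex.X 1).obj.obj V) :
    D.c₁App V (D.π₁ V x) = splitProj P' V (ev (P'.complex.d 1 0) V x) :=
  liftSurj_apply (D.π₁ V) (D.π₁_surjective V) _ _ x

lemma c₁App_mp {V W : FGProj R} (f : V.obj →ₗ[R] W.obj) (y : φ.C₁.obj.obj V) :
    D.c₁App W (mp φ.C₁ f y) = mpAb (splitObj P') f (D.c₁App V y) := by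
  obtain ⟨x, rfl⟩ := D.π₁_surjective V y
  rw [← D.mp_π₁, c₁App_π₁, c₁App_π₁, ev_mp, splitProj_mp]

/-- The embedding of `C₁` in the splitting. -/
def c₁ : (eLower R).obj φ.C₁ ⟶ splitObj P' :=
  mkHomAb (F := (eLower R).obj φ.C₁) D.c₁App fun _ _ => D.c₁App_mp

lemma c₁_π₁ {V : FGProj R} (x : (P'.complex.X 1).obj.obj V) :
    evAb D.c₁ V (D.π₁ V x) = splitProj P' V (ev (P'.complex.d 1 0) V x) := D.c₁App_π₁ x

/-- The projection from the splitting to `C₀(V)`. -/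
def c₀App (V : FGProj R) : (splitObj P').obj.obj V →+ φ.C₀.obj.obj V :=
  liftSurj (splitProj P' V) (splitProj_surjective P' V) (D.π₀ V) fun x hx => by
    obtain ⟨z, rfl⟩ := (splitProj_eq_zero_iff P' x).1 hx
    refine (D.π₀_eq_zero_iff V _).2 ⟨btensorMap X.q R M (ev (P'.complex.d 1 0) V) z, ?_⟩
    rw [mulMap_btensorMap]

lemma c₀App_splitProj {V : FGProj R} (x : (P'.complex.X 0).obj.obj V) :
    D.c₀App V (splitProj P' V x) = D.π₀ V x :=
  liftSurj_apply (splitProj P' V) (splitProj_surjective P' V) _ _ x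

lemma c₀App_mp {V W : FGProj R} (f : V.obj →ₗ[R] W.obj) (y : (splitObj P').obj.obj V) :
    D.c₀App W (mpAb (splitObj P') f y) = mp φ.C₀ f (D.c₀App V y) := by
  obtain ⟨x, rfl⟩ := splitProj_surjective P' V y
  rw [← splitProj_mp, c₀App_splitProj, c₀App_splitProj, D.mp_π₀]

/-- The projection from the splitting to `C₀`. -/
def c₀ : splitObj P' ⟶ (eLower R).obj φ.C₀ :=
  mkHomAb (G := (eLower R).obj φ.C₀) D.c₀App fun _ _ => D.c₀App_mp

lemma c₀_splitProj {V : FGProj R} (x : (P'.complex.X 0).obj.obj V) :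
    evAb D.c₀ V (splitProj P' V x) = D.π₀ V x := D.c₀App_splitProj x

/-- If `d x = d z` with `z ∈ M P'₁`, then `x - z` is a cycle, hence a boundary; so `x ∈ M P'₁ + d
P'₂`, which is the kernel of `π₁`. -/
lemma c₁_injective (V : FGProj R) : Function.Injective (evAb D.c₁ V) := by
  rw [injective_iff_map_eq_zero]
  intro y hy
  obtain ⟨x, rfl⟩ := D.π₁_surjective V y
  rw [D.c₁_π₁, splitProj_eq_zero_iff] at hy
  obtain ⟨z, hz⟩ := hy
  obtain ⟨u, hu⟩ := exists_d_eq P' V (x := x - X.mulMap _ z) (by rw [map_sub, hz, sub_self])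
  exact (D.π₁_eq_zero_iff V x).2 ⟨z, u, by rw [hu, add_sub_cancel]⟩

lemma c₁_c₀ : D.c₁ ≫ D.c₀ = (eLowerExt φ).d := evAb_ext fun V y => by
  obtain ⟨x, rfl⟩ := D.π₁_surjective V y
  change evAb D.c₀ V (evAb D.c₁ V (D.π₁ V x)) = ev φ.d V (D.π₁ V x)
  rw [c₁_π₁, c₀_splitProj, D.d_π₁]

lemma proj_splitProj {V : FGProj R} (x : (P'.complex.X 0).obj.obj V) :
    evAb (D.c₀ ≫ (eLowerExt φ).a) V (splitProj P' V x) = X.aug P' V x := by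
  rw [evAb_comp, c₀_splitProj]
  exact D.a_π₀ V x

/-- The splitting of a truncation. -/
def splitting : (eLowerExt φ).Splitting where
  C₀₁ := splitObj P'
  c₁ := D.c₁
  c₀ := D.c₀
  c₁_c₀ := D.c₁_c₀
  shortExact₁ := (shortExact_iff_evAb _ _ _).2 fun V => by
    refine ⟨D.c₁_injective V, fun y hy => ?_, fun v => ?_⟩
    · obtain ⟨x, rfl⟩ := splitProj_surjective P' V y
      rw [proj_splitProj] at hy
      obtain ⟨w, rfl⟩ := exists_d_eq_of_aug P' V hy
      exact ⟨D.π₁ V w, D.c₁_π₁ w⟩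
    · obtain ⟨x, rfl⟩ := aug_surjective P' V v
      exact ⟨splitProj P' V x, D.proj_splitProj x⟩
  shortExact₀ := (shortExact_iff_evAb _ _ _).2 fun V => by
    refine ⟨(D.c₁_injective V).comp ((mono_iff_injective φ.b).1 φ.mono_b V),
      fun y hy => ?_, fun y => ?_⟩
    · obtain ⟨x, rfl⟩ := splitProj_surjective P' V y
      rw [c₀_splitProj] at hy
      obtain ⟨z, rfl⟩ := (D.π₀_eq_zero_iff V x).1 hy
      -- The kernel of `C₀₁ → C₀` is `M P'₀ / d(M P'₁)`. Elements of `M P'₀` are boundaries, and the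
      -- formula for the connecting map identifies their classes with values of `c₁ b`.
      obtain ⟨w, hw⟩ := exists_d_eq_mulMap P' V z
      refine ⟨tensorAug P' V z, ?_⟩
      rw [← hw, ← c₁_π₁]
      exact congrArg (evAb D.c₁ V) (D.b_tensorAug hw)
    · obtain ⟨x, rfl⟩ := D.π₀_surjective V y
      exact ⟨splitProj P' V x, D.c₀_splitProj x⟩

/-- The action of `X` on the splitting of a truncation. -/
def regularAction : RegularAction D.splitting X where
  ρ := splitAction P'
  isRegularOver r := by
    constructor
    · refine evAb_ext fun V y => ?_
      obtain ⟨x, rfl⟩ := D.π₁_surjective V y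
      change evAb (splitAction P' r) V (evAb D.c₁ V (D.π₁ V x)) =
        evAb D.c₁ V (X.q r • D.π₁ V x : φ.C₁.obj.obj V)
      rw [← D.π₁_smul, c₁_π₁, c₁_π₁, splitAction_splitProj,
        map_smul (ev (P'.complex.d 1 0) V)]
    · refine split_hom_ext P' fun V x => ?_
      exact ((D.c₀_splitProj _).trans (D.π₀_smul V r x)).trans
        (congrArg (fun t : φ.C₀.obj.obj V => X.q r • t) (D.c₀_splitProj x).symm)
  ρ_i m := by
    refine split_hom_ext P' fun V x => ?_
    -- With `i(m) x = d w`, the class of `i(m) x` is `c₁ (π₁ w)`, and `π₁ w = b (m ⊗ v)` by the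
    -- description of the connecting map.
    obtain ⟨w, hw⟩ := exists_d_eq_smul P' V m x
    refine (splitAction_splitProj P' (X.i m) x).trans ?_
    rw [← hw, ← c₁_π₁, ← D.b_tmulIM V m x w hw]
    exact congrArg (fun v : V.obj => evAb D.c₁ V (ev φ.b V (tmulIM M V m v)))
      (D.proj_splitProj x).symm

lemma isRegularExt : IsRegularExt D.splitting X := D.regularAction.isRegularExt

end TruncationData

end SqZeroExt

end TruncationSplitting


noncomputable section TruncationMaps

variable {R : Type u} [Ring R] {M : Type u} [AddCommGroup M] [Module R M] [Module Rᵐᵒᵖ M]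

/-! ### Maps from truncations -/

section

variable {ψ : RingElemExt R M} {S : (eLowerExt ψ).Splitting}

lemma IsRegularOver.c₁_apply {x : End S.C₀₁} {r : R} (h : IsRegularOver S x r) (V : FGProj R)
    (y : ψ.C₁.obj.obj V) :
    evAb x V (evAb S.c₁ V y) = evAb S.c₁ V (r • y : ψ.C₁.obj.obj V) :=
  congrArg (fun t => evAb t V y) h.1

lemma IsRegularOver.c₀_apply {x : End S.C₀₁} {r : R} (h : IsRegularOver S x r) (V : FGProj R)
    (y : S.C₀₁.obj.obj V) :
    evAb S.c₀ V (evAb x V y) = HSMul.hSMul (β := ψ.C₀.obj.obj V) r (evAb S.c₀ V y) :=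
  congrArg (fun t => evAb t V y) h.2

variable (S) in
/-- The projection from a splitting to `𝖨`. -/
def splittingProj (V : FGProj R) : S.C₀₁.obj.obj V →+ V.obj :=
  (ev ψ.a V).toAddMonoidHom.comp (evAb S.c₀ V)

lemma IsRegularOver.proj_apply {x : End S.C₀₁} {r : R} (h : IsRegularOver S x r) (V : FGProj R)
    (y : S.C₀₁.obj.obj V) :
    splittingProj S V (evAb x V y) = r • splittingProj S V y :=
  (congrArg (ev ψ.a V) (h.c₀_apply V y)).trans (map_smul (ev ψ.a V) r _)

lemma splittingProj_mp {V W : FGProj R} (f : V.obj →ₗ[R] W.obj) (y : S.C₀₁.obj.obj V) :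
    splittingProj S W (mpAb S.C₀₁ f y) = f (splittingProj S V y) :=
  evAb_mpAb (S.c₀ ≫ (eLowerExt ψ).a) f y

lemma splittingProj_surjective (V : FGProj R) : Function.Surjective (splittingProj S V) :=
  ((shortExact_iff_evAb _ _ _).1 S.shortExact₁ V).2.2

lemma splitting_c₁_injective (V : FGProj R) : Function.Injective (evAb S.c₁ V) :=
  ((shortExact_iff_evAb _ _ _).1 S.shortExact₁ V).1

lemma exists_c₁_eq {V : FGProj R} {y : S.C₀₁.obj.obj V} (h : splittingProj S V y = 0) :
    ∃ x : ψ.C₁.obj.obj V, evAb S.c₁ V x = y :=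
  ((shortExact_iff_evAb _ _ _).1 S.shortExact₁ V).2.1 y h

lemma c₀_c₁_apply (V : FGProj R) (x : ψ.C₁.obj.obj V) :
    evAb S.c₀ V (evAb S.c₁ V x) = ev ψ.d V x :=
  congrArg (fun t => evAb t V x) S.c₁_c₀

lemma c₀_c₁_b_apply (V : FGProj R) (x : (IM R M).obj.obj V) :
    evAb S.c₀ V (evAb S.c₁ V (ev ψ.b V x)) = 0 :=
  (c₀_c₁_apply V _).trans (congrArg (fun t => ev t V x) ψ.b_d)

variable {X : SqZeroExt R M} (h : RegularAction S X)

/-- The values of a splitting, as modules over the square-zero extension acting on it. -/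
def RegularAction.Val (_ : RegularAction S X) (V : FGProj R) : Type u := S.C₀₁.obj.obj V

namespace RegularAction

instance (V : FGProj R) : AddCommGroup (h.Val V) :=
  inferInstanceAs (AddCommGroup (S.C₀₁.obj.obj V))

instance (V : FGProj R) : Module X.carrier (h.Val V) where
  smul x y := evAb (h.ρ x) V y
  one_smul y := congrArg (fun t => evAb t V y) h.ρ.map_one
  mul_smul x x' y := congrArg (fun t => evAb t V y) (h.ρ.map_mul x x')
  smul_zero x := map_zero (evAb (h.ρ x) V)
  smul_add x := map_add (evAb (h.ρ x) V)
  add_smul x x' y := congrArg (fun t => evAb t V y) (h.ρ.map_add x x')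
  zero_smul y := congrArg (fun t => evAb t V y) h.ρ.map_zero

/-- The maps of the functor given by a splitting, as linear maps. -/
def valMap {V W : FGProj R} (f : V.obj →ₗ[R] W.obj) : h.Val V →ₗ[X.carrier] h.Val W :=
  { mpAb S.C₀₁ f with map_smul' := fun x y => (evAb_mpAb (h.ρ x) f y).symm }

/-- The functor given by a splitting, with values in modules over the square-zero extension
acting on it. -/
def valFun : BCat R X.carrier :=
  mkFun h.Val h.valMap
    (fun V => LinearMap.ext fun y => DFunLike.congr_fun (mpAb_id S.C₀₁ V) y)
    (fun f g => LinearMap.ext fun y => mpAb_comp S.C₀₁ f g y)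
    (fun V => LinearMap.ext fun y => DFunLike.congr_fun (mpAb_zero S.C₀₁ V V) y)

/-- The projection from a splitting to `q_* 𝖨`. -/
def valProj : h.valFun ⟶ X.qLower.obj (I R) :=
  mkHom (F := h.valFun) (G := X.qLower.obj (I R)) (fun V =>
    { splittingProj S V with
      map_smul' := fun x y => (h.isRegularOver x).proj_apply V y }) fun _ _ f y =>
    splittingProj_mp f y

instance : Epi h.valProj := (epi_iff_surjective _).2 splittingProj_surjective

/-- The action makes the splitting an object of `𝓑(R, R')` with an epimorphism to `q_* 𝖨`, along
which the augmentation lifts because `P'₀` is projective there. -/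
lemma exists_lift_aug (P' : ProjectiveResolution (X.qLower.obj (I R))) :
    ∃ f : ∀ V, (P'.complex.X 0).obj.obj V →+ S.C₀₁.obj.obj V,
      (∀ {V W : FGProj R} (g : V.obj →ₗ[R] W.obj) x,
        f W (mp (P'.complex.X 0) g x) = mpAb S.C₀₁ g (f V x)) ∧
      (∀ V (r : X.carrier) x, f V (r • x) = evAb (h.ρ r) V (f V x)) ∧
      ∀ V x, splittingProj S V (f V x) = X.aug P' V x := by
  have := P'.projective 0
  let t : P'.complex.X 0 ⟶ X.qLower.obj (I R) := P'.π.f 0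
  let f : P'.complex.X 0 ⟶ h.valFun := Projective.factorThru t h.valProj
  have hf : f ≫ h.valProj = t := Projective.factorThru_comp _ _
  exact ⟨fun V => (ev f V).toAddMonoidHom, fun g x => ev_mp f g x,
    fun V r x => map_smul (ev f V) r x, fun V x => congrArg (fun s => ev s V x) hf⟩

end RegularAction

end

namespace SqZeroExt.TruncationData

variable [SMulCommClass R Rᵐᵒᵖ M] {X : SqZeroExt R M}
  {P' : ProjectiveResolution (X.qLower.obj (I R))} {φ ψ : RingElemExt R M}
  {S : (eLowerExt ψ).Splitting}

/-- A truncation of `q^* P'` maps to every elementary extension with a splitting on which the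
square-zero extension acts. -/
lemma nonempty_hom (D : TruncationData P' φ) (h : RegularAction S X) : Nonempty (φ ⟶ ψ) := by
  obtain ⟨f, hfn, hfs, hfa⟩ := h.exists_lift_aug P'
  -- The lift is linear over the square-zero extension and `i(m)` acts as `regularEmb S m`, so the
  -- values on `M P'₀` depend only on the augmentation.
  have hfM : ∀ V z, f V (X.mulMap _ z) = evAb S.c₁ V (ev ψ.b V (tensorAug P' V z)) := by
    intro V z
    refine bt_induction X.q R M (P := fun z => f V (X.mulMap _ z) =
      evAb S.c₁ V (ev ψ.b V (tensorAug P' V z))) (fun m x => ?_) (fun y z hy hz => ?_) z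
    · rw [mulMap_btmul, hfs, h.ρ_i, tensorAug_btmul, ← hfa]
      rfl
    · rw [map_add, map_add, hy, hz, map_add, map_add]
      exact (map_add (evAb S.c₁ V) _ _).symm
  -- Boundaries have zero augmentation, so `f ∘ d` lands in the subobject `C₁`.
  have hex : ∀ V (x : (P'.complex.X 1).obj.obj V), ∃ y : ψ.C₁.obj.obj V,
      evAb S.c₁ V y = f V (ev (P'.complex.d 1 0) V x) := fun V x =>
    exists_c₁_eq (by rw [hfa, aug_d])
  choose g hg using hex
  have hinj : ∀ V (y y' : ψ.C₁.obj.obj V), evAb S.c₁ V y = evAb S.c₁ V y' → y = y' :=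
    fun V _ _ hy => splitting_c₁_injective V hy
  have hadd : ∀ V x x', g V (x + x') = g V x + g V x' := fun V x x' => hinj V _ _ (by
    rw [hg, map_add, map_add, ← hg, ← hg]
    exact (map_add (evAb S.c₁ V) _ _).symm)
  -- On `d P'₂` this is `d ∘ d = 0`. On `M P'₁` it holds because `f` maps `d(M P'₁)` through
  -- `tensorAug`, which kills the image of `M ⊗ d`.
  have hg0 : ∀ V x, D.π₁ V x = 0 → AddMonoidHom.mk' (g V) (hadd V) x = 0 := by
    intro V x hx
    obtain ⟨z, y, rfl⟩ := (D.π₁_eq_zero_iff V x).1 hx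
    refine hinj V _ _ ((hg V _).trans ?_)
    rw [map_add, d_d_apply, add_zero, ← mulMap_btensorMap, hfM, tensorAug_btensorMap_d, map_zero]
  have hf0 : ∀ V x, D.π₀ V x = 0 →
      ((evAb S.c₀ V).comp (f V) : (P'.complex.X 0).obj.obj V →+ ψ.C₀.obj.obj V) x = 0 := by
    intro V x hx
    obtain ⟨z, rfl⟩ := (D.π₀_eq_zero_iff V x).1 hx
    exact (congrArg (evAb S.c₀ V) (hfM V z)).trans (c₀_c₁_b_apply V _)
  let f₁ (V : FGProj R) : φ.C₁.obj.obj V →+ ψ.C₁.obj.obj V :=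
    liftSurj (D.π₁ V) (D.π₁_surjective V) _ (hg0 V)
  let f₀ (V : FGProj R) : φ.C₀.obj.obj V →+ ψ.C₀.obj.obj V :=
    liftSurj (D.π₀ V) (D.π₀_surjective V) _ (hf0 V)
  have hf₁ : ∀ V x, evAb S.c₁ V (f₁ V (D.π₁ V x)) = f V (ev (P'.complex.d 1 0) V x) :=
    fun V x => (congrArg (evAb S.c₁ V) (liftSurj_apply _ _ _ (hg0 V) x)).trans (hg V x)
  have hf₀ : ∀ V x, f₀ V (D.π₀ V x) = evAb S.c₀ V (f V x) := fun V x =>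
    liftSurj_apply _ _ _ (hf0 V) x
  -- From here on only the values on `π₁` and `π₀` matter.
  clear_value f₁ f₀
  have hs₁ : ∀ V (r : R) y, f₁ V (r • y) = r • f₁ V y := by
    intro V r y
    obtain ⟨x, rfl⟩ := D.π₁_surjective V y
    obtain ⟨r, rfl⟩ := X.q_surjective r
    refine hinj V _ _ ?_
    rw [← D.π₁_smul, hf₁, map_smul (ev (P'.complex.d 1 0) V), hfs, ← hf₁]
    exact (h.isRegularOver r).c₁_apply V _
  have hs₀ : ∀ V (r : R) y, f₀ V (r • y) = r • f₀ V y := by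
    intro V r y
    obtain ⟨x, rfl⟩ := D.π₀_surjective V y
    obtain ⟨r, rfl⟩ := X.q_surjective r
    rw [← D.π₀_smul, hf₀, hf₀, hfs]
    exact (h.isRegularOver r).c₀_apply V _
  have hn₁ : ∀ {V W : FGProj R} (k : V.obj →ₗ[R] W.obj) y,
      f₁ W (mp φ.C₁ k y) = mp ψ.C₁ k (f₁ V y) := by
    intro V W k y
    obtain ⟨x, rfl⟩ := D.π₁_surjective V y
    refine hinj W _ _ ?_
    rw [← D.mp_π₁, hf₁, ev_mp, hfn, ← hf₁]
    exact (evAb_mpAb S.c₁ k _).symm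
  have hn₀ : ∀ {V W : FGProj R} (k : V.obj →ₗ[R] W.obj) y,
      f₀ W (mp φ.C₀ k y) = mp ψ.C₀ k (f₀ V y) := by
    intro V W k y
    obtain ⟨x, rfl⟩ := D.π₀_surjective V y
    rw [← D.mp_π₀, hf₀, hfn, hf₀]
    exact evAb_mpAb S.c₀ k _
  refine ⟨⟨mkHom (fun V => { f₁ V with map_smul' := hs₁ V }) fun _ _ => hn₁,
    mkHom (fun V => { f₀ V with map_smul' := hs₀ V }) fun _ _ => hn₀, ev_ext fun V y => ?_,
    ev_ext fun V y => ?_, ev_ext fun V y => ?_⟩⟩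
  · obtain ⟨z, rfl⟩ := tensorAug_surjective P' V y
    obtain ⟨x, hx⟩ := exists_d_eq_mulMap P' V z
    change f₁ V (ev φ.b V _) = ev ψ.b V _
    refine hinj V _ _ ?_
    rw [D.b_tensorAug hx, hf₁, hx, hfM]
  · obtain ⟨x, rfl⟩ := D.π₁_surjective V y
    change f₀ V (ev φ.d V _) = ev ψ.d V (f₁ V _)
    rw [D.d_π₁, hf₀, ← hf₁]
    exact c₀_c₁_apply V _
  · obtain ⟨x, rfl⟩ := D.π₀_surjective V y
    change ev ψ.a V (f₀ V _) = ev φ.a V _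
    rw [hf₀, D.a_π₀, ← hfa]
    rfl

end SqZeroExt.TruncationData

end TruncationMaps

noncomputable section Main

variable {R : Type u} [Ring R] {M : Type u} [AddCommGroup M] [Module R M] [Module Rᵐᵒᵖ M]
  [SMulCommClass R Rᵐᵒᵖ M]

/-! ### The bijection between square-zero extensions and elementary extensions -/

/-- `X` acts regularly on the splitting `P'₀ / d(M P'₁)` of the truncation, so it is its ring of
regular endomorphisms. This is `Ψ ∘ Φ = id`. -/
lemma SqZeroExt.IsTruncation.elToSq_mk {X : SqZeroExt R M}
    {P' : ProjectiveResolution (X.qLower.obj (I R))} {φ : RingElemExt R M}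
    (h : X.IsTruncation P' φ) : elToSq (El.mk φ) = Sq.mk X :=
  h.data.isRegularExt.regularClass_eq

lemma IsRegularExt.elToSq_mk {φ : RingElemExt R M} {S : (eLowerExt φ).Splitting}
    {X : SqZeroExt R M} (h : IsRegularExt S X) : elToSq (El.mk φ) = Sq.mk X :=
  h.regularClass_eq

lemma El.mk_eq_of_regularExt {φ ψ : RingElemExt R M} {S : (eLowerExt ψ).Splitting}
    {X : SqZeroExt R M} {P' : ProjectiveResolution (X.qLower.obj (I R))}
    (h : X.IsTruncation P' φ) (h' : RegularAction S X) : El.mk φ = El.mk ψ :=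
  connectedComponents_mk_eq_of_hom (h.data.nonempty_hom h').some

/-- The ring of regular endomorphisms acts tautologically, and the action pulls back along an
isomorphism from `X`. -/
lemma El.exists_splitting_regularAction {ψ : RingElemExt R M} {X : SqZeroExt R M}
    (h : elToSq (El.mk ψ) = Sq.mk X) :
    ∃ S : (eLowerExt ψ).Splitting, Nonempty (RegularAction S X) := by
  obtain ⟨S⟩ := exists_splitting isAdd_IM (eLowerExt ψ)
  obtain ⟨Y, hY⟩ := exists_isRegularExt S
  obtain ⟨e⟩ := Quotient.exact (h.symm.trans hY.elToSq_mk)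
  exact ⟨S, ⟨hY.regularAction.comp e.hom⟩⟩

/-- If `φ` and `ψ` give the same `X`, then `X` acts regularly on splittings of both, and one
truncation for `X` maps to both. Surjectivity holds since each `X` is recovered from its truncation.
-/
lemma elToSq_bijective : Function.Bijective (elToSq : El R M → Sq R M) := by
  constructor
  · rintro ⟨φ⟩ ⟨ψ⟩ hφψ
    obtain ⟨X, hX⟩ := Quotient.exists_rep (elToSq (El.mk φ))
    let P' := ProjectiveResolution.of (X.qLower.obj (I R))
    obtain ⟨S, ⟨h⟩⟩ := El.exists_splitting_regularAction (hX : Sq.mk X = _).symm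
    obtain ⟨S', ⟨h'⟩⟩ := El.exists_splitting_regularAction (ψ := ψ) (hφψ.symm.trans hX.symm)
    have ht := SqZeroExt.isTruncation_truncation P'
    exact (El.mk_eq_of_regularExt ht h).symm.trans (El.mk_eq_of_regularExt ht h')
  · rintro ⟨X⟩
    exact ⟨_, (SqZeroExt.isTruncation_truncation (ProjectiveResolution.of _)).elToSq_mk⟩

end Main

end SqEl

theorem mainTheorem1 (R : Type u) [Ring R] (M : Type u) [AddCommGroup M] [Module R M]
    [Module Rᵐᵒᵖ M] [SMulCommClass R Rᵐᵒᵖ M] :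
    ∃ (Φ : Sq R M → El R M) (Ψ : El R M → Sq R M) (cl : El R M → MacLaneH2 R M),
      -- `Φ` is given by `τ_[0,1] q^* P'`, for any projective resolution `P'` of `q_* 𝖨`
      (∀ X : SqZeroExt R M, Nonempty (ProjectiveResolution (X.qLower.obj (I R)))) ∧
      (∀ (X : SqZeroExt R M) (P' : ProjectiveResolution (X.qLower.obj (I R))),
        (∃ φ : RingElemExt R M, X.IsTruncation P' φ) ∧
        ∀ φ : RingElemExt R M, X.IsTruncation P' φ → Φ (Sq.mk X) = El.mk φ) ∧
      -- `Ψ` is given by the regular endomorphisms of `C₀₁`, for any splitting `C₀₁` of `e_* φ`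
      (∀ φ : RingElemExt R M, Nonempty (eLowerExt φ).Splitting) ∧
      (∀ (φ : RingElemExt R M) (S : (eLowerExt φ).Splitting),
        (∃ X : SqZeroExt R M, IsRegularExt S X) ∧
        ∀ X : SqZeroExt R M, IsRegularExt S X → Ψ (El.mk φ) = Sq.mk X) ∧
      -- `cl` sends an elementary extension to its Yoneda class
      (∀ φ : RingElemExt R M, cl (El.mk φ) = φ.yonedaClass) ∧
      Function.LeftInverse Ψ Φ ∧ Function.RightInverse Ψ Φ ∧
      Function.Bijective cl ∧ Function.Bijective (cl ∘ Φ) := by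
  -- `Φ` is taken to be the inverse of `Ψ`. Its description by truncations, and so its independence
  -- of the resolution, follows from `elToSq_mk`.
  let e : El R M ≃ Sq R M := Equiv.ofBijective elToSq elToSq_bijective
  have hcl := elemExtClass_bijective.{u + 1} (I R) (IM R M)
  exact ⟨e.symm, elToSq, elemExtClass (I R) (IM R M),
    fun X => ⟨ProjectiveResolution.of _⟩,
    fun X P' => ⟨⟨_, SqZeroExt.isTruncation_truncation P'⟩,
      fun φ h => e.symm_apply_eq.2 h.elToSq_mk.symm⟩,
    fun φ => exists_splitting isAdd_IM (eLowerExt φ),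
    fun φ S => ⟨exists_isRegularExt S, fun X h => h.elToSq_mk⟩, fun φ => rfl,
    e.apply_symm_apply, e.symm_apply_apply, hcl, hcl.comp e.symm.bijective⟩
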